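/- **Setting.** Let $n\ge 1$ and let $\mathscr S=(s_{ij})\in\mathbb R^{n\times n}$ be flat, i.e. $s_*/n\le s_{ij}\le s^*/n$ for all $i,j$, with constants $s^*>s_*>0$. (In applications $s_{ij}=\mathbb E|x_{ij}|^2$ is the variance matrix of a random matrix.) For $R\in\mathbb C^{2n\times 2n}$ put $\mathcal S[R]=\mathrm{diag}(\mathscr S r_2,\mathscr S^t r_1)$, where $(r_1,r_2)\in\mathbb C^n\times\mathbb C^n$ is the diagonal of $R$. Fix $\tau>1$. For $z\in\mathbb C$ with $|z|<\tau$ and $\eta\in(0,1]$ let $M=M(z,\eta)\in\mathbb C^{2n\times 2n}$ be the solution with positive definite imaginary part of the matrix Dyson equation $$-M^{-1}=\begin{pmatrix} i\eta & z\\ \bar z& i\eta\end{pmatrix}+\mathcal S[M].$$ Here $\mathrm{Re}\,R=\frac12(R+R^*)$ and $\mathrm{Im}\,R=\frac1{2i}(R-R^*)$, and $\mathrm{Im}\,M^{-1}$ means $\mathrm{Im}(M^{-1})$. Let $\langle V\rangle=\frac1{2n}\mathrm{Tr}\,V$, $\langle V,W\rangle=\langle V^*W\rangle$, $\rho=\frac1\pi\langle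 \mathrm{Im}\,M\rangle$, $E_-=\begin{pmatrix}1&0\\0&-1\end{pmatrix}$, and let $\mathcal B[R]=R-M\mathcal S[R]M$, a linear map on $\mathbb C^{2n\times 2n}$. $\mathcal B^*$ is its adjoint with respect to $\langle\cdot,\cdot\rangle$. For matrices $\|\cdot\|$ is the Euclidean operator norm, and for linear maps on matrices it is the operator norm induced by this norm. For $a,b\geq 0$, $a\lesssim b$ means $a\le Cb$ with a constant $C>0$ depending only on $s_*,s^*,\tau$; $a\sim b$ means $a\lesssim b$ and $b\lesssim a$; $X=Y+\mathcal O(\delta)$ means $\|X-Y\|\lesssim\delta$ (absolute value for scalars). **Proposition.** There are $\rho_*,\varepsilon>0$ depending only on $s_*,s^*,\tau$ such that, whenever $\rho+\eta/\rho\le\rho_*$, the following holds. 1. $\mathrm{spec}(\mathcal B)\cap\{|w|<\varepsilon\}=\{\beta,\beta_*\}$, where $\beta,\beta_*$ have geometric and algebraic multiplicity one, $0<|\beta_*|<|\beta|$, and $$|\beta_*|\sim\eta/\rho,\qquad |\beta|\sim\eta/\rho+\rho^2.$$ 2. There are $B,B_*,\widehat B,\widehat B_*\in\mathbb C^{2n\times2n}$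 with $\mathcal B[B_*]=\beta_*B_*$, $\mathcal B[B]=\beta B$, $\mathcal B^*[\widehat B_*]=\overline{\beta_*}\widehat B_*$, $\mathcal B^*[\widehat B]=\overline{\beta}\widehat B$ and $$B=\rho^{-1}\mathrm{Im}\,M-2i\rho^{-1}(\mathrm{Im}\,M)(\mathrm{Im}\,M^{-1})(\mathrm{Re}\,M)+\mathcal O(\rho^2+\eta/\rho),$$ $$B_*=\rho^{-1}E_-\mathrm{Im}\,M+\mathcal O(\rho^2+\eta/\rho),$$ $$\widehat B=-\rho^{-1}\mathrm{Im}(M^{-1})+\mathcal O(\rho^2+\eta/\rho),\qquad \widehat B_*=-\rho^{-1}E_-\mathrm{Im}(M^{-1})+\mathcal O(\rho^2+\eta/\rho).$$ For fixed $z$, all of $\beta,\beta_*,B,B_*,\widehat B,\widehat B_*$ are continuous functions of $\eta$ on the set of $\eta\in(0,1]$ with $\rho+\eta/\rho\le\rho_*$. 3. With $\psi=\rho^{-4}\langle[(\mathrm{Im}\,M)(\mathrm{Im}\,M^{-1})]^2\rangle$, $$\beta\langle\widehat B,B\rangle=\pi\eta\rho^{-1}+2\rho^2\psi+\mathcal O(\rho^3+\eta\rho+\eta^2/\rho^2),$$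 $$\beta_*\langle\widehat B_*,B_*\rangle=\pi\eta\rho^{-1}+\mathcal O(\rho^3+\eta\rho+\eta^2/\rho^2),$$ and $\psi\sim1$, $|\langle\widehat B,B\rangle|\sim1$, $|\langle\widehat B_*,B_*\rangle|\sim1$. 4. $\mathcal B$ is invertible, and if $\mathcal Q$ is the spectral projection of $\mathcal B$ associated with $\mathrm{spec}(\mathcal B)\setminus\{\beta,\beta_*\}$ then $$\|\mathcal B^{-1}\mathcal Q\|+\|(\mathcal B^*)^{-1}\mathcal Q^*\|\lesssim1.$$ -/

import Mathlib

open scoped Matrix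

/-- Complex `2n × 2n` matrices, indexed so that the four `n × n` blocks are visible. -/
abbrev BlockMat (n : ℕ) : Type := Matrix (Fin n ⊕ Fin n) (Fin n ⊕ Fin n) ℂ

/-- Linear maps on the space of `2n × 2n` matrices. -/
abbrev SuperOp (n : ℕ) : Type := Module.End ℂ (BlockMat n)

namespace BlockMat

variable {n : ℕ}

/-- The real part `Re R = (R + R^*) / 2` of a matrix. -/
noncomputable def rePart (R : BlockMat n) : BlockMat n := (1 / 2 : ℂ) • (R + Rᴴ)

/-- The imaginary part `Im R = (R - R^*) / (2i)` of a matrix. -/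
noncomputable def imPart (R : BlockMat n) : BlockMat n :=
  (1 / (2 * Complex.I) : ℂ) • (R - Rᴴ)

/-- The normalized trace `⟨V⟩ = (2n)⁻¹ Tr V`. -/
noncomputable def avg (V : BlockMat n) : ℂ := (2 * (n : ℂ))⁻¹ * V.trace

/-- The normalized Hilbert-Schmidt scalar product `⟨V, W⟩ = (2n)⁻¹ Tr (V^* W)`,
antilinear in the first argument. -/
noncomputable def hsInner (V W : BlockMat n) : ℂ := avg (Vᴴ * W)

/-- The block matrix `E_- = diag(1, -1)`. -/
def Eminus (n : ℕ) : BlockMat n := Matrix.fromBlocks 1 0 0 (-1)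

/-- The operator norm of a matrix induced by the Euclidean norm on `ℂ^{2n}`
(the normalization of the Euclidean norm drops out). -/
noncomputable def opNorm (R : BlockMat n) : ℝ :=
  ‖Matrix.toEuclideanCLM (n := Fin n ⊕ Fin n) (𝕜 := ℂ) R‖

end BlockMat

namespace SuperOp

open BlockMat

variable {n : ℕ}

open scoped Matrix.Norms.L2Operator in
/-- The operator norm of a linear map on matrices, where the space of matrices carries the
operator norm induced by the Euclidean norm. -/
noncomputable def superNorm (T : SuperOp n) : ℝ := ‖LinearMap.toContinuousLinearMap T‖

/-- The map `R ↦ A R B`. -/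
noncomputable def conj (A B : BlockMat n) : SuperOp n :=
  LinearMap.mulLeft ℂ A ∘ₗ LinearMap.mulRight ℂ B

/-- The adjoint of a linear map on matrices with respect to the Hilbert-Schmidt scalar product;
see `hsInner_hsAdjoint`. -/
noncomputable def hsAdjoint (T : SuperOp n) : SuperOp n where
  toFun W := Matrix.of fun i j => ((T (Matrix.single i j 1))ᴴ * W).trace
  map_add' V W := by
    ext i j
    simp [Matrix.mul_add, Matrix.trace_add]
  map_smul' c W := by
    ext i j
    simp [Matrix.trace_smul]

/-- The defining property of the Hilbert-Schmidt adjoint: `⟨T[V], W⟩ = ⟨V, T^*[W]⟩`. -/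
theorem hsInner_hsAdjoint (T : SuperOp n) (V W : BlockMat n) :
    hsInner (T V) W = hsInner V (hsAdjoint T W) := by
  unfold hsInner avg
  congr 1
  have hV : T V = ∑ i, ∑ j, V i j • T (Matrix.single i j 1) := by
    conv_lhs => rw [Matrix.matrix_eq_sum_single V]
    rw [map_sum]
    refine Finset.sum_congr rfl fun i _ => ?_
    rw [map_sum]
    refine Finset.sum_congr rfl fun j _ => ?_
    rw [← map_smul, Matrix.smul_single, smul_eq_mul, mul_one]
  rw [hV, Matrix.conjTranspose_sum, Finset.sum_mul, Matrix.trace_sum]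
  simp_rw [Matrix.conjTranspose_sum, Finset.sum_mul, Matrix.trace_sum,
    Matrix.conjTranspose_smul, Matrix.smul_mul, Matrix.trace_smul]
  rw [Finset.sum_comm]
  simp [Matrix.trace, Matrix.mul_apply, hsAdjoint]

/-- The generalized eigenspaces inside and outside of a set of complex numbers are complementary. -/
theorem isCompl_maxGenEigenspace (T : SuperOp n) (s : Set ℂ) :
    IsCompl (⨆ μ ∈ s, T.maxGenEigenspace μ) (⨆ μ ∈ sᶜ, T.maxGenEigenspace μ) := by
  constructor
  · exact T.independent_maxGenEigenspace.disjoint_biSup_biSup disjoint_compl_right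
  · rw [codisjoint_iff, ← T.iSup_maxGenEigenspace_eq_top]
    rw [← iSup_union, Set.union_compl_self, iSup_univ]

/-- The spectral projection of `T` associated to the part `s` of its spectrum: the (in general
not orthogonal) projection onto the sum of the generalized eigenspaces for the eigenvalues in `s`
along the sum of all other generalized eigenspaces. -/
noncomputable def spectralProjection (T : SuperOp n) (s : Set ℂ) : SuperOp n :=
  Submodule.projection _ _ (isCompl_maxGenEigenspace T s)

end SuperOp

namespace Dyson

open BlockMat SuperOp

variable {n : ℕ}

/-- The self-energy operator: `R` is mapped to the diagonal matrix with the vectors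
`S r₂` and `Sᵗ r₁` on its diagonal, where `(r₁, r₂)` is the diagonal of `R`. -/
noncomputable def selfEnergy (S : Matrix (Fin n) (Fin n) ℝ) : SuperOp n where
  toFun R := Matrix.fromBlocks
    (Matrix.diagonal (S.map Complex.ofReal *ᵥ fun i => R (Sum.inr i) (Sum.inr i))) 0
    0 (Matrix.diagonal ((S.map Complex.ofReal)ᵀ *ᵥ fun i => R (Sum.inl i) (Sum.inl i)))
  map_add' R R' := by
    rw [Matrix.fromBlocks_add, Matrix.diagonal_add, Matrix.diagonal_add]
    simp only [Matrix.add_apply, ← Pi.add_def, Matrix.mulVec_add, add_zero]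
  map_smul' c R := by
    rw [RingHom.id_apply, Matrix.fromBlocks_smul, ← Matrix.diagonal_smul, ← Matrix.diagonal_smul,
      ← Matrix.mulVec_smul, ← Matrix.mulVec_smul, smul_zero]
    rfl

/-- Flatness of the variance matrix: all entries lie between `s_* / n` and `s^* / n`. -/
def IsFlat (sLow sUp : ℝ) (S : Matrix (Fin n) (Fin n) ℝ) : Prop :=
  ∀ i j, sLow / n ≤ S i j ∧ S i j ≤ sUp / n

open scoped ComplexOrder in
/-- `M` solves the matrix Dyson equation with parameters `z` and `η`, and `Im M` is positive
definite. (Such a matrix is automatically invertible.) -/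
def IsSolution (S : Matrix (Fin n) (Fin n) ℝ) (z : ℂ) (η : ℝ) (M : BlockMat n) : Prop :=
  -M⁻¹ = Matrix.fromBlocks ((Complex.I * (η : ℂ)) • 1) (z • 1)
      ((starRingEnd ℂ) z • 1) ((Complex.I * (η : ℂ)) • 1) + selfEnergy S M ∧
    (imPart M).PosDef

/-- `ρ = π⁻¹ ⟨Im M⟩` (the trace of the Hermitian matrix `Im M` is real). -/
noncomputable def density (M : BlockMat n) : ℝ := (1 / Real.pi) * (avg (imPart M)).re

/-- The stability operator `R ↦ R - M S[R] M`. -/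
noncomputable def stabOp (S : Matrix (Fin n) (Fin n) ℝ) (M : BlockMat n) : SuperOp n :=
  1 - conj M M ∘ₗ selfEnergy S

/-- `ψ = ρ⁻⁴ ⟨[(Im M) (Im M⁻¹)]²⟩`, where `Im M⁻¹` is the imaginary part of `M⁻¹`
(the trace is real since both factors are Hermitian). -/
noncomputable def psi (M : BlockMat n) : ℝ :=
  (density M ^ 4)⁻¹ * (avg ((imPart M * imPart M⁻¹) ^ 2)).re

/-- For a family `M` of matrices indexed by `η`, the set of all `η ∈ (0, 1]` such that
`ρ + η / ρ ≤ r`. -/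
def regime (M : ℝ → BlockMat n) (r : ℝ) : Set ℝ :=
  {η | η ∈ Set.Ioc (0 : ℝ) 1 ∧ density (M η) + η / density (M η) ≤ r}

/-- `a ∼ b` with constant `C`. -/
def Comparable (C a b : ℝ) : Prop := a ≤ C * b ∧ b ≤ C * a

end Dyson

/-! The solution of the matrix Dyson equation is explicit in terms of one positive vector. By
uniqueness of the vector Dyson equation and its symmetry under `r ↦ -conj r`, the diagonal of `M` is
`i v` with `v > 0`. With `a = η + 𝕊 v`, where `𝕊` is the symmetric matrix with off-diagonal blocks
`S` and `Sᵗ`, with a prime for the exchange of the two blocks and with `u = 1 / (a a' + |z|²)`, one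
has `v = u a'`, and the off-diagonal blocks of `M` are diagonal with entries `-z u` and `-conj z u`.
Near the edge `v` and `a` are of order `ρ` and `u` is of order one (`edgeData_of_isPosSolution`).

Since the self-energy sees only diagonals, eigenvectors of `R ↦ R - M 𝒮[R] M` with eigenvalue `t ≠
1` correspond to eigenvectors of `K x = w (𝕊 x)' - v² 𝕊 x`, `w = u - v v' = |z|² u²`, with
eigenvalue `1 - t`. This is `edgeOp` with `σ = -1`. Flipping the sign of one block turns `K` into
the same operator with `σ = +1`, whose entries are positive. Its Perron vector gives the eigenvalue
`β_*`. The other eigenvalue also comes from Perron's theorem: a rank one correction of `K`, built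
from the known left eigenvector, makes all entries positive, and the Perron vector of the corrected
matrix turns out to be annihilated by the correction (`sum_blockSign_mul_deflVec`). So both
eigenvalues are real, and both eigenvectors are positive up to the block sign.

The sizes come from one identity. Pairing `x - K x` with `a` gives `t ⟨a, x⟩ = ⟨η + (1 - σ) 𝕊(v² a),
x⟩`, so `t` has order `η / ρ` for `σ = 1` and `η / ρ + ρ²` for `σ = -1`; with sharper input the same
identity gives the expansions. For the eigenvectors, `u (𝕊 ·)'` preserves each block and almost
fixes `v`; Doeblin's argument on each block shows that an approximate fixed vector of `K` is a
multiple of `v` on each block up to `δ = ρ² + η / ρ` (`norm_sub_blockSum_le`). For a positive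
eigenvector the two multiples are almost equal, because `(v 𝕊 x)²` has the same mass on both blocks.
For a general vector the two multiples are controlled by the two left eigenvectors, which are close
to `a / ρ` and its block-signed version. Hence the stability operator and its adjoint are bounded
below up to two functionals (`opNorm_le_stabOp`, `opNorm_le_hsAdjoint_stabOp`).

That lower bound, together with nonzero pairings of left and right eigenvectors, yields isolation
and simplicity of the two eigenvalues and the bounds on the complementary spectral subspace by pure
linear algebra (`Module.End.IsolatedPair`). Continuity in `η` follows from compactness and
uniqueness, both for `v` and for Perron vectors. -/

/-! ### Perron's theorem with continuity, and Doeblin's contraction argument. -/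

theorem Matrix.mulVec_pos_of_pos {ι : Type*} [Fintype ι] {A : Matrix ι ι ℝ}
    (hA : ∀ i j, 0 < A i j) {x : ι → ℝ} (hx : ∀ i, 0 ≤ x i) (hx0 : x ≠ 0) (i : ι) :
    0 < (A *ᵥ x) i := by
  obtain ⟨j, hj⟩ := Function.ne_iff.1 hx0
  exact Finset.sum_pos' (fun k _ => mul_nonneg (hA i k).le (hx k))
    ⟨j, Finset.mem_univ j, mul_pos (hA i j) (lt_of_le_of_ne (hx j) (Ne.symm hj))⟩

/-- Existence part of Perron's theorem for matrices with positive entries. -/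
theorem Matrix.exists_perron {ι : Type*} [Fintype ι] [Nonempty ι] {A : Matrix ι ι ℝ}
    (hA : ∀ i j, 0 < A i j) :
    ∃ x : ι → ℝ, ∃ r : ℝ, (∀ i, 0 < x i) ∧ ∑ i, x i = 1 ∧ A *ᵥ x = r • x := by
  classical
  -- Collatz–Wielandt: the Perron eigenvalue is the largest `t` for which some probability vector
  -- satisfies `t x ≤ A x`.
  let s : Set ((ι → ℝ) × ℝ) := {p | p.1 ∈ stdSimplex ℝ ι ∧ 0 ≤ p.2 ∧
    ∀ i, p.2 * p.1 i ≤ (A *ᵥ p.1) i}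
  have hbound : ∀ p ∈ s, p.2 ≤ ∑ i, ∑ j, A i j := by
    rintro ⟨x, t⟩ ⟨hx, ht, h⟩
    have h1 : t = ∑ i, t * x i := by rw [← Finset.mul_sum, hx.2, mul_one]
    simp only at h ⊢
    rw [h1]
    refine Finset.sum_le_sum fun i _ => (h i).trans ?_
    refine Finset.sum_le_sum fun j _ => ?_
    have : x j ≤ 1 := by
      rw [← hx.2]; exact Finset.single_le_sum (fun k _ => hx.1 k) (Finset.mem_univ j)
    nlinarith [hA i j]
  have hclosed : IsClosed s := by
    have e : s = {p | p.1 ∈ stdSimplex ℝ ι} ∩ ({p | 0 ≤ p.2} ∩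
      ⋂ i, {p | p.2 * p.1 i ≤ (A *ᵥ p.1) i}) := by
      ext p; simp [s]
    rw [e]
    refine ((isClosed_stdSimplex ℝ ι).preimage continuous_fst).inter
      ((isClosed_le continuous_const continuous_snd).inter (isClosed_iInter fun i => ?_))
    refine isClosed_le (by fun_prop) ?_
    simp only [Matrix.mulVec, dotProduct]
    fun_prop
  have hcompact : IsCompact s := by
    refine ((isCompact_stdSimplex ℝ ι).prod
      (isCompact_Icc (a := (0 : ℝ)) (b := ∑ i, ∑ j, A i j))).of_isClosed_subset hclosed ?_
    intro p hp
    exact ⟨hp.1, hp.2.1, hbound p hp⟩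
  have hne : s.Nonempty := by
    obtain ⟨i⟩ := ‹Nonempty ι›
    refine ⟨(Pi.single i 1, 0), single_mem_stdSimplex ℝ i, le_rfl, fun k => ?_⟩
    simpa using (hA k i).le
  obtain ⟨⟨x, t⟩, hxt, hmax⟩ := hcompact.exists_isMaxOn hne continuous_snd.continuousOn
  obtain ⟨hx, ht, h⟩ := hxt
  simp only at hx ht h
  have hx0 : x ≠ 0 := by
    rintro rfl
    simpa using hx.2
  have hy := Matrix.mulVec_pos_of_pos hA hx.1 hx0
  have heq : A *ᵥ x = t • x := by
    -- If `A x - t x` is nonnegative but not zero, applying `A` makes it strictly positive. Then the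
    -- normalized vector `A x` admits a value larger than `t`.
    by_contra hne
    have hd0 : A *ᵥ x - t • x ≠ 0 := sub_ne_zero.2 hne
    have hd : ∀ i, 0 < (A *ᵥ (A *ᵥ x - t • x)) i :=
      Matrix.mulVec_pos_of_pos hA (fun i => by simpa using h i) hd0
    obtain ⟨k, -, hk⟩ := Finset.exists_min_image Finset.univ
      (fun i => (A *ᵥ (A *ᵥ x - t • x)) i / (A *ᵥ x) i) Finset.univ_nonempty
    set e := (A *ᵥ (A *ᵥ x - t • x)) k / (A *ᵥ x) k with he
    have hepos : 0 < e := div_pos (hd k) (hy k)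
    set Y := ∑ i, (A *ᵥ x) i with hY
    have hYpos : 0 < Y := Finset.sum_pos (fun i _ => hy i) Finset.univ_nonempty
    have hmem : ((Y⁻¹ • (A *ᵥ x), t + e) : (ι → ℝ) × ℝ) ∈ s := by
      refine ⟨⟨fun i => ?_, ?_⟩, by positivity, fun i => ?_⟩
      · simpa using mul_nonneg (inv_nonneg.2 hYpos.le) (hy i).le
      · simp only [Pi.smul_apply, smul_eq_mul, ← Finset.mul_sum]
        exact inv_mul_cancel₀ hYpos.ne'
      · have h1 := (le_div_iff₀ (hy i)).1 (hk i (Finset.mem_univ i))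
        rw [Matrix.mulVec_sub, Matrix.mulVec_smul] at h1
        simp only [Pi.sub_apply, Pi.smul_apply, smul_eq_mul] at h1
        simp only [Matrix.mulVec_smul, Pi.smul_apply, smul_eq_mul]
        have : (t + e) * (A *ᵥ x) i ≤ (A *ᵥ (A *ᵥ x)) i := by linarith
        have := mul_le_mul_of_nonneg_left this (inv_nonneg.2 hYpos.le)
        linarith
    have := hmax hmem
    simp only [Set.mem_ofPred_eq] at this
    linarith
  refine ⟨x, t, fun i => ?_, hx.2, heq⟩
  have h1 := hy i
  rw [heq] at h1
  exact pos_of_mul_pos_right h1 ht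

/-- A subinvariant vector bounds the Perron eigenvalue from below. -/
theorem Matrix.le_of_perron {ι : Type*} [Fintype ι] [Nonempty ι] {A : Matrix ι ι ℝ}
    (hA : ∀ i j, 0 < A i j) {x y : ι → ℝ} {r s : ℝ} (hx : ∀ i, 0 < x i) (hy : ∀ i, 0 < y i)
    (hAx : A *ᵥ x = r • x) (hAy : ∀ i, s * y i ≤ (A *ᵥ y) i) : s ≤ r := by
  obtain ⟨k, -, hk⟩ := Finset.exists_max_image Finset.univ
    (fun i => y i / x i) Finset.univ_nonempty
  set t := y k / x k with ht
  -- The multiple `t x` touches `y` from above at the coordinate `k`. Comparing `A (t x)` and `A y`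
  -- at this coordinate gives the inequality.
  have htk : t * x k = y k := div_mul_cancel₀ _ (hx k).ne'
  have h0 : 0 ≤ (A *ᵥ (t • x - y)) k := by
    refine Finset.sum_nonneg fun i _ => mul_nonneg (hA k i).le ?_
    have := (div_le_iff₀ (hx i)).1 (hk i (Finset.mem_univ i))
    simpa using this
  rw [Matrix.mulVec_sub, Matrix.mulVec_smul, hAx] at h0
  simp only [Pi.sub_apply, Pi.smul_apply, smul_eq_mul] at h0
  have h1 := hAy k
  have h2 : s * y k ≤ r * y k := by rw [← htk] at h1 ⊢; linarith
  exact le_of_mul_le_mul_right h2 (hy k)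

/-- Uniqueness part of Perron's theorem. -/
theorem Matrix.perron_unique {ι : Type*} [Fintype ι] [Nonempty ι] {A : Matrix ι ι ℝ}
    (hA : ∀ i j, 0 < A i j) {x y : ι → ℝ} {r s : ℝ} (hx : ∀ i, 0 < x i) (hy : ∀ i, 0 < y i)
    (hxs : ∑ i, x i = 1) (hys : ∑ i, y i = 1)
    (hAx : A *ᵥ x = r • x) (hAy : A *ᵥ y = s • y) : x = y := by
  have hrs : r = s := le_antisymm
    (Matrix.le_of_perron hA hy hx hAy fun i => by rw [hAx]; rfl)
    (Matrix.le_of_perron hA hx hy hAx fun i => by rw [hAy]; rfl)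
  subst hrs
  obtain ⟨k, -, hk⟩ := Finset.exists_max_image Finset.univ
    (fun i => y i / x i) Finset.univ_nonempty
  set t := y k / x k with ht
  have htk : t * x k = y k := div_mul_cancel₀ _ (hx k).ne'
  have h0 : t • x - y = 0 := by
    by_contra hne
    have := Matrix.mulVec_pos_of_pos hA (fun i => by
      have := (div_le_iff₀ (hx i)).1 (hk i (Finset.mem_univ i))
      simpa using this) hne k
    rw [Matrix.mulVec_sub, Matrix.mulVec_smul, hAx, hAy] at this
    simp only [Pi.sub_apply, Pi.smul_apply, smul_eq_mul] at this
    rw [← htk] at this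
    linarith
  have h1 : t • x = y := sub_eq_zero.1 h0
  have h2 : t = 1 := by
    rw [← hys, ← h1]
    simp [← Finset.mul_sum, hxs]
  rw [← h1, h2, one_smul]

open Classical in
/-- The normalized Perron eigenvector of a matrix with positive entries. -/
noncomputable def Matrix.perronVec {ι : Type*} [Fintype ι] (A : Matrix ι ι ℝ) : ι → ℝ :=
  if h : ∃ x : ι → ℝ, ∃ r : ℝ, (∀ i, 0 < x i) ∧ ∑ i, x i = 1 ∧ A *ᵥ x = r • x
  then h.choose else 0

/-- The Perron eigenvalue of a matrix with positive entries. -/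
noncomputable def Matrix.perronVal {ι : Type*} [Fintype ι] (A : Matrix ι ι ℝ) : ℝ :=
  ∑ i, (A *ᵥ A.perronVec) i

theorem Matrix.perron_spec {ι : Type*} [Fintype ι] [Nonempty ι] {A : Matrix ι ι ℝ}
    (hA : ∀ i j, 0 < A i j) : (∀ i, 0 < A.perronVec i) ∧ ∑ i, A.perronVec i = 1 ∧
      A *ᵥ A.perronVec = A.perronVal • A.perronVec := by
  have h := Matrix.exists_perron hA
  have e : A.perronVec = h.choose := dif_pos h
  obtain ⟨r, h1, h2, h3⟩ := h.choose_spec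
  rw [← e] at h1 h2 h3
  refine ⟨h1, h2, ?_⟩
  have : A.perronVal = r := by
    rw [Matrix.perronVal, h3]
    simp [← Finset.mul_sum, h2]
  rw [this, h3]

/-- A map with values in a compact set is continuous at a point as soon as all its limit values
there agree with its value. -/
theorem tendsto_of_isCompact_of_unique {X Y : Type*} [TopologicalSpace Y]
    {l : Filter X} {f : X → Y} {K : Set Y} {y : Y} (hK : IsCompact K) (hf : ∀ᶠ x in l, f x ∈ K)
    (huniq : ∀ z, (∃ U : Ultrafilter X, ↑U ≤ l ∧ Filter.Tendsto f U (nhds z)) → z = y) :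
    Filter.Tendsto f l (nhds y) := by
  rw [Filter.tendsto_iff_ultrafilter]
  intro U hU
  obtain ⟨z, hz, hz2⟩ := hK.ultrafilter_le_nhds (U.map f)
    (Filter.le_principal_iff.2 (hU hf))
  have := huniq z ⟨U, hU, hz2⟩
  subst this
  exact hz2

/-- Perron vectors live in the compact simplex. A limit of them is a nonnegative eigenvector of the
limit matrix, hence positive, hence the Perron vector by uniqueness. -/
theorem Matrix.continuousOn_perronVec {ι X : Type*} [Fintype ι] [Nonempty ι] [TopologicalSpace X]
    {A : X → Matrix ι ι ℝ} {s : Set X} (hA : ContinuousOn A s)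
    (hpos : ∀ x ∈ s, ∀ i j, 0 < A x i j) : ContinuousOn (fun x => (A x).perronVec) s := by
  intro x₀ hx₀
  refine tendsto_of_isCompact_of_unique (isCompact_stdSimplex ℝ ι) ?_ ?_
  · filter_upwards [self_mem_nhdsWithin] with x hx
    have := Matrix.perron_spec (hpos x hx)
    exact ⟨fun i => (this.1 i).le, this.2.1⟩
  rintro y ⟨U, hU, hy⟩
  have hUs : ∀ᶠ x in (U : Filter X), x ∈ s := hU self_mem_nhdsWithin
  have hAU : Filter.Tendsto A U (nhds (A x₀)) := (hA x₀ hx₀).mono_left hU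
  have hmv : Filter.Tendsto (fun x => A x *ᵥ (A x).perronVec) U (nhds (A x₀ *ᵥ y)) := by
    have hc : Continuous fun p : Matrix ι ι ℝ × (ι → ℝ) => p.1 *ᵥ p.2 := by fun_prop
    exact (hc.tendsto (A x₀, y)).comp (hAU.prodMk_nhds hy)
  have hval : Filter.Tendsto (fun x => (A x).perronVal) U (nhds (∑ i, (A x₀ *ᵥ y) i)) := by
    have hc : Continuous fun p : ι → ℝ => ∑ i, p i := by fun_prop
    exact (hc.tendsto _).comp hmv
  have heq : A x₀ *ᵥ y = (∑ i, (A x₀ *ᵥ y) i) • y := by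
    refine tendsto_nhds_unique hmv ?_
    refine (hval.smul hy).congr' ?_
    filter_upwards [hUs] with x hx
    exact (Matrix.perron_spec (hpos x hx)).2.2.symm
  have hy1 : y ∈ stdSimplex ℝ ι := by
    refine (isClosed_stdSimplex ℝ ι).mem_of_tendsto hy ?_
    filter_upwards [hUs] with x hx
    have := Matrix.perron_spec (hpos x hx)
    exact ⟨fun i => (this.1 i).le, this.2.1⟩
  have hy0 : y ≠ 0 := by rintro rfl; simpa using hy1.2
  have hypos : ∀ i, 0 < y i := by
    intro i
    have h1 := Matrix.mulVec_pos_of_pos (hpos x₀ hx₀) hy1.1 hy0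
    have h2 := h1 i
    rw [heq] at h2
    exact pos_of_mul_pos_right h2 (Finset.sum_nonneg fun j _ => (h1 j).le)
  have h0 := Matrix.perron_spec (hpos x₀ hx₀)
  exact Matrix.perron_unique (hpos x₀ hx₀) hypos h0.1 hy1.2 h0.2.1 heq h0.2.2

theorem Matrix.continuousOn_perronVal {ι X : Type*} [Fintype ι] [Nonempty ι] [TopologicalSpace X]
    {A : X → Matrix ι ι ℝ} {s : Set X} (hA : ContinuousOn A s)
    (hpos : ∀ x ∈ s, ∀ i j, 0 < A x i j) : ContinuousOn (fun x => (A x).perronVal) s := by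
  have hc : Continuous fun p : Matrix ι ι ℝ × (ι → ℝ) => ∑ i, (p.1 *ᵥ p.2) i := by fun_prop
  have h := hA.prodMk (Matrix.continuousOn_perronVec hA hpos)
  have h' := hc.comp_continuousOn (f := fun x => (A x, (A x).perronVec)) h
  simpa only [Matrix.perronVal, Function.comp_def] using h'

/-- Doeblin's argument: if a nonnegative matrix `T` has the positive subsolution `v` and dominates
`q`, then a vector `x` is controlled by `x - T x` and `q x`. -/
theorem Matrix.norm_le_of_doeblin {ι : Type*} [Fintype ι] [Nonempty ι] {T q : Matrix ι ι ℝ}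
    {v : ι → ℝ} {c s t : ℝ} (hv : ∀ i, 0 < v i) (hc : 0 < c)
    (hTv : ∀ i, (T *ᵥ v) i ≤ v i) (hqT : ∀ i j, q i j ≤ T i j)
    (hqv : ∀ i, c * v i ≤ (q *ᵥ v) i) {x : ι → ℂ}
    (hx : ∀ i, ‖∑ j, (q i j : ℂ) * x j‖ ≤ t * v i)
    (hxT : ∀ i, ‖x i - ∑ j, (T i j : ℂ) * x j‖ ≤ s * v i) (i : ι) :
    ‖x i‖ ≤ (t + s) / c * v i := by
  obtain ⟨k, -, hk⟩ := Finset.exists_max_image Finset.univ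
    (fun i => ‖x i‖ / v i) Finset.univ_nonempty
  set m := ‖x k‖ / v k with hm
  have hmk : m * v k = ‖x k‖ := div_mul_cancel₀ _ (hv k).ne'
  have hle : ∀ j, ‖x j‖ ≤ m * v j := fun j => (div_le_iff₀ (hv j)).1 (hk j (Finset.mem_univ j))
  -- At the index where `|x| / v` is maximal, `T x` is split into `q x`, which is controlled by
  -- assumption, and the nonnegative remainder `(T - q) x`, which contracts by the factor `1 - c`
  -- relative to `v`.
  have e : x k = (x k - ∑ j, (T k j : ℂ) * x j) + ∑ j, (q k j : ℂ) * x j +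
      ∑ j, ((T k j - q k j : ℝ) : ℂ) * x j := by
    simp only [Complex.ofReal_sub, sub_mul, Finset.sum_sub_distrib]
    ring
  have h3 : ‖∑ j, ((T k j - q k j : ℝ) : ℂ) * x j‖ ≤ m * ((T *ᵥ v) k - (q *ᵥ v) k) := by
    refine (norm_sum_le _ _).trans ?_
    simp only [Matrix.mulVec, dotProduct, ← Finset.sum_sub_distrib, Finset.mul_sum]
    refine Finset.sum_le_sum fun j _ => ?_
    rw [norm_mul, Complex.norm_real, Real.norm_of_nonneg (sub_nonneg.2 (hqT k j))]
    have := mul_le_mul_of_nonneg_left (hle j) (sub_nonneg.2 (hqT k j))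
    linarith
  have hm0 : 0 ≤ m := div_nonneg (norm_nonneg _) (hv k).le
  have h4 : ‖x k‖ ≤ s * v k + t * v k + m * (v k - c * v k) := by
    have h5 : m * ((T *ᵥ v) k - (q *ᵥ v) k) ≤ m * (v k - c * v k) :=
      mul_le_mul_of_nonneg_left (by linarith [hTv k, hqv k]) hm0
    rw [e]
    exact (norm_add₃_le).trans (add_le_add_three (hxT k) (hx k) (h3.trans h5))
  have h6 : m * c ≤ t + s := by
    rw [← hmk] at h4
    have : m * c * v k ≤ (t + s) * v k := by linarith
    exact le_of_mul_le_mul_right this (hv k)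
  exact (hle i).trans (mul_le_mul_of_nonneg_right ((le_div_iff₀ hc).2 h6) (hv i).le)

/-! ### Edge data, the reduced operator on diagonals, and its almost fixed vectors. -/

namespace Dyson

variable {n : ℕ}

/-- The symmetric matrix with off-diagonal blocks `S` and `Sᵗ`. -/
def symS (S : Matrix (Fin n) (Fin n) ℝ) : Matrix (Fin n ⊕ Fin n) (Fin n ⊕ Fin n) ℝ :=
  Matrix.fromBlocks 0 S Sᵀ 0

/-- The sum of the entries of `x` in the block containing `i`. -/
def blockSum {α : Type*} [AddCommMonoid α] (x : Fin n ⊕ Fin n → α) (i : Fin n ⊕ Fin n) : α :=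
  Sum.elim (fun _ => ∑ j, x (Sum.inl j)) (fun _ => ∑ j, x (Sum.inr j)) i

/-- The quantities describing the solution of the Dyson equation near the spectral edge, with
comparison constant `k`. -/
structure EdgeData (k : ℝ) (S : Matrix (Fin n) (Fin n) ℝ) (zz η ρ : ℝ)
    (v a u : Fin n ⊕ Fin n → ℝ) : Prop where
  one_le : 1 ≤ k
  n_pos : 0 < n
  η_pos : 0 < η
  ρ_pos : 0 < ρ
  ρ_le : ρ ≤ 1
  S_lb : ∀ i j, 1 / (k * n) ≤ S i j
  S_ub : ∀ i j, S i j ≤ k / n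
  a_eq : ∀ i, a i = η + (symS S *ᵥ v) i
  v_eq : ∀ i, v i = u i * a i.swap
  u_eq : ∀ i, u i * (a i * a i.swap + zz) = 1
  zz_nonneg : 0 ≤ zz
  u_lb : ∀ i, 1 / k ≤ u i
  u_ub : ∀ i, u i ≤ k
  v_lb : ∀ i, ρ / k ≤ v i
  v_ub : ∀ i, v i ≤ k * ρ
  a_lb : ∀ i, ρ / k ≤ a i
  a_ub : ∀ i, a i ≤ k * ρ
  sum_v : ∀ i, blockSum v i = n * Real.pi * ρ

/-- The matrix `x ↦ w (𝕊 x)' + σ v² 𝕊 x`, where the prime exchanges the blocks and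
`w = u - v v'`. -/
def edgeOp (S : Matrix (Fin n) (Fin n) ℝ) (v u : Fin n ⊕ Fin n → ℝ) (σ : ℝ) :
    Matrix (Fin n ⊕ Fin n) (Fin n ⊕ Fin n) ℝ :=
  Matrix.of fun i j => (u i - v i * v i.swap) * symS S i.swap j + σ * v i ^ 2 * symS S i j

theorem edgeOp_mulVec (S : Matrix (Fin n) (Fin n) ℝ) (v u : Fin n ⊕ Fin n → ℝ) (σ : ℝ)
    (x : Fin n ⊕ Fin n → ℝ) (i : Fin n ⊕ Fin n) :
    (edgeOp S v u σ *ᵥ x) i = (u i - v i * v i.swap) * (symS S *ᵥ x) i.swap +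
      σ * v i ^ 2 * (symS S *ᵥ x) i := by
  simp only [edgeOp, Matrix.mulVec, dotProduct, Matrix.of_apply, Finset.mul_sum,
    ← Finset.sum_add_distrib]
  exact Finset.sum_congr rfl fun j _ => by ring

theorem symS_transpose (S : Matrix (Fin n) (Fin n) ℝ) : (symS S)ᵀ = symS S := by
  simp [symS, Matrix.fromBlocks_transpose]

theorem symS_comm (S : Matrix (Fin n) (Fin n) ℝ) (i j : Fin n ⊕ Fin n) :
    symS S i j = symS S j i := by
  conv_lhs => rw [← symS_transpose]
  rfl

theorem sum_mul_symS (S : Matrix (Fin n) (Fin n) ℝ) (x y : Fin n ⊕ Fin n → ℝ) :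
    ∑ i, x i * (symS S *ᵥ y) i = ∑ i, (symS S *ᵥ x) i * y i := by
  simp only [Matrix.mulVec, dotProduct, Finset.mul_sum, Finset.sum_mul]
  rw [Finset.sum_comm]
  refine Finset.sum_congr rfl fun j _ => Finset.sum_congr rfl fun i _ => ?_
  rw [symS_comm S i j]; ring

theorem sum_swap {α : Type*} [AddCommMonoid α] (f : Fin n ⊕ Fin n → α) :
    ∑ i, f (Sum.swap i) = ∑ i, f i :=
  Equiv.sum_comp (Equiv.sumComm (Fin n) (Fin n)) f

theorem blockSum_add_blockSum_swap {α : Type*} [AddCommMonoid α] (x : Fin n ⊕ Fin n → α)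
    (i : Fin n ⊕ Fin n) : blockSum x i + blockSum x i.swap = ∑ j, x j := by
  cases i <;> simp [blockSum, Fintype.sum_sum_type, add_comm]

theorem norm_blockSum_le {x : Fin n ⊕ Fin n → ℂ} {X : ℝ} (hx : ∀ i, ‖x i‖ ≤ X)
    (i : Fin n ⊕ Fin n) : ‖blockSum x i‖ ≤ n * X := by
  cases i
  · simp only [blockSum, Sum.elim_inl]
    refine (norm_sum_le _ _).trans ((Finset.sum_le_sum fun j _ => hx (Sum.inl j)).trans ?_)
    simp
  · simp only [blockSum, Sum.elim_inr]
    refine (norm_sum_le _ _).trans ((Finset.sum_le_sum fun j _ => hx (Sum.inr j)).trans ?_)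
    simp

/-- The complex linear extension of `symS S`. -/
noncomputable def symSC (S : Matrix (Fin n) (Fin n) ℝ) (x : Fin n ⊕ Fin n → ℂ)
    (i : Fin n ⊕ Fin n) : ℂ := ∑ j, (symS S i j : ℂ) * x j

theorem symSC_ofReal (S : Matrix (Fin n) (Fin n) ℝ) (x : Fin n ⊕ Fin n → ℝ)
    (i : Fin n ⊕ Fin n) : symSC S (fun j => (x j : ℂ)) i = ((symS S *ᵥ x) i : ℝ) := by
  simp [symSC, Matrix.mulVec, dotProduct]

theorem symSC_sub (S : Matrix (Fin n) (Fin n) ℝ) (x y : Fin n ⊕ Fin n → ℂ)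
    (i : Fin n ⊕ Fin n) : symSC S (fun j => x j - y j) i = symSC S x i - symSC S y i := by
  simp [symSC, mul_sub]

/-- The function constant on each block, multiplied by `v`, is mapped by `symS` blockwise. -/
theorem symSC_block_mul (S : Matrix (Fin n) (Fin n) ℝ) (α : Fin n ⊕ Fin n → ℂ)
    (hl : ∀ i j, α (Sum.inl i) = α (Sum.inl j)) (hr : ∀ i j, α (Sum.inr i) = α (Sum.inr j))
    (x : Fin n ⊕ Fin n → ℂ) (i : Fin n ⊕ Fin n) :
    symSC S (fun j => α j * x j) i = α i.swap * symSC S x i := by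
  cases i with
  | inl i =>
    simp only [symSC, Fintype.sum_sum_type, symS, Matrix.fromBlocks_apply₁₁,
      Matrix.fromBlocks_apply₁₂, Sum.swap_inl]
    simp only [Matrix.zero_apply, Complex.ofReal_zero, zero_mul, Finset.sum_const_zero,
      zero_add]
    rw [Finset.mul_sum]
    refine Finset.sum_congr rfl ?_
    intro j _
    rw [hr i j]; ring
  | inr i =>
    simp only [symSC, Fintype.sum_sum_type, symS, Matrix.fromBlocks_apply₂₁,
      Matrix.fromBlocks_apply₂₂, Sum.swap_inr]
    simp only [Matrix.zero_apply, Complex.ofReal_zero, zero_mul, Finset.sum_const_zero,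
      add_zero]
    rw [Finset.mul_sum]
    refine Finset.sum_congr rfl ?_
    intro j _
    rw [hl i j]; ring

theorem symSC_blockSum_mul (S : Matrix (Fin n) (Fin n) ℝ) (c : ℂ) (y x : Fin n ⊕ Fin n → ℂ)
    (i : Fin n ⊕ Fin n) :
    symSC S (fun j => c * blockSum y j * x j) i = c * blockSum y i.swap * symSC S x i :=
  symSC_block_mul S (fun j => c * blockSum y j) (fun _ _ => rfl) (fun _ _ => rfl) x i

namespace EdgeData

variable {k : ℝ} {S : Matrix (Fin n) (Fin n) ℝ} {zz η ρ : ℝ} {v a u : Fin n ⊕ Fin n → ℝ}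

theorem k_pos (h : EdgeData k S zz η ρ v a u) : 0 < k := by linarith [h.one_le]

theorem n_pos' (h : EdgeData k S zz η ρ v a u) : (0 : ℝ) < n := by exact_mod_cast h.n_pos

theorem u_pos (h : EdgeData k S zz η ρ v a u) (i) : 0 < u i :=
  lt_of_lt_of_le (one_div_pos.2 h.k_pos) (h.u_lb i)

theorem v_pos (h : EdgeData k S zz η ρ v a u) (i) : 0 < v i :=
  lt_of_lt_of_le (div_pos h.ρ_pos h.k_pos) (h.v_lb i)

theorem a_pos (h : EdgeData k S zz η ρ v a u) (i) : 0 < a i :=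
  lt_of_lt_of_le (div_pos h.ρ_pos h.k_pos) (h.a_lb i)

theorem S_pos (h : EdgeData k S zz η ρ v a u) (i j) : 0 < S i j :=
  lt_of_lt_of_le (one_div_pos.2 (mul_pos h.k_pos h.n_pos')) (h.S_lb i j)

theorem u_swap (h : EdgeData k S zz η ρ v a u) (i) : u i.swap = u i := by
  have h1 := h.u_eq i
  have h2 := h.u_eq i.swap
  rw [Sum.swap_swap, mul_comm (a i.swap)] at h2
  have h3 : a i * a i.swap + zz ≠ 0 := by rintro h0; simp [h0] at h1
  exact mul_right_cancel₀ h3 (h2.trans h1.symm)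

/-- Both sides equal `u a a'`. This symmetry makes weighted sums over the two blocks agree and is
what couples the blocks later on. -/
theorem va_swap (h : EdgeData k S zz η ρ v a u) (i) : v i.swap * a i.swap = v i * a i := by
  rw [h.v_eq i, h.v_eq i.swap, h.u_swap, Sum.swap_swap]; ring

/-- `w = u - v v'` equals `|z|² u²`. -/
theorem w_eq (h : EdgeData k S zz η ρ v a u) (i) : u i - v i * v i.swap = zz * u i ^ 2 := by
  have h1 := h.u_eq i
  rw [h.v_eq i, h.v_eq i.swap, h.u_swap, Sum.swap_swap]
  linear_combination (-u i) * h1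

theorem symS_nonneg (h : EdgeData k S zz η ρ v a u) (i j) : 0 ≤ symS S i j := by
  cases i <;> cases j <;> simp [symS, (h.S_pos _ _).le]

theorem symS_le (h : EdgeData k S zz η ρ v a u) (i j) : symS S i j ≤ k / n := by
  have := h.k_pos
  have : 0 ≤ k / n := by positivity
  cases i <;> cases j <;> simp [symS, h.S_ub, this]

theorem sum_symS_le (h : EdgeData k S zz η ρ v a u) (i) : ∑ j, symS S i j ≤ k := by
  have hn := h.n_pos'
  have hk : ∑ _j : Fin n, k / (n : ℝ) = k := by simp; field_simp
  cases i with
  | inl i =>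
    simp only [Fintype.sum_sum_type, symS, Matrix.fromBlocks_apply₁₁, Matrix.fromBlocks_apply₁₂,
      Matrix.zero_apply, Finset.sum_const_zero, zero_add]
    exact (Finset.sum_le_sum fun j _ => h.S_ub i j).trans hk.le
  | inr i =>
    simp only [Fintype.sum_sum_type, symS, Matrix.fromBlocks_apply₂₁, Matrix.fromBlocks_apply₂₂,
      Matrix.zero_apply, Finset.sum_const_zero, add_zero, Matrix.transpose_apply]
    exact (Finset.sum_le_sum fun j _ => h.S_ub j i).trans hk.le

theorem norm_symSC_le (h : EdgeData k S zz η ρ v a u) {x : Fin n ⊕ Fin n → ℂ} {X : ℝ}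
    (hX : 0 ≤ X) (hx : ∀ i, ‖x i‖ ≤ X) (i) : ‖symSC S x i‖ ≤ k * X := by
  refine (norm_sum_le _ _).trans ?_
  refine le_trans ?_ (mul_le_mul_of_nonneg_right (h.sum_symS_le i) hX)
  rw [Finset.sum_mul]
  refine Finset.sum_le_sum fun j _ => ?_
  rw [norm_mul, Complex.norm_real, Real.norm_of_nonneg (h.symS_nonneg i j)]
  exact mul_le_mul_of_nonneg_left (hx j) (h.symS_nonneg i j)

theorem le_symS_mulVec (h : EdgeData k S zz η ρ v a u) {x : Fin n ⊕ Fin n → ℝ}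
    (hx : ∀ i, 0 ≤ x i) (i) : 1 / (k * n) * blockSum x i.swap ≤ (symS S *ᵥ x) i := by
  cases i with
  | inl i =>
    simp only [Matrix.mulVec, dotProduct, Fintype.sum_sum_type, symS, Matrix.fromBlocks_apply₁₁,
      Matrix.fromBlocks_apply₁₂, Matrix.zero_apply, zero_mul, Finset.sum_const_zero, zero_add,
      blockSum, Sum.swap_inl, Sum.elim_inr, Finset.mul_sum]
    exact Finset.sum_le_sum fun j _ => mul_le_mul_of_nonneg_right (h.S_lb i j) (hx _)
  | inr i =>
    simp only [Matrix.mulVec, dotProduct, Fintype.sum_sum_type, symS, Matrix.fromBlocks_apply₂₁,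
      Matrix.fromBlocks_apply₂₂, Matrix.zero_apply, zero_mul, Finset.sum_const_zero, add_zero,
      blockSum, Sum.swap_inr, Sum.elim_inl, Finset.mul_sum, Matrix.transpose_apply]
    exact Finset.sum_le_sum fun j _ => mul_le_mul_of_nonneg_right (h.S_lb j i) (hx _)

theorem symS_mulVec_le (h : EdgeData k S zz η ρ v a u) {x : Fin n ⊕ Fin n → ℝ}
    (hx : ∀ i, 0 ≤ x i) (i) : (symS S *ᵥ x) i ≤ k / n * ∑ j, x j := by
  simp only [Matrix.mulVec, dotProduct, Finset.mul_sum]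
  exact Finset.sum_le_sum fun j _ => mul_le_mul_of_nonneg_right (h.symS_le i j) (hx j)

/-- Up to the error `δ = ρ² + η / ρ`, a vector `x` is on each block a multiple of `v`,
provided `x - K x` is small. -/
theorem norm_sub_blockSum_le (h : EdgeData k S zz η ρ v a u) {σ : ℝ} (hσ : |σ| ≤ 1)
    {x : Fin n ⊕ Fin n → ℂ} {X N : ℝ} (hX : ∀ i, ‖x i‖ ≤ X)
    (hN : ∀ i, ‖x i - ((u i - v i * v i.swap : ℝ) * symSC S x i.swap +
      (σ * v i ^ 2 : ℝ) * symSC S x i)‖ ≤ N) (i) :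
    ‖x i - ((n * Real.pi * ρ : ℝ) : ℂ)⁻¹ * blockSum x i * (v i : ℂ)‖ ≤
      3 * k ^ 8 * (N + (ρ ^ 2 + η / ρ) * X) := by
  have hk := h.one_le
  have hk0 := h.k_pos
  have hn := h.n_pos'
  have hρ := h.ρ_pos
  have hη := h.η_pos
  have hX0 : 0 ≤ X := (norm_nonneg _).trans (hX i)
  have hN0 : 0 ≤ N := (norm_nonneg _).trans (hN i)
  have : Nonempty (Fin n ⊕ Fin n) := ⟨i⟩
  set c : ℂ := ((n * Real.pi * ρ : ℝ) : ℂ)⁻¹ with hc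
  have hd : 0 < (n * Real.pi * ρ : ℝ) := by positivity
  -- `T` is the part of the operator that survives at `ρ = 0`; it does not mix the blocks and
  -- satisfies `T v = v - η u`. The matrix `q` below it is constant on each diagonal block, so that
  -- `q y` sees only the block sums of `y`.
  let T : Matrix (Fin n ⊕ Fin n) (Fin n ⊕ Fin n) ℝ := Matrix.of fun i j => u i * symS S i.swap j
  let q : Matrix (Fin n ⊕ Fin n) (Fin n ⊕ Fin n) ℝ :=
    Matrix.fromBlocks (Matrix.of fun _ _ => 1 / (k ^ 2 * n)) 0 0
      (Matrix.of fun _ _ => 1 / (k ^ 2 * n))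
  have hq : ∀ (y : Fin n ⊕ Fin n → ℝ) i, (q *ᵥ y) i = 1 / (k ^ 2 * n) * blockSum y i := by
    intro y i
    cases i <;> simp [q, Matrix.mulVec, dotProduct, Fintype.sum_sum_type, blockSum,
      Finset.mul_sum]
  have hqC : ∀ (y : Fin n ⊕ Fin n → ℂ) i,
      ∑ j, (q i j : ℂ) * y j = (1 / (k ^ 2 * n) : ℝ) * blockSum y i := by
    intro y i
    cases i <;> simp [q, Fintype.sum_sum_type, blockSum, Finset.mul_sum]
  have hTC : ∀ (y : Fin n ⊕ Fin n → ℂ) i,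
      ∑ j, (T i j : ℂ) * y j = (u i : ℂ) * symSC S y i.swap := by
    intro y i
    simp only [T, Matrix.of_apply, symSC, Finset.mul_sum, Complex.ofReal_mul, mul_assoc]
  have hTv : ∀ i, (T *ᵥ v) i = v i - η * u i := by
    intro i
    have : (T *ᵥ v) i = u i * (symS S *ᵥ v) i.swap := by
      simp only [T, Matrix.mulVec, dotProduct, Matrix.of_apply, Finset.mul_sum, mul_assoc]
    rw [this, h.v_eq i, h.a_eq i.swap]; ring
  -- Subtracting the multiple of `v` with the same block sum makes `q y` vanish, so Doeblin's bound
  -- applies with `t = 0`.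
  let y : Fin n ⊕ Fin n → ℂ := fun i => x i - c * blockSum x i * (v i : ℂ)
  have hy0 : ∀ i, blockSum y i = 0 := by
    intro i
    have hvC : (blockSum (fun i => (v i : ℂ)) i) = ((n * Real.pi * ρ : ℝ) : ℂ) := by
      rw [← h.sum_v i]
      cases i <;> simp [blockSum]
    have hdC : ((n * Real.pi * ρ : ℝ) : ℂ) ≠ 0 := Complex.ofReal_ne_zero.2 hd.ne'
    have : blockSum y i = blockSum x i - c * blockSum x i * blockSum (fun i => (v i : ℂ)) i := by
      cases i <;> simp [blockSum, y, Finset.mul_sum]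
    rw [this, hvC, hc]
    field_simp
    ring
  have hcx : ∀ i, ‖c * blockSum x i‖ ≤ X / ρ := by
    intro i
    rw [norm_mul, hc, norm_inv, Complex.norm_real, Real.norm_of_nonneg hd.le,
      inv_mul_le_iff₀ hd]
    refine (norm_blockSum_le hX i).trans ?_
    have : n * Real.pi * ρ * (X / ρ) = n * X * Real.pi := by field_simp
    rw [this]
    have := Real.pi_gt_three
    exact le_mul_of_one_le_right (by positivity) (by linarith)
  have hsym := fun i => h.norm_symSC_le hX0 hX i
  have key : ∀ i, ‖y i - ∑ j, (T i j : ℂ) * y j‖ ≤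
      3 * k ^ 3 * (N + (ρ ^ 2 + η / ρ) * X) * (k / ρ) * v i := by
    intro i
    have e1 : symSC S y i.swap = symSC S x i.swap -
        c * blockSum x i * ((a i.swap - η : ℝ) : ℂ) := by
      have := symSC_blockSum_mul S c x (fun j => (v j : ℂ)) i.swap
      rw [Sum.swap_swap, symSC_ofReal] at this
      rw [h.a_eq i.swap, add_sub_cancel_left, ← this, ← symSC_sub]
    -- Four errors: the assumed one, the replacement of `w` by `u` and the loss of `σ v²` (each of
    -- size `ρ²`), and the defect `η u` of `T v = v`. The last is multiplied by a coefficient of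
    -- order `X / ρ`, whence `η / ρ`.
    have e2 : y i - ∑ j, (T i j : ℂ) * y j =
        (x i - ((u i - v i * v i.swap : ℝ) * symSC S x i.swap +
          (σ * v i ^ 2 : ℝ) * symSC S x i)) + (-((v i * v i.swap : ℝ) : ℂ) * symSC S x i.swap) +
          ((σ * v i ^ 2 : ℝ) : ℂ) * symSC S x i + -(c * blockSum x i) * ((η * u i : ℝ) : ℂ) := by
      rw [hTC, e1]
      have hv : (v i : ℂ) = u i * a i.swap := by exact_mod_cast h.v_eq i
      simp only [y]
      push_cast
      linear_combination (-(c * blockSum x i)) * hv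
    rw [e2]
    have hvi := h.v_ub i
    have hvi' := h.v_ub i.swap
    have hv0 := (h.v_pos i).le
    have hv0' := (h.v_pos i.swap).le
    have b1 : ‖-((v i * v i.swap : ℝ) : ℂ) * symSC S x i.swap‖ ≤ k ^ 3 * (ρ ^ 2 * X) := by
      rw [norm_mul, norm_neg, Complex.norm_real, Real.norm_of_nonneg (by positivity)]
      calc v i * v i.swap * ‖symSC S x i.swap‖ ≤ (k * ρ) * (k * ρ) * (k * X) := by
            gcongr; exact hsym _
        _ = _ := by ring
    have b2 : ‖((σ * v i ^ 2 : ℝ) : ℂ) * symSC S x i‖ ≤ k ^ 3 * (ρ ^ 2 * X) := by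
      rw [norm_mul, Complex.norm_real, Real.norm_eq_abs, abs_mul, abs_of_nonneg (sq_nonneg (v i))]
      calc |σ| * v i ^ 2 * ‖symSC S x i‖ ≤ 1 * (k * ρ) ^ 2 * (k * X) := by
            gcongr; exact hsym _
        _ = _ := by ring
    have b3 : ‖-(c * blockSum x i) * ((η * u i : ℝ) : ℂ)‖ ≤ k * (η / ρ * X) := by
      rw [norm_mul, norm_neg, Complex.norm_real,
        Real.norm_of_nonneg (mul_nonneg hη.le (h.u_pos i).le)]
      calc ‖c * blockSum x i‖ * (η * u i) ≤ X / ρ * (η * k) := by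
            gcongr
            · exact mul_nonneg hη.le (h.u_pos i).le
            · exact hcx i
            · exact h.u_ub i
        _ = _ := by ring
    have b4 : N + k ^ 3 * (ρ ^ 2 * X) + k ^ 3 * (ρ ^ 2 * X) + k * (η / ρ * X) ≤
        3 * k ^ 3 * (N + (ρ ^ 2 + η / ρ) * X) := by
      have h1 : 1 ≤ k ^ 3 := one_le_pow₀ hk
      have h2 : k ≤ k ^ 3 := le_self_pow₀ hk (by norm_num)
      have h3 : N ≤ k ^ 3 * N := le_mul_of_one_le_left hN0 h1
      have h4 : 0 ≤ η / ρ * X := by positivity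
      have h5 : 0 ≤ ρ ^ 2 * X := by positivity
      have h6 : k * (η / ρ * X) ≤ k ^ 3 * (η / ρ * X) := mul_le_mul_of_nonneg_right h2 h4
      have h7 : 0 ≤ k ^ 3 := by positivity
      have h8 := mul_nonneg h7 h4
      have h9 := mul_nonneg h7 h5
      have h10 := mul_nonneg h7 hN0
      linarith
    have b5 : 3 * k ^ 3 * (N + (ρ ^ 2 + η / ρ) * X) ≤
        3 * k ^ 3 * (N + (ρ ^ 2 + η / ρ) * X) * (k / ρ) * v i := by
      rw [mul_assoc _ (k / ρ)]
      refine le_mul_of_one_le_right (by positivity) ?_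
      rw [div_mul_eq_mul_div, le_div_iff₀ hρ, one_mul]
      have := h.v_lb i
      rw [div_le_iff₀ hk0] at this
      linarith
    exact (norm_add_le_of_le (norm_add_le_of_le (norm_add_le_of_le (hN i) b1) b2) b3).trans
      (b4.trans b5)
  -- The contraction constant: `q v = π ρ / k²` on every coordinate, while `v ≤ k ρ`, so `q v ≥ v /
  -- k³`.
  have main := Matrix.norm_le_of_doeblin (T := T) (q := q) (v := v) (c := 1 / k ^ 3) (t := 0)
    h.v_pos (by positivity)
    (fun i => by rw [hTv]; linarith [mul_pos hη (h.u_pos i)])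
    (fun i j => by
      have hu := h.u_lb i
      have e : 1 / (k ^ 2 * n) = 1 / k * (1 / (k * n)) := by
        rw [div_mul_div_comm, one_mul]; congr 1; ring
      have hu0 := (h.u_pos i).le
      cases i <;> cases j
      · simp only [q, T, Matrix.fromBlocks_apply₁₁, Matrix.of_apply, Sum.swap_inl, symS,
          Matrix.fromBlocks_apply₂₁, Matrix.transpose_apply]
        rw [e]
        exact mul_le_mul hu (h.S_lb _ _) (by positivity) hu0
      · simp [q, T, symS]
      · simp [q, T, symS]
      · simp only [q, T, Matrix.fromBlocks_apply₂₂, Matrix.of_apply, Sum.swap_inr, symS,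
          Matrix.fromBlocks_apply₁₂]
        rw [e]
        exact mul_le_mul hu (h.S_lb _ _) (by positivity) hu0)
    (fun i => by
      rw [hq, h.sum_v, div_mul_eq_mul_div, div_mul_eq_mul_div, one_mul, one_mul,
        div_le_div_iff₀ (by positivity) (by positivity)]
      have h1 := h.v_ub i
      have h2 := Real.pi_gt_three
      calc v i * (k ^ 2 * n) ≤ (k * ρ) * (k ^ 2 * n) := by gcongr
        _ = n * 1 * ρ * k ^ 3 := by ring
        _ ≤ n * Real.pi * ρ * k ^ 3 := by gcongr; linarith)
    (x := y) (fun i => by rw [hqC, hy0]; simp) key i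
  refine main.trans ?_
  have hvi := h.v_ub i
  rw [zero_add]
  calc 3 * k ^ 3 * (N + (ρ ^ 2 + η / ρ) * X) * (k / ρ) / (1 / k ^ 3) * v i
      ≤ 3 * k ^ 3 * (N + (ρ ^ 2 + η / ρ) * X) * (k / ρ) / (1 / k ^ 3) * (k * ρ) := by gcongr
    _ = _ := by field_simp

end EdgeData

end Dyson

/-! ### Positive eigenvectors of the reduced operator: eigenvalue size and shape. -/

namespace Dyson
namespace EdgeData

variable {n : ℕ} {k : ℝ} {S : Matrix (Fin n) (Fin n) ℝ} {zz η ρ : ℝ} {v a u : Fin n ⊕ Fin n → ℝ}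

theorem w_swap (h : EdgeData k S zz η ρ v a u) (i) :
    u i.swap - v i.swap * v i.swap.swap = u i - v i * v i.swap := by
  rw [h.u_swap, Sum.swap_swap, mul_comm (v i)]

theorem w_le (h : EdgeData k S zz η ρ v a u) (i) : u i - v i * v i.swap ≤ k := by
  have := h.u_ub i
  have := mul_pos (h.v_pos i) (h.v_pos i.swap)
  linarith

theorem w_nonneg (h : EdgeData k S zz η ρ v a u) (i) : 0 ≤ u i - v i * v i.swap := by
  rw [h.w_eq]
  exact mul_nonneg h.zz_nonneg (sq_nonneg _)

theorem symS_mulVec_nonneg (h : EdgeData k S zz η ρ v a u) {x : Fin n ⊕ Fin n → ℝ}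
    (hx : ∀ i, 0 ≤ x i) (i) : 0 ≤ (symS S *ᵥ x) i := by
  simp only [Matrix.mulVec, dotProduct]
  exact Finset.sum_nonneg fun j _ => mul_nonneg (h.symS_nonneg i j) (hx j)

/-- The vector `a` is almost a left eigenvector of `edgeOp`. -/
theorem sum_a_mul_sub (h : EdgeData k S zz η ρ v a u) (σ : ℝ) (x : Fin n ⊕ Fin n → ℝ) :
    ∑ i, a i * (x i - (edgeOp S v u σ *ᵥ x) i) =
      ∑ i, (η + (1 - σ) * (symS S *ᵥ fun j => v j ^ 2 * a j) i) * x i := by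
  simp only [edgeOp_mulVec, mul_sub, mul_add, Finset.sum_sub_distrib, Finset.sum_add_distrib,
    add_mul]
  -- After exchanging blocks the weight is `a' w = a' u - v (v' a') = v - v² a`, using `v = u a'`
  -- and `v' a' = v a`.
  have e1 : ∑ i, a i * ((u i - v i * v i.swap) * (symS S *ᵥ x) i.swap) =
      ∑ i, (v i - v i ^ 2 * a i) * (symS S *ᵥ x) i := by
    rw [← sum_swap]
    refine Finset.sum_congr rfl fun i _ => ?_
    rw [h.w_swap, Sum.swap_swap]
    have h1 := h.v_eq i
    have h2 := h.va_swap i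
    linear_combination (-(symS S *ᵥ x) i) * h1 - v i * (symS S *ᵥ x) i * h2
  have e2 : ∑ i, v i * (symS S *ᵥ x) i = ∑ i, (a i - η) * x i := by
    rw [sum_mul_symS]
    exact Finset.sum_congr rfl fun i _ => by rw [h.a_eq i]; ring
  have e3 : ∑ i, v i ^ 2 * a i * (symS S *ᵥ x) i =
      ∑ i, (symS S *ᵥ fun j => v j ^ 2 * a j) i * x i :=
    sum_mul_symS S (fun j => v j ^ 2 * a j) x
  have e4 : ∑ i, a i * (σ * v i ^ 2 * (symS S *ᵥ x) i) =
      σ * ∑ i, v i ^ 2 * a i * (symS S *ᵥ x) i := by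
    rw [Finset.mul_sum]
    exact Finset.sum_congr rfl fun i _ => by ring
  have e5 : ∑ i, (1 - σ) * (symS S *ᵥ fun j => v j ^ 2 * a j) i * x i =
      (1 - σ) * ∑ i, (symS S *ᵥ fun j => v j ^ 2 * a j) i * x i := by
    rw [Finset.mul_sum]
    exact Finset.sum_congr rfl fun i _ => by ring
  simp only [sub_mul (v _), Finset.sum_sub_distrib] at e1
  simp only [sub_mul (a _), Finset.sum_sub_distrib] at e2
  rw [e1, e4, e5, e2, e3]
  ring

theorem abs_sub_blockSum_le (h : EdgeData k S zz η ρ v a u) {σ : ℝ} (hσ : |σ| ≤ 1)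
    {x : Fin n ⊕ Fin n → ℝ} {X N : ℝ} (hX : ∀ i, |x i| ≤ X)
    (hN : ∀ i, |x i - (edgeOp S v u σ *ᵥ x) i| ≤ N) (i) :
    |x i - (n * Real.pi)⁻¹ * blockSum x i * (v i / ρ)| ≤
      3 * k ^ 8 * (N + (ρ ^ 2 + η / ρ) * X) := by
  have := h.norm_sub_blockSum_le hσ (x := fun j => (x j : ℂ)) (X := X) (N := N)
    (fun i => by simpa using hX i)
    (fun i => by
      rw [symSC_ofReal, symSC_ofReal]
      have := hN i
      rw [edgeOp_mulVec] at this
      exact_mod_cast this) i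
  have e : blockSum (fun j => (x j : ℂ)) i = (blockSum x i : ℝ) := by
    cases i <;> simp [blockSum]
  rw [e] at this
  have hρ := h.ρ_pos.ne'
  have e2 : x i - (n * Real.pi)⁻¹ * blockSum x i * (v i / ρ) =
      x i - (n * Real.pi * ρ)⁻¹ * blockSum x i * v i := by
    rw [mul_inv _ ρ]; ring
  rw [e2]
  exact_mod_cast this

section Eigenvector

variable {σ β : ℝ} {x : Fin n ⊕ Fin n → ℝ}

/-- The source of all information on the eigenvalue: for positive `x`, the weight `a` is of order
`ρ` and the weight on the right is of order `η + (1 - σ) ρ³`. The parameter `σ = 1` kills the cubic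
term, and this distinguishes `β_*` from `β`. -/
theorem eigenvalue_identity (h : EdgeData k S zz η ρ v a u)
    (hx : edgeOp S v u σ *ᵥ x = (1 - β) • x) :
    β * ∑ i, a i * x i =
      ∑ i, (η + (1 - σ) * (symS S *ᵥ fun j => v j ^ 2 * a j) i) * x i := by
  rw [← h.sum_a_mul_sub σ x, hx, Finset.mul_sum]
  refine Finset.sum_congr rfl fun i _ => ?_
  simp only [Pi.smul_apply, smul_eq_mul]
  ring

theorem symS_v_sq_mul_a_bounds (h : EdgeData k S zz η ρ v a u) (i) :
    ρ ^ 3 / k ^ 4 ≤ (symS S *ᵥ fun j => v j ^ 2 * a j) i ∧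
      (symS S *ᵥ fun j => v j ^ 2 * a j) i ≤ 2 * k ^ 4 * ρ ^ 3 := by
  have hk := h.k_pos
  have hρ := h.ρ_pos
  have hn := h.n_pos'
  have h1 : ∀ j, 0 ≤ v j ^ 2 * a j := fun j => by
    have := h.a_pos j
    positivity
  constructor
  · refine le_trans ?_ (h.le_symS_mulVec h1 i)
    have h2 : ∀ j, (ρ / k) ^ 3 ≤ v j ^ 2 * a j := fun j => by
      have := h.v_lb j
      have := h.a_lb j
      calc (ρ / k) ^ 3 = (ρ / k) ^ 2 * (ρ / k) := by ring
        _ ≤ _ := by gcongr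
    have h3 : n * (ρ / k) ^ 3 ≤ blockSum (fun j => v j ^ 2 * a j) i.swap := by
      cases i
      · have := Finset.sum_le_sum fun j (_ : j ∈ Finset.univ) => h2 (Sum.inr j)
        simpa [blockSum] using this
      · have := Finset.sum_le_sum fun j (_ : j ∈ Finset.univ) => h2 (Sum.inl j)
        simpa [blockSum] using this
    calc ρ ^ 3 / k ^ 4 = 1 / (k * n) * (n * (ρ / k) ^ 3) := by field_simp
      _ ≤ _ := by gcongr
  · refine (h.symS_mulVec_le h1 i).trans ?_
    have h2 : ∀ j ∈ Finset.univ, v j ^ 2 * a j ≤ (k * ρ) ^ 3 := fun j _ => by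
      have := h.v_ub j
      have := h.a_ub j
      have := (h.v_pos j).le
      have := (h.a_pos j).le
      calc v j ^ 2 * a j ≤ (k * ρ) ^ 2 * (k * ρ) := by gcongr
        _ = _ := by ring
    have h3 := Finset.sum_le_sum h2
    have h4 : ∑ _j : Fin n ⊕ Fin n, (k * ρ) ^ 3 = 2 * n * (k * ρ) ^ 3 := by
      rw [Finset.sum_const, Finset.card_univ, Fintype.card_sum, Fintype.card_fin, nsmul_eq_mul]
      push_cast
      ring
    rw [h4] at h3
    calc k / n * ∑ j, v j ^ 2 * a j ≤ k / n * (2 * n * (k * ρ) ^ 3) := by gcongr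
      _ = _ := by field_simp

theorem eigenvalue_lower (h : EdgeData k S zz η ρ v a u) (hσ : |σ| ≤ 1) (hx0 : ∀ i, 0 < x i)
    (hx : edgeOp S v u σ *ᵥ x = (1 - β) • x) :
    η + (1 - σ) * (ρ ^ 3 / k ^ 4) ≤ k * ρ * β := by
  have : Nonempty (Fin n ⊕ Fin n) := ⟨Sum.inl ⟨0, h.n_pos⟩⟩
  have hk := h.k_pos
  have hρ := h.ρ_pos
  have hσ1 := (abs_le.1 hσ).2
  have hP : 0 < ∑ i, x i := Finset.sum_pos (fun i _ => hx0 i) Finset.univ_nonempty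
  have h1 := h.eigenvalue_identity hx
  have h2 : (η + (1 - σ) * (ρ ^ 3 / k ^ 4)) * ∑ i, x i ≤ β * ∑ i, a i * x i := by
    rw [h1, Finset.mul_sum]
    refine Finset.sum_le_sum fun i _ => mul_le_mul_of_nonneg_right ?_ (hx0 i).le
    have := mul_le_mul_of_nonneg_left (h.symS_v_sq_mul_a_bounds i).1 (sub_nonneg.2 hσ1)
    linarith
  have h3 : ∑ i, a i * x i ≤ k * ρ * ∑ i, x i := by
    rw [Finset.mul_sum]
    exact Finset.sum_le_sum fun i _ => mul_le_mul_of_nonneg_right (h.a_ub i) (hx0 i).le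
  have h4 : 0 < ∑ i, a i * x i :=
    Finset.sum_pos (fun i _ => mul_pos (h.a_pos i) (hx0 i)) Finset.univ_nonempty
  have h5 : 0 < η + (1 - σ) * (ρ ^ 3 / k ^ 4) := by
    have := mul_nonneg (sub_nonneg.2 hσ1) (show 0 ≤ ρ ^ 3 / k ^ 4 by positivity)
    linarith [h.η_pos]
  have hβ : 0 < β := pos_of_mul_pos_left ((mul_pos h5 hP).trans_le h2) h4.le
  have h6 := h2.trans (mul_le_mul_of_nonneg_left h3 hβ.le)
  refine le_of_mul_le_mul_right (h6.trans (le_of_eq ?_)) hP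
  ring

theorem eigenvalue_pos (h : EdgeData k S zz η ρ v a u) (hσ : |σ| ≤ 1) (hx0 : ∀ i, 0 < x i)
    (hx : edgeOp S v u σ *ᵥ x = (1 - β) • x) : 0 < β := by
  have h1 := h.eigenvalue_lower hσ hx0 hx
  have h2 := mul_nonneg (sub_nonneg.2 (abs_le.1 hσ).2)
    (show 0 ≤ ρ ^ 3 / k ^ 4 by have := h.ρ_pos; have := h.k_pos; positivity)
  have h3 : 0 < k * ρ * β := by linarith [h.η_pos]
  exact pos_of_mul_pos_right h3 (mul_pos h.k_pos h.ρ_pos).le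

theorem eigenvalue_upper (h : EdgeData k S zz η ρ v a u) (hσ : |σ| ≤ 1) (hx0 : ∀ i, 0 < x i)
    (hx : edgeOp S v u σ *ᵥ x = (1 - β) • x) :
    ρ / k * β ≤ η + (1 - σ) * (2 * k ^ 4 * ρ ^ 3) := by
  have : Nonempty (Fin n ⊕ Fin n) := ⟨Sum.inl ⟨0, h.n_pos⟩⟩
  have hβ := h.eigenvalue_pos hσ hx0 hx
  have hσ1 := (abs_le.1 hσ).2
  have hP : 0 < ∑ i, x i := Finset.sum_pos (fun i _ => hx0 i) Finset.univ_nonempty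
  have h1 := h.eigenvalue_identity hx
  have h2 : β * ∑ i, a i * x i ≤ (η + (1 - σ) * (2 * k ^ 4 * ρ ^ 3)) * ∑ i, x i := by
    rw [h1, Finset.mul_sum]
    refine Finset.sum_le_sum fun i _ => mul_le_mul_of_nonneg_right ?_ (hx0 i).le
    have := mul_le_mul_of_nonneg_left (h.symS_v_sq_mul_a_bounds i).2 (sub_nonneg.2 hσ1)
    linarith
  have h3 : ρ / k * ∑ i, x i ≤ ∑ i, a i * x i := by
    rw [Finset.mul_sum]
    exact Finset.sum_le_sum fun i _ => mul_le_mul_of_nonneg_right (h.a_lb i) (hx0 i).le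
  have h6 := (mul_le_mul_of_nonneg_left h3 hβ.le).trans h2
  refine le_of_mul_le_mul_right (le_trans (le_of_eq ?_) h6) hP
  ring

theorem eigenvalue_le (h : EdgeData k S zz η ρ v a u) (hσ : |σ| ≤ 1) (hx0 : ∀ i, 0 < x i)
    (hx : edgeOp S v u σ *ᵥ x = (1 - β) • x) : β ≤ 4 * k ^ 5 * (ρ ^ 2 + η / ρ) := by
  have h1 := h.eigenvalue_upper hσ hx0 hx
  have hk := h.k_pos
  have hρ := h.ρ_pos
  have hη := h.η_pos
  have h2 : (1 - σ) * (2 * k ^ 4 * ρ ^ 3) ≤ 2 * (2 * k ^ 4 * ρ ^ 3) :=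
    mul_le_mul_of_nonneg_right (by linarith [(abs_le.1 hσ).1]) (by positivity)
  have h3 : η ≤ 4 * k ^ 4 * η := le_mul_of_one_le_left hη.le (by
    have := one_le_pow₀ (n := 4) h.one_le
    linarith)
  have h4 : ρ / k * β ≤ 4 * k ^ 4 * η + 4 * k ^ 4 * ρ ^ 3 := by linarith
  refine le_of_mul_le_mul_left (h4.trans (le_of_eq ?_)) (show 0 < ρ / k by positivity)
  field_simp
  ring

/-- The squares of `v 𝕊 x` have the same mass on both blocks. -/
theorem blockSum_sq_eq (h : EdgeData k S zz η ρ v a u) (hσ : σ ≠ 0)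
    (hx : edgeOp S v u σ *ᵥ x = (1 - β) • x) :
    ∑ i, (v (Sum.inl i) * (symS S *ᵥ x) (Sum.inl i)) ^ 2 =
      ∑ i, (v (Sum.inr i) * (symS S *ᵥ x) (Sum.inr i)) ^ 2 := by
  have e : ∀ i, σ * (v i * (symS S *ᵥ x) i) ^ 2 = (1 - β) * (x i * (symS S *ᵥ x) i) -
      (u i - v i * v i.swap) * ((symS S *ᵥ x) i * (symS S *ᵥ x) i.swap) := by
    intro i
    have := congrFun hx i
    -- The eigenvalue equation is multiplied by `𝕊 x`. The two other terms have equal sums over the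
    -- blocks: `x 𝕊 x` because `𝕊` exchanges the blocks symmetrically, and `w (𝕊 x) (𝕊 x)'` because
    -- it is invariant under the exchange.
    rw [edgeOp_mulVec, Pi.smul_apply, smul_eq_mul] at this
    linear_combination (symS S *ᵥ x) i * this
  have hbil : ∑ i, x (Sum.inl i) * (symS S *ᵥ x) (Sum.inl i) =
      ∑ i, x (Sum.inr i) * (symS S *ᵥ x) (Sum.inr i) := by
    simp only [symS, Matrix.mulVec, dotProduct, Fintype.sum_sum_type, Matrix.fromBlocks_apply₁₁,
      Matrix.fromBlocks_apply₁₂, Matrix.fromBlocks_apply₂₁, Matrix.fromBlocks_apply₂₂,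
      Matrix.zero_apply, zero_mul, Finset.sum_const_zero, zero_add, add_zero,
      Matrix.transpose_apply, Finset.mul_sum]
    rw [Finset.sum_comm]
    exact Finset.sum_congr rfl fun i _ => Finset.sum_congr rfl fun j _ => by ring
  refine mul_left_cancel₀ hσ ?_
  rw [Finset.mul_sum, Finset.mul_sum, Finset.sum_congr rfl fun i _ => e (Sum.inl i),
    Finset.sum_congr rfl fun i _ => e (Sum.inr i), Finset.sum_sub_distrib,
    Finset.sum_sub_distrib, ← Finset.mul_sum, ← Finset.mul_sum, hbil]
  congr 1
  refine Finset.sum_congr rfl fun i _ => ?_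
  have h1 := h.w_swap (Sum.inl i)
  simp only [Sum.swap_inl, Sum.swap_inr] at h1 ⊢
  rw [h1]; ring

theorem sum_eq_of_sum (h : EdgeData k S zz η ρ v a u) (hs : ∑ i, x i = 2 * n * Real.pi)
    (i : Fin n ⊕ Fin n) :
    (n * Real.pi)⁻¹ * blockSum x i + (n * Real.pi)⁻¹ * blockSum x i.swap = 2 := by
  have hn := h.n_pos'
  have := Real.pi_pos
  rw [← mul_add, blockSum_add_blockSum_swap, hs]
  field_simp

/-- The averaging by `𝕊` turns the normalization of the sum into a uniform bound on `𝕊 x`, and the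
eigenvalue equation transfers it to `x`, since `1 - β` is at least one half. -/
theorem eigenvector_le (h : EdgeData k S zz η ρ v a u) (hσ : |σ| ≤ 1) (hx0 : ∀ i, 0 < x i)
    (hs : ∑ i, x i = 2 * n * Real.pi) (hx : edgeOp S v u σ *ᵥ x = (1 - β) • x)
    (hβ : β ≤ 1 / 2) (i) : x i ≤ 32 * k ^ 3 ∧ (symS S *ᵥ x) i ≤ 8 * k := by
  have hk := h.k_pos
  have hk1 := h.one_le
  have hn := h.n_pos'
  have hs1 : ∀ i, (symS S *ᵥ x) i ≤ 8 * k := by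
    intro i
    refine (h.symS_mulVec_le (fun i => (hx0 i).le) i).trans ?_
    rw [hs]
    calc k / n * (2 * n * Real.pi) = 2 * k * Real.pi := by field_simp
      _ ≤ 2 * k * 4 := by gcongr; exact Real.pi_le_four
      _ = _ := by ring
  refine ⟨?_, hs1 i⟩
  have h1 := congrFun hx i
  rw [edgeOp_mulVec, Pi.smul_apply, smul_eq_mul] at h1
  have hs0 : ∀ i, 0 ≤ (symS S *ᵥ x) i := 
    h.symS_mulVec_nonneg fun j => (hx0 j).le
  have h2 : (u i - v i * v i.swap) * (symS S *ᵥ x) i.swap ≤ k * (8 * k) :=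
    mul_le_mul (h.w_le i) (hs1 _) (hs0 _) hk.le
  have hv0 := (h.v_pos i).le
  have hvk : v i ≤ k := (h.v_ub i).trans (mul_le_of_le_one_right hk.le h.ρ_le)
  have h3 : σ * v i ^ 2 * (symS S *ᵥ x) i ≤ 1 * k ^ 2 * (8 * k) := by
    calc σ * v i ^ 2 * (symS S *ᵥ x) i ≤ 1 * v i ^ 2 * (symS S *ᵥ x) i := by
          have := hs0 i
          have := (abs_le.1 hσ).2
          gcongr
      _ ≤ _ := by
          have := hs0 i
          gcongr
          exact hs1 i
  have h4 : x i ≤ 2 * ((1 - β) * x i) := by nlinarith [hx0 i]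
  have h5 : k ^ 2 ≤ k ^ 3 := pow_le_pow_right₀ hk1 (by norm_num)
  calc x i ≤ 2 * ((1 - β) * x i) := h4
    _ ≤ 2 * (k * (8 * k) + 1 * k ^ 2 * (8 * k)) := by rw [← h1]; linarith
    _ = 16 * k ^ 2 + 16 * k ^ 3 := by ring
    _ ≤ _ := by linarith

/-- A positive eigenvector of `edgeOp` agrees with `v / ρ` up to `δ = ρ² + η / ρ`. -/
theorem eigenvector_approx (h : EdgeData k S zz η ρ v a u) (hσ : |σ| ≤ 1) (hσ0 : σ ≠ 0)
    (hδ : 8 * k ^ 5 * (ρ ^ 2 + η / ρ) ≤ 1) (hx0 : ∀ i, 0 < x i)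
    (hs : ∑ i, x i = 2 * n * Real.pi) (hx : edgeOp S v u σ *ᵥ x = (1 - β) • x) (i) :
    |x i - v i / ρ| ≤ 4000 * k ^ 25 * (ρ ^ 2 + η / ρ) := by
  have hk := h.k_pos
  have hk1 := h.one_le
  have hn := h.n_pos'
  have hρ := h.ρ_pos
  have hη := h.η_pos
  have hpi := Real.pi_pos
  set δ := ρ ^ 2 + η / ρ with hδdef
  have hδ0 : 0 < δ := by positivity
  have hβle := h.eigenvalue_le hσ hx0 hx
  rw [← hδdef] at hβle
  have hβ0 := h.eigenvalue_pos hσ hx0 hx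
  have hβ : β ≤ 1 / 2 := by linarith
  have hX := fun i => (h.eigenvector_le hσ hx0 hs hx hβ i).1
  have hY := fun i => (h.eigenvector_le hσ hx0 hs hx hβ i).2
  -- The coefficients of `v / ρ` on the two blocks. They add up to 2 by the normalization, so it
  -- remains to show that they almost agree.
  set t : Fin n ⊕ Fin n → ℝ := fun i => (n * Real.pi)⁻¹ * blockSum x i with ht
  have ht0 : ∀ i, 0 ≤ t i := fun i => by
    have : 0 ≤ blockSum x i := by
      cases i
      · simp only [blockSum, Sum.elim_inl]
        exact Finset.sum_nonneg fun j _ => (hx0 _).le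
      · simp only [blockSum, Sum.elim_inr]
        exact Finset.sum_nonneg fun j _ => (hx0 _).le
    exact mul_nonneg (by positivity) this
  have ht2 : ∀ i, t i + t i.swap = 2 := h.sum_eq_of_sum hs
  have hpow : ∀ {a b : ℕ}, a ≤ b → k ^ a ≤ k ^ b := fun hab => pow_le_pow_right₀ hk1 hab
  have hC1 : ∀ i, |x i - t i * (v i / ρ)| ≤ 480 * k ^ 16 * δ := by
    intro i
    refine (h.abs_sub_blockSum_le hσ (X := 32 * k ^ 3) (N := β * (32 * k ^ 3))
      (fun i => by rw [abs_of_pos (hx0 i)]; exact hX i) (fun i => ?_) i).trans ?_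
    · rw [hx, Pi.smul_apply, smul_eq_mul]
      have : x i - (1 - β) * x i = β * x i := by ring
      rw [this, abs_of_pos (mul_pos hβ0 (hx0 i))]
      exact mul_le_mul_of_nonneg_left (hX i) hβ0.le
    · rw [← hδdef]
      calc 3 * k ^ 8 * (β * (32 * k ^ 3) + δ * (32 * k ^ 3))
          ≤ 3 * k ^ 8 * ((4 * k ^ 5 * δ) * (32 * k ^ 3) + δ * (32 * k ^ 3)) := by gcongr
        _ = (384 * k ^ 16 + 96 * k ^ 11) * δ := by ring
        _ ≤ (384 * k ^ 16 + 96 * k ^ 16) * δ := by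
            gcongr ?_ * δ
            linarith [hpow (show 11 ≤ 16 by norm_num)]
        _ = _ := by ring
  have hηδ : η / ρ ≤ δ := by rw [hδdef]; linarith [sq_nonneg ρ]
  have hC2 : ∀ i, |(symS S *ᵥ x) i - t i.swap * (a i / ρ)| ≤ 482 * k ^ 17 * δ := by
    intro i
    have h1 := h.norm_symSC_le (x := fun j => ((x j - t j * (v j / ρ) : ℝ) : ℂ))
      (X := 480 * k ^ 16 * δ) (by positivity) (fun i => by
        rw [Complex.norm_real]; exact hC1 i) i
    have h2 : symSC S (fun j => ((x j - t j * (v j / ρ) : ℝ) : ℂ)) i =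
        (((symS S *ᵥ x) i - t i.swap * ((a i - η) / ρ) : ℝ) : ℂ) := by
      have h3 := symSC_block_mul S (fun j => (t j : ℂ)) (fun _ _ => rfl) (fun _ _ => rfl)
        (fun j => ((v j / ρ : ℝ) : ℂ)) i
      have h4 : symSC S (fun j => ((v j / ρ : ℝ) : ℂ)) i = (((a i - η) / ρ : ℝ) : ℂ) := by
        rw [symSC_ofReal, h.a_eq i, add_sub_cancel_left]
        congr 1
        simp only [Matrix.mulVec, dotProduct, Finset.sum_div, mul_div_assoc]
      rw [h4] at h3
      push_cast at h3 ⊢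
      rw [← h3, symSC_sub, symSC_ofReal]
    rw [h2, Complex.norm_real, Real.norm_eq_abs] at h1
    have h5 : |(t i.swap * η / ρ)| ≤ 2 * δ := by
      rw [abs_of_nonneg (div_nonneg (mul_nonneg (ht0 _) hη.le) hρ.le), mul_div_assoc]
      exact mul_le_mul (by linarith [ht2 i, ht0 i]) hηδ (by positivity) (by norm_num)
    have h6 : (symS S *ᵥ x) i - t i.swap * (a i / ρ) =
        ((symS S *ᵥ x) i - t i.swap * ((a i - η) / ρ)) - t i.swap * η / ρ := by ring
    rw [h6]
    calc _ ≤ k * (480 * k ^ 16 * δ) + 2 * δ := (abs_sub _ _).trans (add_le_add h1 h5)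
      _ = (480 * k ^ 17 + 2 * 1) * δ := by ring
      _ ≤ (480 * k ^ 17 + 2 * k ^ 17) * δ := by
          gcongr
          exact one_le_pow₀ hk1
      _ = _ := by ring
  have hs0 : ∀ i, 0 ≤ (symS S *ᵥ x) i := 
    h.symS_mulVec_nonneg fun j => (hx0 j).le
  have hC3 : ∀ i, |(v i * (symS S *ᵥ x) i) ^ 2 - (t i.swap * (v i * a i / ρ)) ^ 2| ≤
      4820 * k ^ 20 * δ * ρ ^ 2 := by
    intro i
    have e : (v i * (symS S *ᵥ x) i) ^ 2 - (t i.swap * (v i * a i / ρ)) ^ 2 =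
        v i * (v i * (symS S *ᵥ x) i + t i.swap * (v i * a i / ρ)) *
          ((symS S *ᵥ x) i - t i.swap * (a i / ρ)) := by ring
    have hv := h.v_ub i
    have hv0 := (h.v_pos i).le
    have ha := h.a_ub i
    have ha0 := (h.a_pos i).le
    have b0 : 0 ≤ v i * (symS S *ᵥ x) i + t i.swap * (v i * a i / ρ) :=
      add_nonneg (mul_nonneg hv0 (hs0 i)) (mul_nonneg (ht0 _) (by positivity))
    have b1 : v i * (symS S *ᵥ x) i + t i.swap * (v i * a i / ρ) ≤ 10 * k ^ 2 * ρ := by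
      calc v i * (symS S *ᵥ x) i + t i.swap * (v i * a i / ρ)
          ≤ (k * ρ) * (8 * k) + 2 * ((k * ρ) * (k * ρ) / ρ) := by
            have := hs0 i
            have := ht0 i.swap
            gcongr
            · exact hY i
            · linarith [ht2 i, ht0 i]
        _ = _ := by field_simp; ring
    rw [e, abs_mul, abs_of_nonneg (mul_nonneg hv0 b0)]
    calc _ ≤ (k * ρ) * (10 * k ^ 2 * ρ) * (482 * k ^ 17 * δ) := by
          gcongr
          exact hC2 i
      _ = _ := by ring
  have hq : ∀ i, ρ / k ^ 2 ≤ v i * a i / ρ := by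
    intro i
    have h1 := h.v_lb i
    have h2 := h.a_lb i
    have := (h.v_pos i).le
    calc ρ / k ^ 2 = (ρ / k) * (ρ / k) / ρ := by field_simp
      _ ≤ _ := by gcongr
  -- Since `𝕊 x ≈ t' a / ρ` and `v a = v' a'`, equality of the masses of `(v 𝕊 x)²` reads `t² G ≈
  -- t'² G` with `G` at least of order `n ρ²`. As `t + t' = 2`, the difference of squares is twice
  -- the difference.
  have hdiff : |t i.swap - t i| ≤ 4820 * k ^ 24 * δ := by
    have hsq := h.blockSum_sq_eq hσ0 hx
    have key : ∀ T T' : ℝ, (∀ j, t (Sum.inl j) = T) → (∀ j, t (Sum.inr j) = T') → T + T' = 2 →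
        |T' - T| ≤ 4820 * k ^ 24 * δ := by
      intro T T' hT hT' hTT
      set G := ∑ j, (v (Sum.inl j) * a (Sum.inl j) / ρ) ^ 2 with hG
      have hG1 : n * (ρ / k ^ 2) ^ 2 ≤ G := by
        have : ∀ j ∈ Finset.univ, (ρ / k ^ 2) ^ 2 ≤ (v (Sum.inl j) * a (Sum.inl j) / ρ) ^ 2 :=
          fun j _ => pow_le_pow_left₀ (by positivity) (hq _) 2
        have := Finset.sum_le_sum this
        simpa using this
      have e : (T' ^ 2 - T ^ 2) * G =
          ∑ j, ((v (Sum.inr j) * (symS S *ᵥ x) (Sum.inr j)) ^ 2 -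
              (t (Sum.inr j).swap * (v (Sum.inr j) * a (Sum.inr j) / ρ)) ^ 2) -
            ∑ j, ((v (Sum.inl j) * (symS S *ᵥ x) (Sum.inl j)) ^ 2 -
              (t (Sum.inl j).swap * (v (Sum.inl j) * a (Sum.inl j) / ρ)) ^ 2) := by
        rw [Finset.sum_sub_distrib, Finset.sum_sub_distrib, hsq]
        simp only [Sum.swap_inl, Sum.swap_inr, hT, hT', mul_pow, ← Finset.mul_sum]
        have : ∑ j, (v (Sum.inr j) * a (Sum.inr j) / ρ) ^ 2 = G := by
          refine Finset.sum_congr rfl fun j _ => ?_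
          have := h.va_swap (Sum.inl j)
          rw [Sum.swap_inl] at this
          rw [this]
        rw [this]; ring
      have b : ∀ (f : Fin n → ℝ), (∀ j, |f j| ≤ 4820 * k ^ 20 * δ * ρ ^ 2) →
          |∑ j, f j| ≤ n * (4820 * k ^ 20 * δ * ρ ^ 2) := by
        intro f hf
        refine (Finset.abs_sum_le_sum_abs _ _).trans ((Finset.sum_le_sum fun j _ => hf j).trans ?_)
        simp
      have h1 : |(T' ^ 2 - T ^ 2) * G| ≤ 2 * (n * (4820 * k ^ 20 * δ * ρ ^ 2)) := by
        rw [e]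
        refine (abs_sub _ _).trans ?_
        linarith [b _ fun j => hC3 (Sum.inr j), b _ fun j => hC3 (Sum.inl j)]
      have h2 : (T' ^ 2 - T ^ 2) * G = 2 * ((T' - T) * G) := by
        linear_combination (T' - T) * G * hTT
      have hG0 : 0 < G := lt_of_lt_of_le (by positivity) hG1
      rw [h2, abs_mul, abs_two, abs_mul, abs_of_pos hG0] at h1
      have h3 : |T' - T| * (n * (ρ / k ^ 2) ^ 2) ≤ n * (4820 * k ^ 20 * δ * ρ ^ 2) :=
        (mul_le_mul_of_nonneg_left hG1 (abs_nonneg _)).trans (by linarith)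
      refine le_of_mul_le_mul_right (h3.trans (le_of_eq ?_))
        (show 0 < n * (ρ / k ^ 2) ^ 2 by positivity)
      field_simp
    cases i with
    | inl i => exact key _ _ (fun _ => rfl) (fun _ => rfl) (ht2 (Sum.inl i))
    | inr i =>
      rw [abs_sub_comm]
      exact key _ _ (fun _ => rfl) (fun _ => rfl) (by rw [add_comm]; exact ht2 (Sum.inr i))
  have hti : |t i - 1| ≤ 2410 * k ^ 24 * δ := by
    have e : t i - 1 = -((t i.swap - t i) / 2) := by linarith [ht2 i]
    rw [e, abs_neg, abs_div, abs_two]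
    linarith
  have e : x i - v i / ρ = (x i - t i * (v i / ρ)) + (t i - 1) * (v i / ρ) := by ring
  have hvi : v i / ρ ≤ k := by rw [div_le_iff₀ hρ]; exact h.v_ub i
  rw [e]
  refine (abs_add_le _ _).trans ?_
  rw [abs_mul (t i - 1), abs_of_nonneg (div_nonneg (h.v_pos i).le hρ.le)]
  calc _ ≤ 480 * k ^ 16 * δ + 2410 * k ^ 24 * δ * k := by
        gcongr
        · exact hC1 i
        · exact div_nonneg (h.v_pos i).le hρ.le
    _ = (480 * k ^ 16 + 2410 * k ^ 25) * δ := by ring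
    _ ≤ (4000 * k ^ 25) * δ := by
        gcongr ?_ * δ
        linarith [hpow (show 16 ≤ 25 by norm_num), pow_pos hk 25]

end Eigenvector

end EdgeData
end Dyson

/-! ### Block sign symmetry, deflation, and the two eigenvalues near zero. -/

namespace Dyson

variable {n : ℕ}

/-- The sign vector, `1` on the first and `-1` on the second block. -/
def blockSign (n : ℕ) : Fin n ⊕ Fin n → ℝ := Sum.elim (fun _ => 1) (fun _ => -1)

theorem blockSign_mul_self (i : Fin n ⊕ Fin n) : blockSign n i * blockSign n i = 1 := by
  cases i <;> simp [blockSign]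

theorem blockSign_swap (i : Fin n ⊕ Fin n) : blockSign n i.swap = -blockSign n i := by
  cases i <;> simp [blockSign]

theorem symS_mul_blockSign (S : Matrix (Fin n) (Fin n) ℝ) (i j : Fin n ⊕ Fin n) :
    symS S i j * blockSign n j = -(blockSign n i * symS S i j) := by
  cases i <;> cases j <;> simp [symS, blockSign]

theorem symS_mulVec_blockSign (S : Matrix (Fin n) (Fin n) ℝ) (x : Fin n ⊕ Fin n → ℝ)
    (i : Fin n ⊕ Fin n) :
    (symS S *ᵥ fun j => blockSign n j * x j) i = -(blockSign n i * (symS S *ᵥ x) i) := by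
  simp only [Matrix.mulVec, dotProduct, Finset.mul_sum, ← Finset.sum_neg_distrib]
  refine Finset.sum_congr rfl fun j _ => ?_
  rw [← mul_assoc, symS_mul_blockSign]; ring

/-- Every entry of `𝕊` links different blocks, so the block sign anticommutes with `𝕊`. Conjugation
by it therefore reverses only the term without the exchange, and Perron theory for `σ = 1` says
something about `σ = -1`. -/
theorem edgeOp_mulVec_blockSign (S : Matrix (Fin n) (Fin n) ℝ) (v u : Fin n ⊕ Fin n → ℝ) (σ : ℝ)
    (x : Fin n ⊕ Fin n → ℝ) (i : Fin n ⊕ Fin n) :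
    (edgeOp S v u σ *ᵥ fun j => blockSign n j * x j) i =
      blockSign n i * (edgeOp S v u (-σ) *ᵥ x) i := by
  rw [edgeOp_mulVec, edgeOp_mulVec, symS_mulVec_blockSign, symS_mulVec_blockSign, blockSign_swap]
  ring

theorem edgeOp_neg_one (S : Matrix (Fin n) (Fin n) ℝ) (v u : Fin n ⊕ Fin n → ℝ)
    (x : Fin n ⊕ Fin n → ℝ) (i : Fin n ⊕ Fin n) :
    (edgeOp S v u (-1) *ᵥ x) i = (edgeOp S v u 1 *ᵥ x) i - 2 * v i ^ 2 * (symS S *ᵥ x) i := by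
  rw [edgeOp_mulVec, edgeOp_mulVec]; ring

/-- `𝕊 x` is a left eigenvector of `edgeOp` if `x` is a right eigenvector: both sides equal
`(𝕊 x) W (𝕊 y)` with a symmetric `W`. -/
theorem EdgeData.sum_symS_mul_edgeOp {k : ℝ} {S : Matrix (Fin n) (Fin n) ℝ} {zz η ρ : ℝ}
    {v a u : Fin n ⊕ Fin n → ℝ} (h : EdgeData k S zz η ρ v a u) (σ : ℝ)
    (x y : Fin n ⊕ Fin n → ℝ) :
    ∑ i, (symS S *ᵥ x) i * (edgeOp S v u σ *ᵥ y) i =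
      ∑ i, (edgeOp S v u σ *ᵥ x) i * (symS S *ᵥ y) i := by
  simp only [edgeOp_mulVec, mul_add, add_mul, Finset.sum_add_distrib]
  congr 1
  · rw [← sum_swap]
    refine Finset.sum_congr rfl fun i _ => ?_
    rw [h.w_swap, Sum.swap_swap]; ring
  · exact Finset.sum_congr rfl fun i _ => by ring

/-- The Perron eigenvector of `edgeOp S v u 1`, normalized by the sum of its entries. -/
noncomputable def edgeVec (S : Matrix (Fin n) (Fin n) ℝ) (v u : Fin n ⊕ Fin n → ℝ) :
    Fin n ⊕ Fin n → ℝ := (2 * n * Real.pi) • (edgeOp S v u 1).perronVec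

/-- The distance of the Perron eigenvalue of `edgeOp S v u 1` from `1`. -/
noncomputable def edgeVal (S : Matrix (Fin n) (Fin n) ℝ) (v u : Fin n ⊕ Fin n → ℝ) : ℝ :=
  1 - (edgeOp S v u 1).perronVal

/-- A rank one modification of `edgeOp S v u (-1)` that has positive entries. -/
noncomputable def deflOp (k : ℝ) (S : Matrix (Fin n) (Fin n) ℝ) (v u : Fin n ⊕ Fin n → ℝ) :
    Matrix (Fin n ⊕ Fin n) (Fin n ⊕ Fin n) ℝ :=
  Matrix.of fun i j => edgeOp S v u (-1) i j -
    17 * k ^ 9 / n * (blockSign n i * v i ^ 2) * (blockSign n j * (symS S *ᵥ edgeVec S v u) j)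

/-- The Perron eigenvector of `deflOp`, normalized by the sum of its entries. -/
noncomputable def deflVec (k : ℝ) (S : Matrix (Fin n) (Fin n) ℝ) (v u : Fin n ⊕ Fin n → ℝ) :
    Fin n ⊕ Fin n → ℝ := (2 * n * Real.pi) • (deflOp k S v u).perronVec

/-- The distance of the Perron eigenvalue of `deflOp` from `1`. -/
noncomputable def deflVal (k : ℝ) (S : Matrix (Fin n) (Fin n) ℝ) (v u : Fin n ⊕ Fin n → ℝ) : ℝ :=
  1 - (deflOp k S v u).perronVal

theorem deflOp_mulVec (k : ℝ) (S : Matrix (Fin n) (Fin n) ℝ) (v u : Fin n ⊕ Fin n → ℝ)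
    (x : Fin n ⊕ Fin n → ℝ) (i : Fin n ⊕ Fin n) :
    (deflOp k S v u *ᵥ x) i = (edgeOp S v u (-1) *ᵥ x) i -
      17 * k ^ 9 / n * (blockSign n i * v i ^ 2) *
        ∑ j, blockSign n j * (symS S *ᵥ edgeVec S v u) j * x j := by
  simp only [deflOp]
  generalize symS S *ᵥ edgeVec S v u = G
  simp only [Matrix.mulVec, dotProduct, Matrix.of_apply, sub_mul,
    Finset.sum_sub_distrib, Finset.mul_sum]
  congr 1
  exact Finset.sum_congr rfl fun j _ => by ring

theorem scaled_perron {A : Matrix (Fin n ⊕ Fin n) (Fin n ⊕ Fin n) ℝ} (hn : 0 < n)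
    (hA : ∀ i j, 0 < A i j) :
    (∀ i, 0 < ((2 * n * Real.pi) • A.perronVec) i) ∧
      ∑ i, ((2 * n * Real.pi) • A.perronVec) i = 2 * n * Real.pi ∧
      A *ᵥ ((2 * n * Real.pi) • A.perronVec) =
        (1 - (1 - A.perronVal)) • ((2 * n * Real.pi) • A.perronVec) := by
  have : Nonempty (Fin n ⊕ Fin n) := ⟨Sum.inl ⟨0, hn⟩⟩
  have hn' : (0 : ℝ) < n := by exact_mod_cast hn
  have hpi := Real.pi_pos
  obtain ⟨h1, h2, h3⟩ := Matrix.perron_spec hA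
  refine ⟨fun i => ?_, ?_, ?_⟩
  · have := h1 i
    simp only [Pi.smul_apply, smul_eq_mul]
    positivity
  · simp only [Pi.smul_apply, smul_eq_mul]
    rw [← Finset.mul_sum, h2, mul_one]
  · rw [Matrix.mulVec_smul, h3, sub_sub_cancel, smul_comm]

namespace EdgeData

variable {k : ℝ} {S : Matrix (Fin n) (Fin n) ℝ} {zz η ρ : ℝ} {v a u : Fin n ⊕ Fin n → ℝ}

/-- The exponent 29 in the smallness assumption is the largest one needed; it arises when errors are
absorbed in `norm_le_of_functionals`. -/
theorem edge_small_pow (h : EdgeData k S zz η ρ v a u)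
    (hδ : 40000 * k ^ 29 * (ρ ^ 2 + η / ρ) ≤ 1) {m : ℕ} (hm : m ≤ 29) :
    40000 * k ^ m * (ρ ^ 2 + η / ρ) ≤ 1 := by
  refine le_trans ?_ hδ
  have := h.η_pos
  have := h.ρ_pos
  gcongr
  exact h.one_le

theorem ρ_sq_small (h : EdgeData k S zz η ρ v a u)
    (hδ : 40000 * k ^ 29 * (ρ ^ 2 + η / ρ) ≤ 1) {m : ℕ} (hm : m ≤ 29) :
    40000 * k ^ m * ρ ^ 2 ≤ 1 := by
  refine le_trans ?_ (h.edge_small_pow hδ hm)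
  have := h.η_pos
  have := h.ρ_pos
  have := h.k_pos
  gcongr
  exact le_add_of_nonneg_right (by positivity)

theorem le_w (h : EdgeData k S zz η ρ v a u) (hδ : 40000 * k ^ 29 * (ρ ^ 2 + η / ρ) ≤ 1) (i) :
    1 / (2 * k) ≤ u i - v i * v i.swap := by
  have hk := h.k_pos
  have hρ := h.ρ_pos
  have h1 := h.u_lb i
  have h2 : v i * v i.swap ≤ (k * ρ) * (k * ρ) :=
    mul_le_mul (h.v_ub _) (h.v_ub _) (h.v_pos _).le (by positivity)
  have h3 := h.ρ_sq_small hδ (m := 3) (by norm_num)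
  have h4 : (k * ρ) * (k * ρ) ≤ 1 / (2 * k) := by
    rw [le_div_iff₀ (by positivity)]
    nlinarith [show 0 ≤ k ^ 3 * ρ ^ 2 by positivity]
  have h5 : 1 / k = 1 / (2 * k) + 1 / (2 * k) := by field_simp; norm_num
  linarith

/-- Entries within a block come from `w 𝕊` with the exchange, entries between the blocks from `v²
𝕊`. For `σ = 1` both are positive, as `w` stays away from zero. -/
theorem edgeOp_one_pos (h : EdgeData k S zz η ρ v a u)
    (hδ : 40000 * k ^ 29 * (ρ ^ 2 + η / ρ) ≤ 1) (i j) : 0 < edgeOp S v u 1 i j := by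
  have hw : 0 < u i - v i * v i.swap :=
    lt_of_lt_of_le (by have := h.k_pos; positivity) (h.le_w hδ i)
  have hv := h.v_pos i
  rw [edgeOp, Matrix.of_apply, one_mul]
  cases i with
  | inl i =>
    cases j with
    | inl j =>
      have := h.S_pos j i
      simpa [symS] using mul_pos hw this
    | inr j =>
      have := h.S_pos i j
      simpa [symS] using mul_pos (pow_pos hv 2) this
  | inr i =>
    cases j with
    | inl j =>
      have := h.S_pos j i
      simpa [symS] using mul_pos (pow_pos hv 2) this
    | inr j =>
      have := h.S_pos i j
      simpa [symS] using mul_pos hw this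

theorem edgeVec_spec (h : EdgeData k S zz η ρ v a u)
    (hδ : 40000 * k ^ 29 * (ρ ^ 2 + η / ρ) ≤ 1) :
    (∀ i, 0 < edgeVec S v u i) ∧ ∑ i, edgeVec S v u i = 2 * n * Real.pi ∧
      edgeOp S v u 1 *ᵥ edgeVec S v u = (1 - edgeVal S v u) • edgeVec S v u :=
  scaled_perron h.n_pos (h.edgeOp_one_pos hδ)

theorem edge_small_pow_five (h : EdgeData k S zz η ρ v a u)
    (hδ : 40000 * k ^ 29 * (ρ ^ 2 + η / ρ) ≤ 1) : 8 * k ^ 5 * (ρ ^ 2 + η / ρ) ≤ 1 := by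
  have h1 := h.edge_small_pow hδ (m := 5) (by norm_num)
  have := h.η_pos
  have := h.ρ_pos
  have := h.k_pos
  have : 0 ≤ k ^ 5 * (ρ ^ 2 + η / ρ) := by positivity
  linarith

theorem approx_bounds (h : EdgeData k S zz η ρ v a u)
    (hδ : 40000 * k ^ 29 * (ρ ^ 2 + η / ρ) ≤ 1) {x : Fin n ⊕ Fin n → ℝ}
    (hx : ∀ i, |x i - v i / ρ| ≤ 4000 * k ^ 25 * (ρ ^ 2 + η / ρ)) (i) :
    1 / (2 * k) ≤ x i ∧ x i ≤ 2 * k := by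
  have hk := h.k_pos
  have hk1 := h.one_le
  have hρ := h.ρ_pos
  have h1 := abs_le.1 (hx i)
  have h2 := h.v_lb i
  have h3 := h.v_ub i
  have h4 : 4000 * k ^ 25 * (ρ ^ 2 + η / ρ) ≤ 1 / (2 * k) := by
    rw [le_div_iff₀ (by positivity)]
    have := h.edge_small_pow hδ (m := 26) (by norm_num)
    have := h.η_pos
    have : 0 ≤ k ^ 26 * (ρ ^ 2 + η / ρ) := by positivity
    linarith
  have h5 : 1 / k ≤ v i / ρ := by
    rw [div_le_div_iff₀ hk hρ]
    rw [div_le_iff₀ hk] at h2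
    linarith
  have h6 : v i / ρ ≤ k := by rwa [div_le_iff₀ hρ]
  have h7 : 1 / k = 1 / (2 * k) + 1 / (2 * k) := by field_simp; norm_num
  have h8 : 1 / (2 * k) ≤ k := by
    rw [div_le_iff₀ (by positivity)]
    nlinarith
  constructor <;> linarith

theorem symS_bounds (h : EdgeData k S zz η ρ v a u) {x : Fin n ⊕ Fin n → ℝ}
    (hx : ∀ i, 1 / (2 * k) ≤ x i ∧ x i ≤ 2 * k) (i) :
    1 / (2 * k ^ 2) ≤ (symS S *ᵥ x) i ∧ (symS S *ᵥ x) i ≤ 4 * k ^ 2 := by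
  have hk := h.k_pos
  have hn := h.n_pos'
  have h0 : ∀ j, 0 ≤ x j := fun j => le_trans (by positivity) (hx j).1
  constructor
  · refine le_trans ?_ (h.le_symS_mulVec h0 i)
    have h3 : n * (1 / (2 * k)) ≤ blockSum x i.swap := by
      cases i
      · have := Finset.sum_le_sum fun j (_ : j ∈ Finset.univ) => (hx (Sum.inr j)).1
        simpa [blockSum] using this
      · have := Finset.sum_le_sum fun j (_ : j ∈ Finset.univ) => (hx (Sum.inl j)).1
        simpa [blockSum] using this
    calc 1 / (2 * k ^ 2) = 1 / (k * n) * (n * (1 / (2 * k))) := by field_simp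
      _ ≤ _ := by gcongr
  · refine (h.symS_mulVec_le h0 i).trans ?_
    have h3 := Finset.sum_le_sum fun j (_ : j ∈ Finset.univ) => (hx j).2
    have h4 : ∑ _j : Fin n ⊕ Fin n, (2 * k) = 4 * n * k := by
      rw [Finset.sum_const, Finset.card_univ, Fintype.card_sum, Fintype.card_fin, nsmul_eq_mul]
      push_cast
      ring
    rw [h4] at h3
    calc k / n * ∑ j, x j ≤ k / n * (4 * n * k) := by gcongr
      _ = _ := by field_simp

theorem edgeVec_approx (h : EdgeData k S zz η ρ v a u)
    (hδ : 40000 * k ^ 29 * (ρ ^ 2 + η / ρ) ≤ 1) (i) :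
    |edgeVec S v u i - v i / ρ| ≤ 4000 * k ^ 25 * (ρ ^ 2 + η / ρ) := by
  obtain ⟨h1, h2, h3⟩ := h.edgeVec_spec hδ
  exact h.eigenvector_approx (by simp) one_ne_zero (h.edge_small_pow_five hδ) h1 h2 h3 i

/-- Between the blocks the signs multiply to `-1`, so the rank one term adds a multiple of `v²` that
beats the negative entry `-v² S`. Within a block it subtracts something of order `ρ² / n`, which is
small against `w S`. -/
theorem deflOp_pos (h : EdgeData k S zz η ρ v a u)
    (hδ : 40000 * k ^ 29 * (ρ ^ 2 + η / ρ) ≤ 1) (i j) : 0 < deflOp k S v u i j := by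
  have hk := h.k_pos
  have hk1 := h.one_le
  have hn := h.n_pos'
  have hρ := h.ρ_pos
  have hw := h.le_w hδ
  have hg := h.symS_bounds (h.approx_bounds hδ (h.edgeVec_approx hδ))
  set G := symS S *ᵥ edgeVec S v u with hG
  have same : ∀ i j (s : ℝ), 1 / (k * n) ≤ s →
      0 < (u i - v i * v i.swap) * s - 17 * k ^ 9 / n * v i ^ 2 * G j := by
    intro i j s hs
    have h1 : 1 / (2 * k) * (1 / (k * n)) ≤ (u i - v i * v i.swap) * s :=
      mul_le_mul (hw i) hs (by positivity) (h.w_nonneg i)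
    have h2 : 17 * k ^ 9 / n * v i ^ 2 * G j ≤ 17 * k ^ 9 / n * (k * ρ) ^ 2 * (4 * k ^ 2) := by
      have := (h.v_pos i).le
      have := h.v_ub i
      gcongr
      · exact le_trans (by positivity) (hg j).1
      · exact (hg j).2
    have h3 : 17 * k ^ 9 / n * (k * ρ) ^ 2 * (4 * k ^ 2) < 1 / (2 * k) * (1 / (k * n)) := by
      have e1 : 1 / (2 * k) * (1 / (k * n)) = 1 / (2 * k ^ 2 * n) := by field_simp
      rw [e1, lt_div_iff₀ (by positivity)]
      have e2 : 17 * k ^ 9 / n * (k * ρ) ^ 2 * (4 * k ^ 2) * (2 * k ^ 2 * n) =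
          136 * (k ^ 15 * ρ ^ 2) := by field_simp; ring
      rw [e2]
      have := h.ρ_sq_small hδ (m := 15) (by norm_num)
      have : 0 < k ^ 15 * ρ ^ 2 := by positivity
      linarith
    linarith
  have opp : ∀ i j (s : ℝ), s ≤ k / n →
      0 < -(v i ^ 2 * s) + 17 * k ^ 9 / n * v i ^ 2 * G j := by
    intro i j s hs
    have hv := h.v_pos i
    have h1 : k / n < 17 * k ^ 9 / n * G j := by
      calc k / n = k * 1 / n := by rw [mul_one]
        _ < k * (17 / 2 * k ^ 6) / n := by
            gcongr
            have := one_le_pow₀ (n := 6) hk1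
            linarith
        _ = 17 * k ^ 9 / n * (1 / (2 * k ^ 2)) := by field_simp
        _ ≤ _ := by
            gcongr
            exact (hg j).1
    have : -(v i ^ 2 * s) + 17 * k ^ 9 / n * v i ^ 2 * G j =
        v i ^ 2 * (17 * k ^ 9 / n * G j - s) := by ring
    rw [this]
    exact mul_pos (pow_pos hv 2) (by linarith)
  rw [deflOp, Matrix.of_apply, edgeOp, Matrix.of_apply, ← hG]
  clear_value G
  cases i with
  | inl i =>
    cases j with
    | inl j => simpa [symS, blockSign] using same (Sum.inl i) (Sum.inl j) _ (h.S_lb j i)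
    | inr j => simpa [symS, blockSign] using opp (Sum.inl i) (Sum.inr j) _ (h.S_ub i j)
  | inr i =>
    cases j with
    | inl j => simpa [symS, blockSign] using opp (Sum.inr i) (Sum.inl j) _ (h.S_ub j i)
    | inr j => simpa [symS, blockSign] using same (Sum.inr i) (Sum.inr j) _ (h.S_lb i j)

/-- The Perron eigenvector of `deflOp` is annihilated by the rank one modification. -/
theorem sum_blockSign_mul_deflVec (h : EdgeData k S zz η ρ v a u)
    (hδ : 40000 * k ^ 29 * (ρ ^ 2 + η / ρ) ≤ 1) :
    ∑ j, blockSign n j * (symS S *ᵥ edgeVec S v u) j * deflVec k S v u j = 0 := by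
  have : Nonempty (Fin n ⊕ Fin n) := ⟨Sum.inl ⟨0, h.n_pos⟩⟩
  have hk := h.k_pos
  have hk1 := h.one_le
  have hn := h.n_pos'
  have hρ := h.ρ_pos
  obtain ⟨g0, -, g2⟩ := h.edgeVec_spec hδ
  obtain ⟨x0, -, x2⟩ := scaled_perron h.n_pos (h.deflOp_pos hδ)
  have hgb := h.approx_bounds hδ (h.edgeVec_approx hδ)
  have hGb := h.symS_bounds hgb
  rw [show 1 - (deflOp k S v u).perronVal = deflVal k S v u from rfl,
    show (2 * n * Real.pi) • (deflOp k S v u).perronVec = deflVec k S v u from rfl] at x2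
  set g := edgeVec S v u with hg
  set x := deflVec k S v u with hx
  set μ := 1 - edgeVal S v u
  set μ' := 1 - deflVal k S v u
  set G := symS S *ᵥ g with hG
  -- The form `⟨𝕊 g, ε g⟩` with the block sign `ε` vanishes because `𝕊` is symmetric and
  -- anticommutes with `ε`.
  have hgg : ∑ j, blockSign n j * G j * g j = 0 := by
    have h1 : ∑ j, blockSign n j * G j * g j = ∑ j, G j * (blockSign n j * g j) :=
      Finset.sum_congr rfl fun j _ => by ring
    have h2 : ∑ j, G j * (blockSign n j * g j) = -∑ j, blockSign n j * G j * g j := by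
      rw [hG, ← sum_mul_symS S g (fun j => blockSign n j * g j), ← Finset.sum_neg_distrib]
      refine Finset.sum_congr rfl fun j _ => ?_
      rw [symS_mulVec_blockSign]; ring
    linarith
  -- On `g` the rank one term vanishes and only the loss `2 v² 𝕊 g` separates the matrix from the
  -- case `σ = 1`. Thus `g` is subinvariant, and the Perron eigenvalue `μ'` is at least `μ - 16 k⁵
  -- ρ²`.
  have hsub : ∀ i, (μ - 16 * k ^ 5 * ρ ^ 2) * g i ≤ (deflOp k S v u *ᵥ g) i := by
    intro i
    rw [deflOp_mulVec, ← hg, ← hG, hgg, mul_zero, sub_zero, edgeOp_neg_one, g2, Pi.smul_apply,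
      smul_eq_mul, ← hG]
    have h1 : 2 * v i ^ 2 * G i ≤ 2 * (k * ρ) ^ 2 * (4 * k ^ 2) := by
      have := (h.v_pos i).le
      have := h.v_ub i
      gcongr
      · exact le_trans (by positivity) (hGb i).1
      · exact (hGb i).2
    have h2 : 16 * k ^ 5 * ρ ^ 2 * (1 / (2 * k)) ≤ 16 * k ^ 5 * ρ ^ 2 * g i := by
      gcongr
      exact (hgb i).1
    have e : 16 * k ^ 5 * ρ ^ 2 * (1 / (2 * k)) = 2 * (k * ρ) ^ 2 * (4 * k ^ 2) := by
      field_simp; norm_num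
    linarith
  have hμ : μ - 16 * k ^ 5 * ρ ^ 2 ≤ μ' := Matrix.le_of_perron (h.deflOp_pos hδ) x0 g0 x2 hsub
  set L := ∑ j, blockSign n j * G j * x j with hL
  set κ := ∑ j, G j * v j ^ 2 with hκ
  have hκ1 : n * (ρ ^ 2 / k ^ 4) ≤ κ := by
    have h1 : ∀ j ∈ Finset.univ, 1 / (2 * k ^ 2) * (ρ / k) ^ 2 ≤ G j * v j ^ 2 := fun j _ => by
      have := h.v_lb j
      exact mul_le_mul (hGb j).1 (pow_le_pow_left₀ (by positivity) this 2) (by positivity)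
        (le_trans (by positivity) (hGb j).1)
    have h2 := Finset.sum_le_sum h1
    rw [Finset.sum_const, Finset.card_univ, Fintype.card_sum, Fintype.card_fin,
      nsmul_eq_mul] at h2
    refine le_trans (le_of_eq ?_) h2
    push_cast
    field_simp
    norm_num
  -- The vector `ε 𝕊 g` is a left eigenvector of the undeflated matrix with eigenvalue `μ`; the rank
  -- one term shifts its eigenvalue to `μ - 17 k⁹ κ / n`.
  have hev : μ' * L = (μ - 17 * k ^ 9 / n * κ) * L := by
    have e1 : μ' * L = ∑ j, blockSign n j * G j * (deflOp k S v u *ᵥ x) j := by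
      rw [x2, hL, Finset.mul_sum]
      exact Finset.sum_congr rfl fun j _ => by rw [Pi.smul_apply, smul_eq_mul]; ring
    have e2 : ∑ j, blockSign n j * G j * (edgeOp S v u (-1) *ᵥ x) j = μ * L := by
      have h1 : ∀ j, blockSign n j * G j * (edgeOp S v u (-1) *ᵥ x) j =
          -((symS S *ᵥ fun j => blockSign n j * g j) j * (edgeOp S v u (-1) *ᵥ x) j) := fun j => by
        rw [symS_mulVec_blockSign]; ring
      rw [Finset.sum_congr rfl fun j _ => h1 j, Finset.sum_neg_distrib, h.sum_symS_mul_edgeOp]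
      have h2 : ∀ j, (edgeOp S v u (-1) *ᵥ fun j => blockSign n j * g j) j * (symS S *ᵥ x) j =
          μ * ((blockSign n j * g j) * (symS S *ᵥ x) j) := fun j => by
        rw [edgeOp_mulVec_blockSign, neg_neg, g2, Pi.smul_apply, smul_eq_mul]; ring
      rw [Finset.sum_congr rfl fun j _ => h2 j, ← Finset.mul_sum,
        sum_mul_symS S (fun j => blockSign n j * g j) x, hL]
      rw [← mul_neg, ← Finset.sum_neg_distrib]
      congr 1
      refine Finset.sum_congr rfl fun j _ => ?_
      rw [symS_mulVec_blockSign]; ring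
    rw [e1]
    simp only [deflOp_mulVec]
    rw [← hg, ← hG, ← hL]
    have e3 : ∑ j, blockSign n j * G j * ((edgeOp S v u (-1) *ᵥ x) j -
        17 * k ^ 9 / n * (blockSign n j * v j ^ 2) * L) =
        ∑ j, blockSign n j * G j * (edgeOp S v u (-1) *ᵥ x) j -
          17 * k ^ 9 / n * L * ∑ j, G j * v j ^ 2 := by
      rw [Finset.mul_sum, ← Finset.sum_sub_distrib]
      refine Finset.sum_congr rfl fun j _ => ?_
      linear_combination (-(17 * k ^ 9 / n * L * G j * v j ^ 2)) * blockSign_mul_self j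
    rw [e3, e2]; ring
  -- If `L` were nonzero, the eigenvalues would agree, so `μ'` would be at most `μ - 17 k⁵ ρ²`. This
  -- contradicts the lower bound with 16 in place of 17.
  by_contra hne
  have h1 := mul_right_cancel₀ hne hev
  have h2 : 17 * k ^ 9 / n * (n * (ρ ^ 2 / k ^ 4)) ≤ 17 * k ^ 9 / n * κ := by gcongr
  have e : 17 * k ^ 9 / n * (n * (ρ ^ 2 / k ^ 4)) = 17 * k ^ 5 * ρ ^ 2 := by field_simp
  have h3 : 0 < k ^ 5 * ρ ^ 2 := by positivity
  linarith

theorem deflVec_spec (h : EdgeData k S zz η ρ v a u)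
    (hδ : 40000 * k ^ 29 * (ρ ^ 2 + η / ρ) ≤ 1) :
    (∀ i, 0 < deflVec k S v u i) ∧ ∑ i, deflVec k S v u i = 2 * n * Real.pi ∧
      edgeOp S v u (-1) *ᵥ deflVec k S v u = (1 - deflVal k S v u) • deflVec k S v u := by
  obtain ⟨x0, x1, x2⟩ := scaled_perron h.n_pos (h.deflOp_pos hδ)
  refine ⟨x0, x1, ?_⟩
  rw [show 1 - (deflOp k S v u).perronVal = deflVal k S v u from rfl,
    show (2 * n * Real.pi) • (deflOp k S v u).perronVec = deflVec k S v u from rfl] at x2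
  rw [← x2]
  ext i
  rw [deflOp_mulVec, h.sum_blockSign_mul_deflVec hδ, mul_zero, sub_zero]

theorem deflVec_approx (h : EdgeData k S zz η ρ v a u)
    (hδ : 40000 * k ^ 29 * (ρ ^ 2 + η / ρ) ≤ 1) (i) :
    |deflVec k S v u i - v i / ρ| ≤ 4000 * k ^ 25 * (ρ ^ 2 + η / ρ) := by
  obtain ⟨h1, h2, h3⟩ := h.deflVec_spec hδ
  exact h.eigenvector_approx (by simp) (by norm_num) (h.edge_small_pow_five hδ) h1 h2 h3 i

/-- Pairing the second eigenvector `x` with `𝕊 g`, the left eigenvector for `σ = 1`, makes the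
eigenvalue gap proportional to `∑ 2 (𝕊 g) v² (𝕊 x)`, a sum of positive terms. -/
theorem edgeVal_lt_deflVal (h : EdgeData k S zz η ρ v a u)
    (hδ : 40000 * k ^ 29 * (ρ ^ 2 + η / ρ) ≤ 1) : edgeVal S v u < deflVal k S v u := by
  have : Nonempty (Fin n ⊕ Fin n) := ⟨Sum.inl ⟨0, h.n_pos⟩⟩
  have hk := h.k_pos
  obtain ⟨g0, -, g2⟩ := h.edgeVec_spec hδ
  obtain ⟨x0, -, x2⟩ := h.deflVec_spec hδ
  have hGb := h.symS_bounds (h.approx_bounds hδ (h.edgeVec_approx hδ))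
  have hXb := h.symS_bounds (h.approx_bounds hδ (h.deflVec_approx hδ))
  set g := edgeVec S v u
  set x := deflVec k S v u
  have hG : ∀ i, 0 < (symS S *ᵥ g) i := fun i => lt_of_lt_of_le (by positivity) (hGb i).1
  have hXX : ∀ i, 0 < (symS S *ᵥ x) i := fun i => lt_of_lt_of_le (by positivity) (hXb i).1
  have hP : 0 < ∑ i, (symS S *ᵥ g) i * x i :=
    Finset.sum_pos (fun i _ => mul_pos (hG i) (x0 i)) Finset.univ_nonempty
  have hQ : 0 < ∑ i, (symS S *ᵥ g) i * (2 * v i ^ 2 * (symS S *ᵥ x) i) := by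
    refine Finset.sum_pos (fun i _ => ?_) Finset.univ_nonempty
    have := hG i
    have := hXX i
    have := h.v_pos i
    positivity
  have e1 : ∑ i, (symS S *ᵥ g) i * (edgeOp S v u 1 *ᵥ x) i =
      (1 - edgeVal S v u) * ∑ i, (symS S *ᵥ g) i * x i := by
    rw [h.sum_symS_mul_edgeOp, g2, ← sum_mul_symS, Finset.mul_sum]
    exact Finset.sum_congr rfl fun i _ => by rw [Pi.smul_apply, smul_eq_mul]; ring
  have e2 : ∑ i, (symS S *ᵥ g) i * (edgeOp S v u (-1) *ᵥ x) i =
      (1 - deflVal k S v u) * ∑ i, (symS S *ᵥ g) i * x i := by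
    rw [x2, Finset.mul_sum]
    exact Finset.sum_congr rfl fun i _ => by rw [Pi.smul_apply, smul_eq_mul]; ring
  simp only [edgeOp_neg_one, mul_sub, Finset.sum_sub_distrib] at e2
  rw [e1] at e2
  have : 0 < (deflVal k S v u - edgeVal S v u) * ∑ i, (symS S *ᵥ g) i * x i := by linarith
  exact sub_pos.1 (pos_of_mul_pos_left this hP.le)

theorem symS_approx (h : EdgeData k S zz η ρ v a u) {x : Fin n ⊕ Fin n → ℝ}
    (hx : ∀ i, |x i - v i / ρ| ≤ 4000 * k ^ 25 * (ρ ^ 2 + η / ρ)) (i) :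
    |(symS S *ᵥ x) i - a i / ρ| ≤ 8000 * k ^ 26 * (ρ ^ 2 + η / ρ) := by
  have hk := h.k_pos
  have hρ := h.ρ_pos
  have hη := h.η_pos
  set δ := ρ ^ 2 + η / ρ with hδdef
  have hδ0 : 0 < δ := by positivity
  have h1 := h.norm_symSC_le (x := fun j => ((x j - v j / ρ : ℝ) : ℂ))
    (X := 4000 * k ^ 25 * δ) (by positivity) (fun i => by
      rw [Complex.norm_real]; exact hx i) i
  have h2 : symSC S (fun j => ((x j - v j / ρ : ℝ) : ℂ)) i =
      (((symS S *ᵥ x) i - (a i - η) / ρ : ℝ) : ℂ) := by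
    rw [symSC_ofReal, h.a_eq i, add_sub_cancel_left]
    congr 1
    simp only [Matrix.mulVec, dotProduct, Finset.sum_div, mul_div_assoc, mul_sub,
      Finset.sum_sub_distrib]
  rw [h2, Complex.norm_real, Real.norm_eq_abs] at h1
  have h6 : (symS S *ᵥ x) i - a i / ρ = ((symS S *ᵥ x) i - (a i - η) / ρ) - η / ρ := by ring
  have hηδ : η / ρ ≤ δ := by rw [hδdef]; linarith [sq_nonneg ρ]
  rw [h6]
  refine (abs_sub _ _).trans ?_
  rw [abs_of_nonneg (a := η / ρ) (by positivity)]
  have h7 : δ ≤ k ^ 26 * δ := le_mul_of_one_le_left hδ0.le (one_le_pow₀ h.one_le)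
  have h8 : k * (4000 * k ^ 25 * δ) = 4000 * (k ^ 26 * δ) := by ring
  have h9 : 0 ≤ k ^ 26 * δ := by positivity
  linarith

/-- `1 - K` is bounded below on the common kernel of two functionals close to `a` on each block. -/
theorem norm_le_of_functionals (h : EdgeData k S zz η ρ v a u)
    (hδ : 40000 * k ^ 29 * (ρ ^ 2 + η / ρ) ≤ 1) {p q : Fin n ⊕ Fin n → ℝ}
    (hp : ∀ i, |p i - a i / ρ| ≤ 8000 * k ^ 26 * (ρ ^ 2 + η / ρ))
    (hq : ∀ i, |q i - a i / ρ| ≤ 8000 * k ^ 26 * (ρ ^ 2 + η / ρ))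
    {σ : ℝ} (hσ : |σ| ≤ 1) {x : Fin n ⊕ Fin n → ℂ} {N P Q : ℝ}
    (hN : ∀ i, ‖x i - ((u i - v i * v i.swap : ℝ) * symSC S x i.swap +
      (σ * v i ^ 2 : ℝ) * symSC S x i)‖ ≤ N)
    (hP : ‖∑ i, (p i : ℂ) * x i‖ ≤ 2 * n * P)
    (hQ : ‖∑ i, (blockSign n i * q i : ℂ) * x i‖ ≤ 2 * n * Q) (i) :
    ‖x i‖ ≤ 18 * k ^ 12 * (N + P + Q) := by
  have : Nonempty (Fin n ⊕ Fin n) := ⟨i⟩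
  have hk := h.k_pos
  have hk1 := h.one_le
  have hn := h.n_pos'
  have hρ := h.ρ_pos
  have hη := h.η_pos
  set δ := ρ ^ 2 + η / ρ with hδdef
  have hδ0 : 0 < δ := by positivity
  obtain ⟨i₀, -, hi₀⟩ := Finset.exists_max_image Finset.univ (fun i => ‖x i‖)
    Finset.univ_nonempty
  set X := ‖x i₀‖ with hXdef
  have hX : ∀ i, ‖x i‖ ≤ X := fun i => hi₀ i (Finset.mem_univ i)
  have hX0 : 0 ≤ X := norm_nonneg _
  have hN0 : 0 ≤ N := (norm_nonneg _).trans (hN i)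
  have hP0 : 0 ≤ P := by
    have := (norm_nonneg _).trans hP
    exact nonneg_of_mul_nonneg_right this (by positivity)
  have hQ0 : 0 ≤ Q := by
    have := (norm_nonneg _).trans hQ
    exact nonneg_of_mul_nonneg_right this (by positivity)
  have hL := h.norm_sub_blockSum_le hσ hX hN
  rw [← hδdef] at hL
  set Y := 3 * k ^ 8 * (N + δ * X) with hY
  have hY0 : 0 ≤ Y := by positivity
  set t : Fin n ⊕ Fin n → ℂ := fun i => ((n * Real.pi * ρ : ℝ) : ℂ)⁻¹ * blockSum x i * ρ with ht
  have hρC : (ρ : ℂ) ≠ 0 := Complex.ofReal_ne_zero.2 hρ.ne'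
  have hxt : ∀ i, ‖x i - t i * (v i / ρ : ℝ)‖ ≤ Y := by
    intro i
    have : t i * (v i / ρ : ℝ) = ((n * Real.pi * ρ : ℝ) : ℂ)⁻¹ * blockSum x i * (v i : ℂ) := by
      rw [ht]
      push_cast
      field_simp
    rw [this]
    exact hL i
  -- A functional close to `a / ρ`, applied to `x ≈ t v / ρ`, sees the block coefficient `t` times
  -- `a v / ρ²`. The latter has the same sum `G` over both blocks.
  have hloc : ∀ (r : Fin n ⊕ Fin n → ℝ), (∀ i, |r i - a i / ρ| ≤ 8000 * k ^ 26 * δ) →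
      ∀ i, ‖(r i : ℂ) * x i - t i * ((a i * v i / ρ ^ 2 : ℝ) : ℂ)‖ ≤
        8000 * k ^ 26 * δ * X + k * Y := by
    intro r hr i
    have e : (r i : ℂ) * x i - t i * ((a i * v i / ρ ^ 2 : ℝ) : ℂ) =
        ((r i - a i / ρ : ℝ) : ℂ) * x i + ((a i / ρ : ℝ) : ℂ) * (x i - t i * (v i / ρ : ℝ)) := by
      push_cast
      field_simp
      ring
    rw [e]
    refine norm_add_le_of_le ?_ ?_
    · rw [norm_mul, Complex.norm_real]
      exact mul_le_mul (hr i) (hX i) (norm_nonneg _) (by positivity)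
    · rw [norm_mul, Complex.norm_real,
        Real.norm_of_nonneg (div_nonneg (h.a_pos i).le hρ.le)]
      exact mul_le_mul (by rw [div_le_iff₀ hρ]; exact h.a_ub i) (hxt i) (norm_nonneg _) hk.le
  set Z := 8000 * k ^ 26 * δ * X + k * Y with hZ
  set G : ℝ := ∑ j, a (Sum.inl j) * v (Sum.inl j) / ρ ^ 2 with hG
  have hG' : ∑ j, a (Sum.inr j) * v (Sum.inr j) / ρ ^ 2 = G := by
    refine Finset.sum_congr rfl fun j _ => ?_
    have := h.va_swap (Sum.inl j)
    rw [Sum.swap_inl] at this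
    rw [mul_comm, this, mul_comm]
  have hGlb : n * (1 / k ^ 2) ≤ G := by
    have : ∀ j ∈ Finset.univ, 1 / k ^ 2 ≤ a (Sum.inl j) * v (Sum.inl j) / ρ ^ 2 := fun j _ => by
      have h1 := h.a_lb (Sum.inl j)
      have h2 := h.v_lb (Sum.inl j)
      have := (h.a_pos (Sum.inl j)).le
      calc 1 / k ^ 2 = (ρ / k) * (ρ / k) / ρ ^ 2 := by field_simp
        _ ≤ _ := by gcongr
    have := Finset.sum_le_sum this
    simpa using this
  have hG0 : 0 < G := lt_of_lt_of_le (by positivity) hGlb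
  obtain ⟨T, hT⟩ : ∃ T, ∀ j, t (Sum.inl j) = T :=
    ⟨((n * Real.pi * ρ : ℝ) : ℂ)⁻¹ * (∑ j, x (Sum.inl j)) * ρ, fun _ => rfl⟩
  obtain ⟨T', hT'⟩ : ∃ T', ∀ j, t (Sum.inr j) = T' :=
    ⟨((n * Real.pi * ρ : ℝ) : ℂ)⁻¹ * (∑ j, x (Sum.inr j)) * ρ, fun _ => rfl⟩
  have hblock : ∀ (r : Fin n ⊕ Fin n → ℝ), (∀ i, |r i - a i / ρ| ≤ 8000 * k ^ 26 * δ) →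
      ‖∑ j, (r (Sum.inl j) : ℂ) * x (Sum.inl j) - T * G‖ ≤ n * Z ∧
        ‖∑ j, (r (Sum.inr j) : ℂ) * x (Sum.inr j) - T' * G‖ ≤ n * Z := by
    intro r hr
    constructor
    · have e : T * G = ∑ j, t (Sum.inl j) * ((a (Sum.inl j) * v (Sum.inl j) / ρ ^ 2 : ℝ) : ℂ) := by
        simp only [hT, hG, Complex.ofReal_sum, Finset.mul_sum]
      rw [e, ← Finset.sum_sub_distrib]
      refine (norm_sum_le _ _).trans ((Finset.sum_le_sum fun j _ => hloc r hr (Sum.inl j)).trans ?_)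
      simp
    · have e : T' * G = ∑ j, t (Sum.inr j) * ((a (Sum.inr j) * v (Sum.inr j) / ρ ^ 2 : ℝ) : ℂ) := by
        simp only [hT', ← hG', Complex.ofReal_sum, Finset.mul_sum]
      rw [e, ← Finset.sum_sub_distrib]
      refine (norm_sum_le _ _).trans ((Finset.sum_le_sum fun j _ => hloc r hr (Sum.inr j)).trans ?_)
      simp
  have hp' := hblock p hp
  have hq' := hblock q hq
  -- The unsigned functional determines the sum of the two block coefficients and the signed one
  -- their difference.
  have hplus : ‖(T + T') * G‖ ≤ 2 * n * P + 2 * n * Z := by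
    have e : (T + T') * G = ∑ i, (p i : ℂ) * x i -
        (∑ j, (p (Sum.inl j) : ℂ) * x (Sum.inl j) - T * G) -
        (∑ j, (p (Sum.inr j) : ℂ) * x (Sum.inr j) - T' * G) := by
      rw [Fintype.sum_sum_type]; ring
    rw [e]
    refine (norm_sub_le_of_le (norm_sub_le_of_le hP hp'.1) hp'.2).trans (le_of_eq ?_)
    ring
  have hminus : ‖(T - T') * G‖ ≤ 2 * n * Q + 2 * n * Z := by
    have e : (T - T') * G = ∑ i, (blockSign n i * q i : ℂ) * x i -
        (∑ j, (q (Sum.inl j) : ℂ) * x (Sum.inl j) - T * G) +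
        (∑ j, (q (Sum.inr j) : ℂ) * x (Sum.inr j) - T' * G) := by
      rw [Fintype.sum_sum_type]
      simp only [blockSign, Sum.elim_inl, Sum.elim_inr, Complex.ofReal_one, one_mul,
        Complex.ofReal_neg, neg_mul, Finset.sum_neg_distrib]
      ring
    rw [e]
    refine (norm_add_le_of_le (norm_sub_le_of_le hQ hq'.1) hq'.2).trans (le_of_eq ?_)
    ring
  have hfin : ∀ W : ℂ, ‖(2 * W) * (G : ℂ)‖ ≤ 2 * n * (P + Q + 2 * Z) →
      ‖W‖ ≤ k ^ 2 * (P + Q + 2 * Z) := by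
    intro W hW
    rw [norm_mul, norm_mul, Complex.norm_real, Real.norm_of_nonneg hG0.le, Complex.norm_ofNat] at hW
    have h1 : ‖W‖ * (n * (1 / k ^ 2)) ≤ n * (P + Q + 2 * Z) := by
      refine (mul_le_mul_of_nonneg_left hGlb (norm_nonneg _)).trans ?_
      linarith
    refine le_of_mul_le_mul_right (h1.trans (le_of_eq ?_)) (show 0 < n * (1 / k ^ 2) by positivity)
    field_simp
  have hT1 : ‖T‖ ≤ k ^ 2 * (P + Q + 2 * Z) := by
    refine hfin T ?_
    rw [show 2 * T * (G : ℂ) = (T + T') * G + (T - T') * G by ring]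
    refine (norm_add_le_of_le hplus hminus).trans (le_of_eq ?_)
    ring
  have hT2 : ‖T'‖ ≤ k ^ 2 * (P + Q + 2 * Z) := by
    refine hfin T' ?_
    rw [show 2 * T' * (G : ℂ) = (T + T') * G - (T - T') * G by ring]
    refine (norm_sub_le_of_le hplus hminus).trans (le_of_eq ?_)
    ring
  have htn : ∀ i, ‖t i‖ ≤ k ^ 2 * (P + Q + 2 * Z) := by
    rintro (j | j)
    · rw [hT]; exact hT1
    · rw [hT']; exact hT2
  have hXle : X ≤ k ^ 2 * (P + Q + 2 * Z) * k + Y := by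
    have e : x i₀ = t i₀ * (v i₀ / ρ : ℝ) + (x i₀ - t i₀ * (v i₀ / ρ : ℝ)) := by ring
    rw [hXdef]
    conv_lhs => rw [e]
    refine norm_add_le_of_le ?_ (hxt i₀)
    rw [norm_mul, Complex.norm_real, Real.norm_of_nonneg (div_nonneg (h.v_pos _).le hρ.le)]
    have hv : v i₀ / ρ ≤ k := by rw [div_le_iff₀ hρ]; exact h.v_ub _
    exact mul_le_mul (htn _) hv (div_nonneg (h.v_pos _).le hρ.le) (by positivity)
  have hpow : ∀ {a b : ℕ}, a ≤ b → k ^ a ≤ k ^ b := fun hab => pow_le_pow_right₀ hk1 hab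
  have hA : k ^ 2 * (P + Q + 2 * Z) * k + Y =
      k ^ 3 * (P + Q) + (6 * k ^ 12 + 3 * k ^ 8) * N +
        (16000 * k ^ 29 + 6 * k ^ 12 + 3 * k ^ 8) * (δ * X) := by
    rw [hZ, hY]; ring
  have hB1 : k ^ 3 * (P + Q) ≤ k ^ 12 * (P + Q) :=
    mul_le_mul_of_nonneg_right (hpow (by norm_num)) (by linarith)
  have hB2 : (6 * k ^ 12 + 3 * k ^ 8) * N ≤ (9 * k ^ 12) * N :=
    mul_le_mul_of_nonneg_right (by linarith [hpow (show 8 ≤ 12 by norm_num)]) hN0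
  have hB3 : (16000 * k ^ 29 + 6 * k ^ 12 + 3 * k ^ 8) * (δ * X) ≤
      (16009 * k ^ 29) * (δ * X) :=
    mul_le_mul_of_nonneg_right (by
      linarith [hpow (show 8 ≤ 29 by norm_num), hpow (show 12 ≤ 29 by norm_num)]) (by positivity)
  -- Smallness of `δ` lets the term in `X` be absorbed on the left-hand side.
  have hB4 : (16009 * k ^ 29) * (δ * X) ≤ 1 / 2 * X := by
    rw [← mul_assoc]
    refine mul_le_mul_of_nonneg_right ?_ hX0
    have : 0 ≤ k ^ 29 * δ := by positivity
    linarith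
  have hC : X ≤ 18 * k ^ 12 * (N + P + Q) := by
    have : 0 ≤ k ^ 12 * (P + Q) := by positivity
    linarith
  exact (hX i).trans hC

end EdgeData
end Dyson

/-! ### The algebra of block matrices with four diagonal blocks. -/

namespace BlockMat

variable {n : ℕ}

/-- The matrix exchanging the two blocks. -/
def flip (n : ℕ) : BlockMat n := Matrix.fromBlocks 0 1 1 0

/-- The block matrix whose four blocks are diagonal: `a` is the diagonal of the matrix, and `b`
consists of the diagonals of the off-diagonal blocks. -/
def twoDiag (a b : Fin n ⊕ Fin n → ℂ) : BlockMat n :=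
  Matrix.diagonal a + Matrix.diagonal b * flip n

theorem flip_mul_flip : flip n * flip n = 1 := by
  simp [flip, Matrix.fromBlocks_multiply]

theorem flip_apply (i j : Fin n ⊕ Fin n) : flip n i j = if j = i.swap then 1 else 0 := by
  cases i <;> cases j <;> simp [flip, Matrix.one_apply, eq_comm]

theorem twoDiag_apply (a b : Fin n ⊕ Fin n → ℂ) (i j : Fin n ⊕ Fin n) :
    twoDiag a b i j = (if i = j then a i else 0) + if j = i.swap then b i else 0 := by
  simp [twoDiag, Matrix.diagonal_mul, flip_apply, Matrix.diagonal_apply]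

theorem twoDiag_apply_self (a b : Fin n ⊕ Fin n → ℂ) (i : Fin n ⊕ Fin n) :
    twoDiag a b i i = a i := by
  rw [twoDiag_apply]
  cases i <;> simp

theorem flip_mul_diagonal (a : Fin n ⊕ Fin n → ℂ) :
    flip n * Matrix.diagonal a = Matrix.diagonal (fun i => a i.swap) * flip n := by
  ext i j
  rw [Matrix.mul_diagonal, Matrix.diagonal_mul, flip_apply]
  split_ifs with h
  · rw [h]; ring
  · ring

theorem twoDiag_mul (a b c d : Fin n ⊕ Fin n → ℂ) :
    twoDiag a b * twoDiag c d =
      twoDiag (fun i => a i * c i + b i * d i.swap) (fun i => a i * d i + b i * c i.swap) := by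
  have e1 : Matrix.diagonal b * flip n * Matrix.diagonal c =
      Matrix.diagonal (fun i => b i * c i.swap) * flip n := by
    rw [mul_assoc, flip_mul_diagonal, ← mul_assoc, Matrix.diagonal_mul_diagonal]
  have e2 : Matrix.diagonal b * flip n * (Matrix.diagonal d * flip n) =
      Matrix.diagonal (fun i => b i * d i.swap) := by
    rw [mul_assoc, ← mul_assoc (flip n), flip_mul_diagonal, mul_assoc, flip_mul_flip, mul_one,
      Matrix.diagonal_mul_diagonal]
  rw [twoDiag, twoDiag, add_mul, mul_add, mul_add, e1, e2, Matrix.diagonal_mul_diagonal,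
    ← mul_assoc, Matrix.diagonal_mul_diagonal, twoDiag, ← Matrix.diagonal_add,
    ← Matrix.diagonal_add, add_mul]
  abel

theorem twoDiag_add (a b c d : Fin n ⊕ Fin n → ℂ) :
    twoDiag a b + twoDiag c d = twoDiag (fun i => a i + c i) (fun i => b i + d i) := by
  ext i j
  simp only [Matrix.add_apply, twoDiag_apply]
  split_ifs <;> ring

theorem twoDiag_sub (a b c d : Fin n ⊕ Fin n → ℂ) :
    twoDiag a b - twoDiag c d = twoDiag (fun i => a i - c i) (fun i => b i - d i) := by
  ext i j
  simp only [Matrix.sub_apply, twoDiag_apply]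
  split_ifs <;> ring

theorem smul_twoDiag (t : ℂ) (a b : Fin n ⊕ Fin n → ℂ) :
    t • twoDiag a b = twoDiag (fun i => t * a i) (fun i => t * b i) := by
  ext i j
  simp only [Matrix.smul_apply, twoDiag_apply, smul_eq_mul]
  split_ifs <;> ring

theorem neg_twoDiag (a b : Fin n ⊕ Fin n → ℂ) :
    -twoDiag a b = twoDiag (fun i => -a i) (fun i => -b i) := by
  ext i j
  simp only [Matrix.neg_apply, twoDiag_apply]
  split_ifs <;> ring

theorem conjTranspose_twoDiag (a b : Fin n ⊕ Fin n → ℂ) :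
    (twoDiag a b)ᴴ =
      twoDiag (fun i => (starRingEnd ℂ) (a i)) (fun i => (starRingEnd ℂ) (b i.swap)) := by
  ext i j
  rw [Matrix.conjTranspose_apply, twoDiag_apply, twoDiag_apply, star_add]
  have e : (i = j.swap) ↔ (j = i.swap) := by
    constructor <;> rintro rfl <;> simp
  congr 1
  · by_cases h : j = i
    · subst h; simp
    · simp [h, Ne.symm h]
  · by_cases h : j = i.swap
    · subst h; simp
    · simp [h, e]

theorem twoDiag_diagonal (a : Fin n ⊕ Fin n → ℂ) :
    twoDiag a (fun _ => 0) = Matrix.diagonal a := by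
  ext i j
  simp [twoDiag_apply, Matrix.diagonal_apply]

end BlockMat

/-! ### The vector Dyson equation: uniqueness, purely imaginary diagonal, continuity. -/

namespace Dyson

open BlockMat

variable {n : ℕ}

theorem selfEnergy_eq (S : Matrix (Fin n) (Fin n) ℝ) (R : BlockMat n) :
    selfEnergy S R = Matrix.diagonal (symSC S fun i => R i i) := by
  ext i j
  simp only [selfEnergy, LinearMap.coe_mk, AddHom.coe_mk]
  cases i with
  | inl i =>
    cases j with
    | inl j =>
      by_cases h : i = j
      · subst h
        simp [symSC, symS, Matrix.mulVec, dotProduct, Fintype.sum_sum_type]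
      · simp [h]
    | inr j => simp
  | inr i =>
    cases j with
    | inl j => simp
    | inr j =>
      by_cases h : i = j
      · subst h
        simp [symSC, symS, Matrix.mulVec, dotProduct, Fintype.sum_sum_type]
      · simp [h]

/-- The off-diagonal entries of the matrix Dyson equation. -/
def offDiag (n : ℕ) (z : ℂ) : Fin n ⊕ Fin n → ℂ :=
  Sum.elim (fun _ => z) (fun _ => (starRingEnd ℂ) z)

theorem conj_offDiag_swap (z : ℂ) (i : Fin n ⊕ Fin n) :
    (starRingEnd ℂ) (offDiag n z i.swap) = offDiag n z i := by
  cases i <;> simp [offDiag]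

theorem offDiag_mul_swap (z : ℂ) (i : Fin n ⊕ Fin n) :
    offDiag n z i * offDiag n z i.swap = ((‖z‖ ^ 2 : ℝ) : ℂ) := by
  cases i
  · simp [offDiag, Complex.mul_conj']
  · simp [offDiag, Complex.conj_mul']

theorem norm_offDiag (z : ℂ) (i : Fin n ⊕ Fin n) : ‖offDiag n z i‖ = ‖z‖ := by
  cases i <;> simp [offDiag]

theorem fromBlocks_add_selfEnergy (S : Matrix (Fin n) (Fin n) ℝ) (z : ℂ) (η : ℝ)
    (M : BlockMat n) :
    Matrix.fromBlocks ((Complex.I * (η : ℂ)) • 1) (z • 1)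
      ((starRingEnd ℂ) z • 1) ((Complex.I * (η : ℂ)) • 1) + selfEnergy S M =
      twoDiag (fun i => Complex.I * η + symSC S (fun i => M i i) i) (offDiag n z) := by
  rw [selfEnergy_eq]
  ext i j
  rw [Matrix.add_apply, twoDiag_apply, Matrix.diagonal_apply]
  cases i <;> cases j <;> simp [offDiag, Matrix.one_apply, eq_comm, ite_add_ite]

/-- The vector Dyson equation: `r` is the diagonal of the solution of the matrix Dyson equation
with `|z|² = zz`. -/
def IsVecSolution (S : Matrix (Fin n) (Fin n) ℝ) (zz η : ℝ) (r : Fin n ⊕ Fin n → ℂ) : Prop :=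
  (∀ i, 0 < (r i).im) ∧ ∀ i, r i * ((Complex.I * η + symSC S r i) *
    (Complex.I * η + symSC S r i.swap) - zz) = -(Complex.I * η + symSC S r i.swap)

theorem symSC_im (S : Matrix (Fin n) (Fin n) ℝ) (r : Fin n ⊕ Fin n → ℂ) (i : Fin n ⊕ Fin n) :
    (symSC S r i).im = (symS S *ᵥ fun j => (r j).im) i := by
  simp [symSC, Matrix.mulVec, dotProduct]

theorem symS_nonneg_of_nonneg {S : Matrix (Fin n) (Fin n) ℝ} (hS : ∀ i j, 0 ≤ S i j)
    (i j : Fin n ⊕ Fin n) : 0 ≤ symS S i j := by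
  cases i <;> cases j <;> simp [symS, hS]

theorem symS_mulVec_nonneg_of_nonneg {S : Matrix (Fin n) (Fin n) ℝ} (hS : ∀ i j, 0 ≤ S i j)
    {x : Fin n ⊕ Fin n → ℝ} (hx : ∀ i, 0 ≤ x i) (i : Fin n ⊕ Fin n) :
    0 ≤ (symS S *ᵥ x) i := by
  simp only [Matrix.mulVec, dotProduct]
  exact Finset.sum_nonneg fun j _ => mul_nonneg (symS_nonneg_of_nonneg hS i j) (hx j)

theorem IsVecSolution.im_pos {S : Matrix (Fin n) (Fin n) ℝ} (hS : ∀ i j, 0 ≤ S i j)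
    {η : ℝ} {r : Fin n ⊕ Fin n → ℂ} (hr : ∀ i, 0 < (r i).im)
    (i : Fin n ⊕ Fin n) : η ≤ (Complex.I * η + symSC S r i).im := by
  have := symS_mulVec_nonneg_of_nonneg hS (fun i => (hr i).le) i
  rw [Complex.add_im, symSC_im]
  simpa using this

theorem mul_add_mul_le_sqrt_mul_sqrt {x y x' y' : ℝ} (hx : 0 ≤ x) (hy : 0 ≤ y) (hx' : 0 ≤ x')
    (hy' : 0 ≤ y') : √x * √y + √x' * √y' ≤ √(x + x') * √(y + y') := by
  rw [← Real.sqrt_mul (add_nonneg hx hx')]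
  refine Real.le_sqrt_of_sq_le ?_
  have h1 := Real.sq_sqrt hx
  have h2 := Real.sq_sqrt hy
  have h3 := Real.sq_sqrt hx'
  have h4 := Real.sq_sqrt hy'
  calc (√x * √y + √x' * √y') ^ 2 ≤ (√x ^ 2 + √x' ^ 2) * (√y ^ 2 + √y' ^ 2) := by
        nlinarith [sq_nonneg (√x * √y' - √x' * √y)]
    _ = _ := by rw [h1, h2, h3, h4]

/-- The vector Dyson equation has at most one solution in the upper half-plane. -/
theorem IsVecSolution.unique {S : Matrix (Fin n) (Fin n) ℝ} (hS : ∀ i j, 0 ≤ S i j)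
    {zz η : ℝ} (hzz : 0 ≤ zz) (hη : 0 < η) {r r' : Fin n ⊕ Fin n → ℂ}
    (h : IsVecSolution S zz η r) (h' : IsVecSolution S zz η r') : r = r' := by
  by_contra hne
  obtain ⟨i₁, hi₁⟩ := Function.ne_iff.1 hne
  have : Nonempty (Fin n ⊕ Fin n) := ⟨i₁⟩
  set A : Fin n ⊕ Fin n → ℂ := fun i => Complex.I * η + symSC S r i with hA
  set B : Fin n ⊕ Fin n → ℂ := fun i => Complex.I * η + symSC S r' i with hB
  have hAim : ∀ i, η ≤ (A i).im := IsVecSolution.im_pos hS h.1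
  have hBim : ∀ i, η ≤ (B i).im := IsVecSolution.im_pos hS h'.1
  have ne_of_im : ∀ w : ℂ, 0 < w.im → w ≠ 0 := by rintro w hw rfl; simp at hw
  have hA0 : ∀ i, A i ≠ 0 := fun i => ne_of_im _ (hη.trans_le (hAim i))
  have hB0 : ∀ i, B i ≠ 0 := fun i => ne_of_im _ (hη.trans_le (hBim i))
  have hr0 : ∀ i, r i ≠ 0 := fun i => ne_of_im _ (h.1 i)
  have hr0' : ∀ i, r' i ≠ 0 := fun i => ne_of_im _ (h'.1 i)
  have heq : ∀ i, r i * (A i - zz / A i.swap) = -1 := fun i => by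
    have h1 : r i * (A i * A i.swap - zz) = -A i.swap := h.2 i
    have := hA0 i.swap
    field_simp
    linear_combination h1
  have heq' : ∀ i, r' i * (B i - zz / B i.swap) = -1 := fun i => by
    have h1 : r' i * (B i * B i.swap - zz) = -B i.swap := h'.2 i
    have := hB0 i.swap
    field_simp
    linear_combination h1
  -- The imaginary part of `-1 / ρ = a - zz / b`; it expresses `Im ρ` through the same quantities
  -- that bound the difference of two solutions.
  have him : ∀ (ρ a b : ℂ), ρ ≠ 0 → b ≠ 0 → ρ * (a - zz / b) = -1 →
      ρ.im = ‖ρ‖ ^ 2 * (a.im + zz * b.im / ‖b‖ ^ 2) := by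
    intro ρ a b hρ hb h1
    have h2 : ρ = -(a - zz / b)⁻¹ := by
      rw [← neg_eq_iff_eq_neg]
      refine eq_inv_of_mul_eq_one_left ?_
      linear_combination -h1
    have h3 : ‖ρ‖ ^ 2 = (Complex.normSq (a - zz / b))⁻¹ := by
      rw [h2, norm_neg, norm_inv, inv_pow, Complex.normSq_eq_norm_sq]
    have h4 : (zz / b : ℂ).im = -(zz * b.im / ‖b‖ ^ 2) := by
      rw [Complex.div_im, ← Complex.normSq_eq_norm_sq]
      simp
    conv_lhs => rw [h2]
    rw [h3, Complex.neg_im, Complex.inv_im, Complex.sub_im, h4]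
    ring
  set p : Fin n ⊕ Fin n → ℝ := fun i => (r i).im with hp
  set p' : Fin n ⊕ Fin n → ℝ := fun i => (r' i).im with hp'
  have hp0 : ∀ i, 0 < p i := h.1
  have hp0' : ∀ i, 0 < p' i := h'.1
  have hpp : ∀ i, 0 < √(p i) * √(p' i) := fun i =>
    mul_pos (Real.sqrt_pos.2 (hp0 i)) (Real.sqrt_pos.2 (hp0' i))
  -- The distance used is the maximum of `|r - r'| / √(Im r · Im r')`, a hyperbolic distance up to
  -- reparametrization. The equation strictly contracts it, which is impossible for two distinct
  -- solutions.
  obtain ⟨k, -, hk⟩ := Finset.exists_max_image Finset.univ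
    (fun i => ‖r i - r' i‖ / (√(p i) * √(p' i))) Finset.univ_nonempty
  set κ := ‖r k - r' k‖ / (√(p k) * √(p' k)) with hκ
  have hκ0 : 0 < κ := by
    refine lt_of_lt_of_le ?_ (hk i₁ (Finset.mem_univ _))
    exact div_pos (norm_pos_iff.2 (sub_ne_zero.2 hi₁)) (hpp i₁)
  have hle : ∀ j, ‖r j - r' j‖ ≤ κ * (√(p j) * √(p' j)) := fun j =>
    (div_le_iff₀ (hpp j)).1 (hk j (Finset.mem_univ j))
  -- Cauchy–Schwarz on the sum over `j`; the inequality is strict because `η > 0` enters the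
  -- imaginary parts of `A` and `B` but not their difference.
  have hAB : ∀ i, ‖A i - B i‖ < κ * (√(A i).im * √(B i).im) := by
    intro i
    have e : A i - B i = ∑ j, (symS S i j : ℂ) * (r j - r' j) := by
      simp only [hA, hB, symSC, mul_sub, Finset.sum_sub_distrib]
      ring
    have e1 : (A i).im = η + ∑ j, symS S i j * p j := by
      simp [hA, symSC_im, Matrix.mulVec, dotProduct, hp]
    have e2 : (B i).im = η + ∑ j, symS S i j * p' j := by
      simp [hB, symSC_im, Matrix.mulVec, dotProduct, hp']
    have hs1 : ∀ j, 0 ≤ symS S i j * p j := fun j =>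
      mul_nonneg (symS_nonneg_of_nonneg hS i j) (hp0 j).le
    have hs2 : ∀ j, 0 ≤ symS S i j * p' j := fun j =>
      mul_nonneg (symS_nonneg_of_nonneg hS i j) (hp0' j).le
    have b1 : ‖A i - B i‖ ≤ κ * ∑ j, √(symS S i j * p j) * √(symS S i j * p' j) := by
      rw [e, Finset.mul_sum]
      refine (norm_sum_le _ _).trans (Finset.sum_le_sum fun j _ => ?_)
      have hs := symS_nonneg_of_nonneg hS i j
      rw [norm_mul, Complex.norm_real, Real.norm_of_nonneg hs, Real.sqrt_mul hs, Real.sqrt_mul hs]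
      have := Real.mul_self_sqrt hs
      calc symS S i j * ‖r j - r' j‖ ≤ symS S i j * (κ * (√(p j) * √(p' j))) := by
            gcongr
            exact hle j
        _ = _ := by linear_combination (-(κ * √(p j) * √(p' j))) * this
    have b2 := Real.sum_sqrt_mul_sqrt_le Finset.univ hs1 hs2
    refine (b1.trans (mul_le_mul_of_nonneg_left b2 hκ0.le)).trans_lt ?_
    refine mul_lt_mul_of_pos_left ?_ hκ0
    have := Finset.sum_nonneg fun j (_ : j ∈ Finset.univ) => hs1 j
    have := Finset.sum_nonneg fun j (_ : j ∈ Finset.univ) => hs2 j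
    refine mul_lt_mul'' ?_ ?_ (Real.sqrt_nonneg _) (Real.sqrt_nonneg _)
    · rw [e1]; exact Real.sqrt_lt_sqrt (by assumption) (by linarith)
    · rw [e2]; exact Real.sqrt_lt_sqrt (by assumption) (by linarith)
  -- Resolvent identity: `r - r'` is `r r'` times the difference of `A - zz / A'` and `B - zz / B'`.
  have hdiff : r k - r' k = r k * r' k * ((A k - B k) +
      zz * (A k.swap - B k.swap) / (A k.swap * B k.swap)) := by
    have h1 := heq k
    have h2 := heq' k
    have e : (zz : ℂ) * (A k.swap - B k.swap) / (A k.swap * B k.swap) =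
        zz / B k.swap - zz / A k.swap := by
      have := hA0 k.swap
      have := hB0 k.swap
      field_simp
    rw [e]
    linear_combination (-(r' k)) * h1 + r k * h2
  have hAk := hAim k
  have hBk := hBim k
  have hAs := hAim k.swap
  have hBs := hBim k.swap
  have hnA : 0 < ‖A k.swap‖ := norm_pos_iff.2 (hA0 _)
  have hnB : 0 < ‖B k.swap‖ := norm_pos_iff.2 (hB0 _)
  have c2 : ‖(zz : ℂ) * (A k.swap - B k.swap) / (A k.swap * B k.swap)‖ ≤
      κ * (√(zz * (A k.swap).im / ‖A k.swap‖ ^ 2) * √(zz * (B k.swap).im / ‖B k.swap‖ ^ 2)) := by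
    rw [norm_div, norm_mul, norm_mul, Complex.norm_real, Real.norm_of_nonneg hzz,
      Real.sqrt_div (mul_nonneg hzz (by linarith)), Real.sqrt_div (mul_nonneg hzz (by linarith)),
      Real.sqrt_sq hnA.le, Real.sqrt_sq hnB.le, Real.sqrt_mul hzz, Real.sqrt_mul hzz,
      div_mul_div_comm, mul_div_assoc' κ]
    refine div_le_div_of_nonneg_right ?_ (by positivity)
    have := Real.mul_self_sqrt hzz
    calc zz * ‖A k.swap - B k.swap‖ ≤ zz * (κ * (√(A k.swap).im * √(B k.swap).im)) := by
          gcongr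
          exact (hAB k.swap).le
      _ = _ := by linear_combination (-(κ * √(A k.swap).im * √(B k.swap).im)) * this
  have hrr : 0 < ‖r k‖ * ‖r' k‖ := mul_pos (norm_pos_iff.2 (hr0 k)) (norm_pos_iff.2 (hr0' k))
  have hlt : ‖r k - r' k‖ < κ * (√(p k) * √(p' k)) := by
    rw [hdiff, norm_mul, norm_mul]
    have c3 := mul_add_mul_le_sqrt_mul_sqrt (x := (A k).im) (y := (B k).im)
      (x' := zz * (A k.swap).im / ‖A k.swap‖ ^ 2) (y' := zz * (B k.swap).im / ‖B k.swap‖ ^ 2)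
      (by linarith) (by linarith)
      (div_nonneg (mul_nonneg hzz (by linarith)) (by positivity))
      (div_nonneg (mul_nonneg hzz (by linarith)) (by positivity))
    calc ‖r k‖ * ‖r' k‖ * ‖(A k - B k) + zz * (A k.swap - B k.swap) / (A k.swap * B k.swap)‖
        < ‖r k‖ * ‖r' k‖ * (κ * (√((A k).im + zz * (A k.swap).im / ‖A k.swap‖ ^ 2) *
            √((B k).im + zz * (B k.swap).im / ‖B k.swap‖ ^ 2))) := by
          refine mul_lt_mul_of_pos_left ?_ hrr
          refine (norm_add_le _ _).trans_lt ?_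
          refine (add_lt_add_of_lt_of_le (hAB k) c2).trans_le ?_
          rw [← mul_add]
          exact mul_le_mul_of_nonneg_left c3 hκ0.le
      _ = κ * (√(p k) * √(p' k)) := by
          simp only [hp, hp']
          rw [him (r k) (A k) (A k.swap) (hr0 k) (hA0 _) (heq k),
            him (r' k) (B k) (B k.swap) (hr0' k) (hB0 _) (heq' k),
            Real.sqrt_mul (by positivity), Real.sqrt_mul (by positivity),
            Real.sqrt_sq (norm_nonneg _), Real.sqrt_sq (norm_nonneg _)]
          ring
  have : κ * (√(p k) * √(p' k)) = ‖r k - r' k‖ := div_mul_cancel₀ _ (hpp k).ne'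
  linarith

/-- The positive vector equation `v (a a' + zz) = a'` with `a = η + 𝕊 v`. -/
def IsPosSolution (S : Matrix (Fin n) (Fin n) ℝ) (zz η : ℝ) (v : Fin n ⊕ Fin n → ℝ) : Prop :=
  (∀ i, 0 < v i) ∧ ∀ i, v i * ((η + (symS S *ᵥ v) i) * (η + (symS S *ᵥ v) i.swap) + zz) =
    η + (symS S *ᵥ v) i.swap

theorem symSC_I_mul (S : Matrix (Fin n) (Fin n) ℝ) (v : Fin n ⊕ Fin n → ℝ)
    (i : Fin n ⊕ Fin n) :
    symSC S (fun j => Complex.I * (v j : ℂ)) i = Complex.I * ((symS S *ᵥ v) i : ℝ) := by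
  rw [← symSC_ofReal]
  simp only [symSC, Finset.mul_sum]
  exact Finset.sum_congr rfl fun j _ => by ring

theorem isPosSolution_iff (S : Matrix (Fin n) (Fin n) ℝ) (zz η : ℝ) (v : Fin n ⊕ Fin n → ℝ) :
    IsPosSolution S zz η v ↔ IsVecSolution S zz η (fun i => Complex.I * (v i : ℂ)) := by
  refine and_congr (by simp) (forall_congr' fun i => ?_)
  rw [symSC_I_mul, symSC_I_mul]
  have e : (Complex.I * (v i : ℂ)) * ((Complex.I * η + Complex.I * ((symS S *ᵥ v) i : ℝ)) *
      (Complex.I * η + Complex.I * ((symS S *ᵥ v) i.swap : ℝ)) - zz) =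
      -(Complex.I * ((v i * ((η + (symS S *ᵥ v) i) * (η + (symS S *ᵥ v) i.swap) + zz) : ℝ) : ℂ)) := by
    push_cast
    linear_combination (Complex.I * v i * (η + ((symS S *ᵥ v) i : ℝ)) *
      (η + ((symS S *ᵥ v) i.swap : ℝ)) : ℂ) * Complex.I_mul_I
  rw [e, ← mul_add, neg_inj, ← Complex.ofReal_add]
  rw [mul_right_inj' Complex.I_ne_zero, Complex.ofReal_inj]

theorem IsPosSolution.unique {S : Matrix (Fin n) (Fin n) ℝ} (hS : ∀ i j, 0 ≤ S i j)
    {zz η : ℝ} (hzz : 0 ≤ zz) (hη : 0 < η) {v v' : Fin n ⊕ Fin n → ℝ}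
    (h : IsPosSolution S zz η v) (h' : IsPosSolution S zz η v') : v = v' := by
  have := ((isPosSolution_iff S zz η v).1 h).unique hS hzz hη ((isPosSolution_iff S zz η v').1 h')
  ext i
  have := congrFun this i
  exact Complex.ofReal_injective (mul_left_cancel₀ Complex.I_ne_zero this)

/-- Solutions of the vector Dyson equation are purely imaginary. -/
theorem IsVecSolution.eq_I_mul {S : Matrix (Fin n) (Fin n) ℝ} (hS : ∀ i j, 0 ≤ S i j)
    {zz η : ℝ} (hzz : 0 ≤ zz) (hη : 0 < η) {r : Fin n ⊕ Fin n → ℂ}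
    (h : IsVecSolution S zz η r) : r = fun i => Complex.I * ((r i).im : ℂ) := by
  have hsym : ∀ i, symSC S (fun j => -(starRingEnd ℂ) (r j)) i = -(starRingEnd ℂ) (symSC S r i) := by
    intro i
    simp [symSC, map_sum]
  -- The equation is invariant under reflection at the imaginary axis, so uniqueness forces the
  -- solution to be its own reflection.
  have h' : IsVecSolution S zz η (fun i => -(starRingEnd ℂ) (r i)) := by
    refine ⟨fun i => by simpa using h.1 i, fun i => ?_⟩
    have h1 := congrArg (starRingEnd ℂ) (h.2 i)
    rw [hsym, hsym]
    simp only [map_mul, map_sub, map_add, map_neg, Complex.conj_I, Complex.conj_ofReal] at h1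
    linear_combination -h1
  have e := h.unique hS hzz hη h'
  ext i
  have := congrFun e i
  have h2 := congrArg Complex.re this
  simp only [Complex.neg_re, Complex.conj_re] at h2
  apply Complex.ext
  · simp; linarith
  · simp

/-- The imaginary part of the diagonal of a matrix. -/
def diagIm (M : BlockMat n) (i : Fin n ⊕ Fin n) : ℝ := (M i i).im

theorem imPart_apply_self (M : BlockMat n) (i : Fin n ⊕ Fin n) :
    imPart M i i = (diagIm M i : ℂ) := by
  rw [imPart, Matrix.smul_apply, Matrix.sub_apply, Matrix.conjTranspose_apply, diagIm, smul_eq_mul]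
  have h := Complex.sub_conj (M i i)
  rw [show star (M i i) = (starRingEnd ℂ) (M i i) from rfl, h]
  have := Complex.I_ne_zero
  push_cast
  field_simp

open scoped ComplexOrder in
-- Multiplying the inverse by the conjugate four-diagonal matrix gives a diagonal matrix, so `M` is
-- obtained in closed form from its own diagonal. Reading off that diagonal gives the vector
-- equation, which forces it to be imaginary.
theorem IsSolution.structure {S : Matrix (Fin n) (Fin n) ℝ} (hS : ∀ i j, 0 ≤ S i j) {z : ℂ}
    {η : ℝ} (hη : 0 < η) {M : BlockMat n} (h : IsSolution S z η M) :
    IsPosSolution S (‖z‖ ^ 2) η (diagIm M) ∧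
      M⁻¹ = -twoDiag (fun i => Complex.I * ((η + (symS S *ᵥ diagIm M) i : ℝ) : ℂ)) (offDiag n z) ∧
      M = twoDiag (fun i => Complex.I * (diagIm M i : ℂ)) (fun i => -(offDiag n z i *
        ((((η + (symS S *ᵥ diagIm M) i) * (η + (symS S *ᵥ diagIm M) i.swap) + ‖z‖ ^ 2)⁻¹ : ℝ)
          : ℂ))) := by
  obtain ⟨h1, h2⟩ := h
  rw [fromBlocks_add_selfEnergy] at h1
  have hpos : ∀ i, 0 < (M i i).im := by
    intro i
    have := h2.diag_pos (i := i)
    rw [imPart_apply_self] at this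
    exact_mod_cast this
  set A : Fin n ⊕ Fin n → ℂ := fun i => Complex.I * η + symSC S (fun i => M i i) i with hA
  have hAim : ∀ i, η ≤ (A i).im := IsVecSolution.im_pos hS hpos
  have hA0 : ∀ i, A i ≠ 0 := by
    intro i hi
    have := hAim i
    rw [hi] at this
    simp at this
    linarith
  have hMul : M * twoDiag A (offDiag n z) = -1 := by
    rw [← h1, mul_neg, neg_inj]
    -- A singular `M` has `M⁻¹ = 0` by convention, which would contradict the nonzero diagonal of
    -- the right-hand side of the Dyson equation.
    by_cases hdet : IsUnit M.det
    · exact Matrix.mul_nonsing_inv M hdet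
    · ext i j
      have h3 := congrFun (congrFun h1 i) i
      rw [Matrix.nonsing_inv_apply_not_isUnit M hdet, twoDiag_apply_self] at h3
      exact absurd h3.symm (by simpa using hA0 i)
  have hdiag : twoDiag A (offDiag n z) * twoDiag (fun i => A i.swap) (fun i => -offDiag n z i) =
      Matrix.diagonal (fun i => A i * A i.swap - ((‖z‖ ^ 2 : ℝ) : ℂ)) := by
    rw [twoDiag_mul, ← twoDiag_diagonal]
    congr 1 <;> ext i
    · rw [← offDiag_mul_swap z i]; ring
    · rw [Sum.swap_swap]; ring
  have hM : M * Matrix.diagonal (fun i => A i * A i.swap - ((‖z‖ ^ 2 : ℝ) : ℂ)) =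
      twoDiag (fun i => -A i.swap) (fun i => offDiag n z i) := by
    rw [← hdiag, ← mul_assoc, hMul, neg_one_mul, neg_twoDiag]
    simp
  have hvec : IsVecSolution S (‖z‖ ^ 2) η (fun i => M i i) := by
    refine ⟨hpos, fun i => ?_⟩
    have := congrFun (congrFun hM i) i
    rw [Matrix.mul_diagonal, twoDiag_apply_self] at this
    exact this
  have hI := hvec.eq_I_mul hS (sq_nonneg _) hη
  have hps : IsPosSolution S (‖z‖ ^ 2) η (diagIm M) := by
    rw [isPosSolution_iff]
    rw [hI] at hvec
    exact hvec
  have hAI : ∀ i, A i = Complex.I * ((η + (symS S *ᵥ diagIm M) i : ℝ) : ℂ) := by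
    intro i
    simp only [hA]
    rw [hI]
    have := symSC_I_mul S (diagIm M) i
    simp only [diagIm] at this ⊢
    rw [this]
    push_cast
    ring
  have hinv : M⁻¹ = -twoDiag A (offDiag n z) := by rw [← h1, neg_neg]
  refine ⟨hps, by rw [hinv]; congr 2; ext i; exact hAI i, ?_⟩
  set a : Fin n ⊕ Fin n → ℝ := fun i => η + (symS S *ᵥ diagIm M) i with ha
  have hAI' : ∀ i, A i = Complex.I * (a i : ℂ) := hAI
  have ha0 : ∀ i, 0 < a i := fun i => by
    have := symS_mulVec_nonneg_of_nonneg hS (fun i => (hps.1 i).le) i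
    simp only [ha]; linarith
  have hq : ∀ i, 0 < a i * a i.swap + ‖z‖ ^ 2 := fun i =>
    add_pos_of_pos_of_nonneg (mul_pos (ha0 _) (ha0 _)) (sq_nonneg _)
  have hAA : ∀ i, A i * A i.swap - ((‖z‖ ^ 2 : ℝ) : ℂ) =
      -((a i * a i.swap + ‖z‖ ^ 2 : ℝ) : ℂ) := fun i => by
    rw [hAI', hAI']
    push_cast
    linear_combination (a i * a i.swap : ℂ) * Complex.I_mul_I
  have hM2 : M = twoDiag (fun i => -A i.swap) (fun i => offDiag n z i) *
      Matrix.diagonal (fun i => -(((a i * a i.swap + ‖z‖ ^ 2)⁻¹ : ℝ) : ℂ)) := by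
    rw [← hM, mul_assoc, Matrix.diagonal_mul_diagonal]
    have : (fun i => (A i * A i.swap - ((‖z‖ ^ 2 : ℝ) : ℂ)) *
        -(((a i * a i.swap + ‖z‖ ^ 2)⁻¹ : ℝ) : ℂ)) = fun _ => 1 := by
      ext i
      rw [hAA, neg_mul_neg, ← Complex.ofReal_mul, mul_inv_cancel₀ (hq i).ne', Complex.ofReal_one]
    rw [this, Matrix.diagonal_one, mul_one]
  rw [hM2, ← twoDiag_diagonal, twoDiag_mul]
  have hdiagIm : diagIm (twoDiag (fun i => -A i.swap) (fun i => offDiag n z i) *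
      twoDiag (fun i => -(((a i * a i.swap + ‖z‖ ^ 2)⁻¹ : ℝ) : ℂ)) fun _ => 0) = diagIm M := by
    rw [twoDiag_diagonal, ← hM2]
  rw [twoDiag_mul] at hdiagIm
  rw [hdiagIm]
  congr 1 <;> ext i
  · have h3 := hps.2 i
    have h4 : diagIm M i = a i.swap * (a i * a i.swap + ‖z‖ ^ 2)⁻¹ := by
      rw [eq_mul_inv_iff_mul_eq₀ (hq i).ne']
      exact h3
    rw [h4, hAI']
    push_cast
    ring
  · simp only [Sum.swap_swap, mul_zero, zero_add]
    rw [mul_comm (a i.swap) (a i)]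
    ring

/-- The solution depends continuously on the spectral parameter `η`. -/
theorem continuousOn_of_isPosSolution {S : Matrix (Fin n) (Fin n) ℝ} (hS : ∀ i j, 0 ≤ S i j)
    {zz : ℝ} (hzz : 0 ≤ zz) {v : ℝ → Fin n ⊕ Fin n → ℝ} {s : Set ℝ} (hs : ∀ η ∈ s, 0 < η)
    (h : ∀ η ∈ s, IsPosSolution S zz η (v η)) : ContinuousOn v s := by
  intro η₀ hη₀
  have hη₀pos := hs η₀ hη₀
  -- The a priori bound `v ≤ 1 / η` confines the solutions near `η₀` to a compact box, so that only
  -- uniqueness of the limit is needed.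
  have hbound : ∀ η ∈ s, ∀ i, v η i ≤ 1 / η := by
    intro η hη i
    have hpos := h η hη
    have hηpos := hs η hη
    have ha : ∀ i, η ≤ η + (symS S *ᵥ v η) i := fun i => by
      have := symS_mulVec_nonneg_of_nonneg hS (fun i => (hpos.1 i).le) i
      linarith
    set a := fun i => η + (symS S *ᵥ v η) i
    have h1 : v η i * (a i * a i.swap + zz) = a i.swap := hpos.2 i
    have h2 : η ≤ a i := ha i
    have h3 : η ≤ a i.swap := ha i.swap
    have h4 : v η i * (η * a i.swap) ≤ v η i * (a i * a i.swap + zz) := by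
      have := (hpos.1 i).le
      have : η * a i.swap ≤ a i * a i.swap := mul_le_mul_of_nonneg_right h2 (by linarith)
      gcongr
      linarith
    rw [h1] at h4
    rw [le_div_iff₀ hηpos]
    refine le_of_mul_le_mul_right (?_ : v η i * η * a i.swap ≤ 1 * a i.swap) (by linarith)
    linarith
  refine tendsto_of_isCompact_of_unique
    (isCompact_univ_pi fun _ : Fin n ⊕ Fin n => isCompact_Icc (a := (0 : ℝ)) (b := 2 / η₀)) ?_ ?_
  · filter_upwards [self_mem_nhdsWithin,
      mem_nhdsWithin_of_mem_nhds (lt_mem_nhds (half_lt_self hη₀pos))] with η hη hη2 i _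
    refine ⟨((h η hη).1 i).le, (hbound η hη i).trans ?_⟩
    rw [div_le_div_iff₀ (hs η hη) hη₀pos]
    linarith
  rintro y ⟨U, hU, hy⟩
  have hUs : ∀ᶠ η in (U : Filter ℝ), η ∈ s := hU self_mem_nhdsWithin
  have hUη : Filter.Tendsto (fun η : ℝ => η) U (nhds η₀) := hU.trans nhdsWithin_le_nhds
  have hyi : ∀ i, Filter.Tendsto (fun η => v η i) U (nhds (y i)) := fun i =>
    (tendsto_pi_nhds.1 hy) i
  have hy0 : ∀ i, 0 ≤ y i := fun i =>
    ge_of_tendsto (hyi i) (by filter_upwards [hUs] with η hη using ((h η hη).1 i).le)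
  have ha : ∀ i, Filter.Tendsto (fun η => η + (symS S *ᵥ v η) i) U
      (nhds (η₀ + (symS S *ᵥ y) i)) := fun i => by
    refine hUη.add ?_
    simp only [Matrix.mulVec, dotProduct]
    exact tendsto_finsetSum _ fun j _ => (hyi j).const_mul _
  have heq : ∀ i, y i * ((η₀ + (symS S *ᵥ y) i) * (η₀ + (symS S *ᵥ y) i.swap) + zz) =
      η₀ + (symS S *ᵥ y) i.swap := by
    intro i
    refine tendsto_nhds_unique_of_eventuallyEq
      ((hyi i).mul (((ha i).mul (ha i.swap)).add_const zz)) (ha i.swap) ?_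
    filter_upwards [hUs] with η hη using (h η hη).2 i
  refine IsPosSolution.unique hS hzz hη₀pos ⟨fun i => ?_, heq⟩ (h η₀ hη₀)
  -- A vanishing coordinate of the limit would make `η₀ + 𝕊 y` vanish at the exchanged index,
  -- although it is at least `η₀ > 0`.
  refine lt_of_le_of_ne (hy0 i) fun h0 => ?_
  have h1 := heq i
  rw [← h0, zero_mul] at h1
  have := symS_mulVec_nonneg_of_nonneg hS hy0 i.swap
  linarith

end Dyson

/-! ### Size of the solution near the spectral edge. -/

namespace Dyson

open BlockMat

variable {n : ℕ}

/-- The vector `a = η + 𝕊 v`. -/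
def edgeA (S : Matrix (Fin n) (Fin n) ℝ) (η : ℝ) (v : Fin n ⊕ Fin n → ℝ) (i : Fin n ⊕ Fin n) :
    ℝ := η + (symS S *ᵥ v) i

/-- The vector `u = 1 / (a a' + |z|²)`. -/
noncomputable def edgeU (S : Matrix (Fin n) (Fin n) ℝ) (zz η : ℝ) (v : Fin n ⊕ Fin n → ℝ)
    (i : Fin n ⊕ Fin n) : ℝ := (edgeA S η v i * edgeA S η v i.swap + zz)⁻¹

theorem density_eq (M : BlockMat n) :
    density M = (1 / Real.pi) * ((2 * (n : ℝ))⁻¹ * ∑ i, diagIm M i) := by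
  have h1 : (imPart M).trace = ((∑ i, diagIm M i : ℝ) : ℂ) := by
    rw [Matrix.trace, Complex.ofReal_sum]
    exact Finset.sum_congr rfl fun i _ => imPart_apply_self M i
  have h2 : ((2 : ℂ) * (n : ℂ))⁻¹ = ((2 * (n : ℝ))⁻¹ : ℝ) := by push_cast; rfl
  rw [density, avg, h1, h2, ← Complex.ofReal_mul, Complex.ofReal_re]

/-- The comparison constant of the data at the spectral edge. -/
noncomputable def edgeConst (sLow sUp τ : ℝ) : ℝ :=
  1 + 1 / sLow + sUp + 2 / sLow + ((1 + sUp * Real.pi) ^ 2 + τ ^ 2) + 1 / (sLow * Real.pi) +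
    (1 + sUp * Real.pi) + ((1 + sUp * Real.pi) ^ 2 + τ ^ 2) / (sLow * Real.pi) +
    2 / sLow * (1 + sUp * Real.pi)

/-- The equation gives `a v = a' v'`. Summed over a block, the quadratic part `∑ v 𝕊 v` agrees for
both blocks, so `η` times the block sums agree too. -/
theorem blockSum_eq_of_isPosSolution {S : Matrix (Fin n) (Fin n) ℝ} {zz η : ℝ} (hη : 0 < η)
    {v : Fin n ⊕ Fin n → ℝ} (h : IsPosSolution S zz η v) :
    ∑ j, v (Sum.inl j) = ∑ j, v (Sum.inr j) := by
  have hva : ∀ j, edgeA S η v (Sum.inl j) * v (Sum.inl j) =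
      edgeA S η v (Sum.inr j) * v (Sum.inr j) := by
    intro j
    have h1 : v (Sum.inl j) * (edgeA S η v (Sum.inl j) * edgeA S η v (Sum.inr j) + zz) =
      edgeA S η v (Sum.inr j) := h.2 (Sum.inl j)
    have h2 : v (Sum.inr j) * (edgeA S η v (Sum.inr j) * edgeA S η v (Sum.inl j) + zz) =
      edgeA S η v (Sum.inl j) := h.2 (Sum.inr j)
    linear_combination v (Sum.inr j) * h1 - v (Sum.inl j) * h2
  have hbil : ∑ i, v (Sum.inl i) * (symS S *ᵥ v) (Sum.inl i) =
      ∑ i, v (Sum.inr i) * (symS S *ᵥ v) (Sum.inr i) := by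
    simp only [symS, Matrix.mulVec, dotProduct, Fintype.sum_sum_type, Matrix.fromBlocks_apply₁₁,
      Matrix.fromBlocks_apply₁₂, Matrix.fromBlocks_apply₂₁, Matrix.fromBlocks_apply₂₂,
      Matrix.zero_apply, zero_mul, Finset.sum_const_zero, zero_add, add_zero,
      Matrix.transpose_apply, Finset.mul_sum]
    rw [Finset.sum_comm]
    exact Finset.sum_congr rfl fun i _ => Finset.sum_congr rfl fun j _ => by ring
  have h1 := Finset.sum_congr rfl fun j (_ : j ∈ Finset.univ) => hva j
  simp only [edgeA, add_mul, Finset.sum_add_distrib, ← Finset.mul_sum] at h1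
  simp only [mul_comm (v _)] at hbil
  rw [hbil] at h1
  exact mul_left_cancel₀ hη.ne' (add_right_cancel h1)

/-- Flatness and equal block sums make `𝕊 v` of order `ρ`, and `η ≤ ρ` gives the same for `a`. A
lower bound on `|z|²` then makes `u`, hence `v = u a'`, comparable to its expected size. -/
theorem edgeData_of_isPosSolution {sLow sUp τ : ℝ} (hsLow : 0 < sLow) (hsUp : sLow < sUp)
    (hn : 0 < n) {S : Matrix (Fin n) (Fin n) ℝ} (hS : IsFlat sLow sUp S) {zz η ρ : ℝ}
    (hzz : 0 ≤ zz) (hzτ : zz ≤ τ ^ 2) (hη : 0 < η) {v : Fin n ⊕ Fin n → ℝ}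
    (h : IsPosSolution S zz η v)
    (hρv : ρ = (1 / Real.pi) * ((2 * (n : ℝ))⁻¹ * ∑ i, v i)) (hρ1 : ρ ≤ 1) (hηρ : η / ρ ≤ 1)
    (hsmall : (1 + sUp * Real.pi) ^ 2 * ρ ≤ sLow / 2) :
    EdgeData (edgeConst sLow sUp τ) S zz η ρ v (edgeA S η v) (edgeU S zz η v) := by
  have hpi := Real.pi_pos
  have hn' : (0 : ℝ) < n := by exact_mod_cast hn
  have hsUp0 : 0 < sUp := hsLow.trans hsUp
  have : Nonempty (Fin n ⊕ Fin n) := ⟨Sum.inl ⟨0, hn⟩⟩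
  have hS0 : ∀ i j, 0 ≤ S i j := fun i j => le_trans (by positivity) (hS i j).1
  have hv := h.1
  have hsumpos : 0 < ∑ i, v i := Finset.sum_pos (fun i _ => hv i) Finset.univ_nonempty
  have hρ : 0 < ρ := by rw [hρv]; positivity
  have hηle : η ≤ ρ := by rwa [div_le_one hρ] at hηρ
  have hsum : ∑ i, v i = 2 * (n * Real.pi * ρ) := by
    rw [hρv]; field_simp
  have hbl := blockSum_eq_of_isPosSolution hη h
  rw [Fintype.sum_sum_type] at hsum
  have hl : ∑ j, v (Sum.inl j) = n * Real.pi * ρ := by linarith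
  have hr : ∑ j, v (Sum.inr j) = n * Real.pi * ρ := by linarith
  have hsv : ∀ i, sLow * Real.pi * ρ ≤ (symS S *ᵥ v) i ∧
      (symS S *ᵥ v) i ≤ sUp * Real.pi * ρ := by
    have key : ∀ (s : Fin n → ℝ) (y : Fin n → ℝ), (∀ j, 0 < y j) →
        (∀ j, sLow / n ≤ s j ∧ s j ≤ sUp / n) → ∑ j, y j = n * Real.pi * ρ →
        sLow * Real.pi * ρ ≤ ∑ j, s j * y j ∧ ∑ j, s j * y j ≤ sUp * Real.pi * ρ := by
      intro s y hy hs hys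
      constructor
      · calc sLow * Real.pi * ρ = ∑ j, sLow / n * y j := by
              rw [← Finset.mul_sum, hys]; field_simp
          _ ≤ _ := Finset.sum_le_sum fun j _ => mul_le_mul_of_nonneg_right (hs j).1 (hy j).le
      · calc ∑ j, s j * y j ≤ ∑ j, sUp / n * y j :=
              Finset.sum_le_sum fun j _ => mul_le_mul_of_nonneg_right (hs j).2 (hy j).le
          _ = _ := by rw [← Finset.mul_sum, hys]; field_simp
    rintro (i | i)
    · have := key (fun j => S i j) (fun j => v (Sum.inr j)) (fun j => hv _) (hS i) hr
      simpa [symS, Matrix.mulVec, dotProduct, Fintype.sum_sum_type] using this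
    · have := key (fun j => S j i) (fun j => v (Sum.inl j)) (fun j => hv _) (fun j => hS j i) hl
      simpa [symS, Matrix.mulVec, dotProduct, Fintype.sum_sum_type] using this
  set a := edgeA S η v with ha
  set u := edgeU S zz η v with hu
  set K := 1 + sUp * Real.pi with hK
  have hK1 : 1 ≤ K := by rw [hK]; have := mul_pos hsUp0 hpi; linarith
  have ha_lb : ∀ i, sLow * Real.pi * ρ ≤ a i := fun i => by
    have : a i = η + (symS S *ᵥ v) i := rfl
    linarith [(hsv i).1]
  have ha_ub : ∀ i, a i ≤ K * ρ := fun i => by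
    have : a i = η + (symS S *ᵥ v) i := rfl
    rw [hK]
    linarith [(hsv i).2]
  have hslp : 0 < sLow * Real.pi * ρ := by positivity
  have ha0 : ∀ i, 0 < a i := fun i => hslp.trans_le (ha_lb i)
  have hq0 : ∀ i, 0 < a i * a i.swap + zz := fun i =>
    add_pos_of_pos_of_nonneg (mul_pos (ha0 _) (ha0 _)) hzz
  have hu_eq : ∀ i, u i = (a i * a i.swap + zz)⁻¹ := fun i => rfl
  have hu0 : ∀ i, 0 < u i := fun i => by rw [hu_eq]; exact inv_pos.2 (hq0 i)
  have hueq1 : ∀ i, u i * (a i * a i.swap + zz) = 1 := fun i => by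
    rw [hu_eq]; exact inv_mul_cancel₀ (hq0 i).ne'
  have hv_eq : ∀ i, v i = u i * a i.swap := fun i => by
    have h1 : v i * (a i * a i.swap + zz) = a i.swap := h.2 i
    rw [← h1]
    linear_combination (-(v i)) * hueq1 i
  have haa : ∀ i, a i * a i.swap ≤ K ^ 2 * ρ := fun i => by
    calc a i * a i.swap ≤ (K * ρ) * (K * ρ) :=
          mul_le_mul (ha_ub _) (ha_ub _) (ha0 _).le (by positivity)
      _ = K ^ 2 * ρ * ρ := by ring
      _ ≤ K ^ 2 * ρ * 1 := by gcongr
      _ = _ := mul_one _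
  -- A small density excludes small `|z|`: averaging `v ≥ sLow π ρ / (K² ρ + zz)` against the known
  -- block sum gives `sLow ≤ K² ρ + zz`, and the first term is at most half of `sLow`.
  have hzlb : sLow / 2 ≤ zz := by
    have h1 : ∀ j, sLow * Real.pi * ρ * (K ^ 2 * ρ + zz)⁻¹ ≤ v (Sum.inl j) := fun j => by
      rw [hv_eq, mul_comm (u _), hu_eq]
      have := haa (Sum.inl j)
      have := hq0 (Sum.inl j)
      have := (ha0 (Sum.inl j).swap).le
      gcongr
      exact ha_lb _
    have h2 := Finset.sum_le_sum fun j (_ : j ∈ Finset.univ) => h1 j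
    rw [hl, Finset.sum_const, Finset.card_univ, Fintype.card_fin, nsmul_eq_mul] at h2
    have h0 : 0 < K ^ 2 * ρ + zz := by positivity
    have h3 : sLow * (K ^ 2 * ρ + zz)⁻¹ ≤ 1 := by
      refine le_of_mul_le_mul_right (?_ : _ * (n * Real.pi * ρ) ≤ 1 * (n * Real.pi * ρ))
        (by positivity)
      linarith
    rw [← div_eq_mul_inv, div_le_one h0] at h3
    linarith
  have hzz0 : 0 < zz := lt_of_lt_of_le (by positivity) hzlb
  have hu_ub : ∀ i, u i ≤ 2 / sLow := fun i => by
    rw [hu_eq, inv_le_comm₀ (hq0 i) (by positivity), inv_div]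
    linarith [mul_pos (ha0 i) (ha0 i.swap)]
  have hD : 0 < K ^ 2 + τ ^ 2 := by positivity
  have hu_lb : ∀ i, 1 / (K ^ 2 + τ ^ 2) ≤ u i := fun i => by
    rw [hu_eq, one_div]
    have h1 : K ^ 2 * ρ ≤ K ^ 2 * 1 := by gcongr
    exact inv_anti₀ (hq0 i) (by linarith [haa i])
  -- The constant is a sum of positive terms, arranged so that each bound below follows from one
  -- summand.
  set k := edgeConst sLow sUp τ with hk
  have hkdef : k = 1 + 1 / sLow + sUp + 2 / sLow + (K ^ 2 + τ ^ 2) + 1 / (sLow * Real.pi) +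
    K + (K ^ 2 + τ ^ 2) / (sLow * Real.pi) + 2 / sLow * K := rfl
  have p1 : 0 < 1 / sLow := by positivity
  have p2 : 0 < 2 / sLow := by positivity
  have p3 : 0 < 1 / (sLow * Real.pi) := by positivity
  have p4 : 0 < (K ^ 2 + τ ^ 2) / (sLow * Real.pi) := by positivity
  have p5 : 0 < 2 / sLow * K := by positivity
  have hk0 : 0 < k := by linarith
  have inv_le : ∀ c : ℝ, 0 < c → 1 / c ≤ k → 1 / k ≤ c := fun c hc h => by
    rwa [one_div_le hk0 hc]
  constructor
  · linarith
  · exact hn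
  · exact hη
  · exact hρ
  · exact hρ1
  · intro i j
    refine le_trans ?_ (hS i j).1
    rw [← div_div]
    exact div_le_div_of_nonneg_right (inv_le sLow hsLow (by linarith)) hn'.le
  · intro i j
    exact (hS i j).2.trans (div_le_div_of_nonneg_right (by linarith) hn'.le)
  · exact fun i => rfl
  · exact hv_eq
  · exact hueq1
  · exact hzz
  · exact fun i => (inv_le _ (by positivity) (by rw [one_div_one_div]; linarith)).trans (hu_lb i)
  · exact fun i => (hu_ub i).trans (by linarith)
  · intro i
    rw [hv_eq]
    have h1 : 1 / k ≤ sLow * Real.pi / (K ^ 2 + τ ^ 2) :=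
      inv_le _ (by positivity) (by rw [one_div_div]; linarith)
    calc ρ / k = 1 / k * ρ := by ring
      _ ≤ sLow * Real.pi / (K ^ 2 + τ ^ 2) * ρ := by gcongr
      _ = 1 / (K ^ 2 + τ ^ 2) * (sLow * Real.pi * ρ) := by ring
      _ ≤ u i * a i.swap := mul_le_mul (hu_lb i) (ha_lb _) hslp.le (hu0 i).le
  · intro i
    rw [hv_eq]
    calc u i * a i.swap ≤ 2 / sLow * (K * ρ) :=
          mul_le_mul (hu_ub i) (ha_ub _) (ha0 _).le p2.le
      _ = (2 / sLow * K) * ρ := by ring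
      _ ≤ k * ρ := by gcongr; linarith
  · intro i
    refine le_trans ?_ (ha_lb i)
    have h1 : 1 / k ≤ sLow * Real.pi := inv_le _ (by positivity) (by linarith)
    calc ρ / k = 1 / k * ρ := by ring
      _ ≤ _ := by gcongr
  · intro i
    refine (ha_ub i).trans ?_
    gcongr
    linarith
  · rintro (i | i)
    · exact hl
    · exact hr

end Dyson

/-! ### Linear algebra of two isolated simple eigenvalues. -/

/-- Two eigenvectors `b`, `b'` of `T` and left eigenvectors `φ`, `φ'` with distinct small eigenvalues
`β`, `β'`, such that `T` has no small eigenvalue on the common kernel of `φ` and `φ'`. -/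
structure Module.End.IsolatedPair {V : Type*} [AddCommGroup V] [Module ℂ V] (T : Module.End ℂ V)
    (ε : ℝ) (β β' : ℂ) (b b' : V) (φ φ' : V →ₗ[ℂ] ℂ) : Prop where
  ne : β ≠ β'
  norm_lt : ‖β‖ < ε
  norm_lt' : ‖β'‖ < ε
  map_b : T b = β • b
  map_b' : T b' = β' • b'
  φ_map : ∀ x, φ (T x) = β * φ x
  φ_map' : ∀ x, φ' (T x) = β' * φ' x
  φ_b : φ b ≠ 0
  φ_b' : φ' b' ≠ 0
  eq_zero : ∀ ζ : ℂ, ‖ζ‖ < ε → ∀ x, φ x = 0 → φ' x = 0 → T x = ζ • x → x = 0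

namespace Module.End.IsolatedPair

variable {V : Type*} [AddCommGroup V] [Module ℂ V] {T : Module.End ℂ V}
  {ε : ℝ} {β β' : ℂ} {b b' : V} {φ φ' : V →ₗ[ℂ] ℂ}

theorem symm (h : T.IsolatedPair ε β β' b b' φ φ') : T.IsolatedPair ε β' β b' b φ' φ :=
  ⟨h.ne.symm, h.norm_lt', h.norm_lt, h.map_b', h.map_b, h.φ_map', h.φ_map, h.φ_b', h.φ_b,
    fun ζ hζ x h1 h2 => h.eq_zero ζ hζ x h2 h1⟩

theorem φ_b'_eq_zero (h : T.IsolatedPair ε β β' b b' φ φ') : φ b' = 0 := by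
  have h1 := h.φ_map b'
  rw [h.map_b', map_smul, smul_eq_mul] at h1
  exact (mul_eq_mul_right_iff.1 h1).resolve_left h.ne.symm

theorem b_ne_zero (h : T.IsolatedPair ε β β' b b' φ φ') : b ≠ 0 := by
  rintro rfl
  exact h.φ_b (map_zero φ)

/-- Subtracting the components along `b` and `b'` gives a vector in both kernels that still solves
the eigenvalue equation: a component is nonzero only if its eigenvalue is `ζ`. -/
theorem eq_smul_add_smul (h : T.IsolatedPair ε β β' b b' φ φ') {ζ : ℂ} (hζ : ‖ζ‖ < ε) {x : V}
    (hx : T x = ζ • x) : x = (φ x / φ b) • b + (φ' x / φ' b') • b' := by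
  have h1 : (β - ζ) * φ x = 0 := by
    have := h.φ_map x
    rw [hx, map_smul, smul_eq_mul] at this
    linear_combination -this
  have h2 : (β' - ζ) * φ' x = 0 := by
    have := h.φ_map' x
    rw [hx, map_smul, smul_eq_mul] at this
    linear_combination -this
  refine sub_eq_zero.1 (h.eq_zero ζ hζ _ ?_ ?_ ?_)
  · simp [h.φ_b'_eq_zero, div_mul_cancel₀ _ h.φ_b]
  · simp [h.symm.φ_b'_eq_zero, div_mul_cancel₀ _ h.φ_b']
  · rw [map_sub, map_add, map_smul, map_smul, hx, h.map_b, h.map_b', smul_sub, smul_add]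
    congr 1
    rw [smul_smul, smul_smul, smul_smul, smul_smul]
    congr 2
    · linear_combination (φ b)⁻¹ * h1
    · linear_combination (φ' b')⁻¹ * h2

theorem eq_smul (h : T.IsolatedPair ε β β' b b' φ φ') {x : V} (hx : T x = β • x) :
    x = (φ x / φ b) • b := by
  have h1 := h.eq_smul_add_smul h.norm_lt hx
  have h2 : φ' x = 0 := by
    have := h.φ_map' x
    rw [hx, map_smul, smul_eq_mul] at this
    exact (mul_eq_mul_right_iff.1 this).resolve_left h.ne
  rwa [h2, zero_div, zero_smul, add_zero] at h1

theorem finrank_eigenspace (h : T.IsolatedPair ε β β' b b' φ φ') :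
    Module.finrank ℂ (T.eigenspace β) = 1 := by
  rw [finrank_eq_one_iff']
  refine ⟨⟨b, Module.End.mem_eigenspace_iff.2 h.map_b⟩, ?_, ?_⟩
  · exact fun h0 => h.b_ne_zero (congrArg Subtype.val h0)
  · rintro ⟨w, hw⟩
    exact ⟨φ w / φ b, Subtype.ext (h.eq_smul (Module.End.mem_eigenspace_iff.1 hw)).symm⟩

/-- The functional `φ` kills the range of `T - β`, but not `b`. An element of the range in the
eigenspace, which is spanned by `b`, must therefore be zero, so no Jordan chain has length two. -/
theorem maxGenEigenspace_eq (h : T.IsolatedPair ε β β' b b' φ φ') :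
    T.maxGenEigenspace β = T.eigenspace β := by
  refine le_antisymm ?_ Module.End.eigenspace_le_maxGenEigenspace
  intro x hx
  obtain ⟨k, hk⟩ := (Module.End.mem_maxGenEigenspace T β x).1 hx
  have hstep : ∀ y, ((T - β • 1 : Module.End ℂ V) ^ 2) y = 0 →
      (T - β • 1 : Module.End ℂ V) y = 0 := by
    intro y hy
    have h1 : T ((T - β • 1 : Module.End ℂ V) y) =
        β • (T - β • 1 : Module.End ℂ V) y := by
      rw [pow_two] at hy
      have : (T - β • 1 : Module.End ℂ V) ((T - β • 1 : Module.End ℂ V) y) = 0 := hy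
      simpa [sub_eq_zero] using this
    have h2 := h.eq_smul h1
    have h3 : φ ((T - β • 1 : Module.End ℂ V) y) = 0 := by
      simp [h.φ_map]
    rw [h2, h3, zero_div, zero_smul]
  have hall : ∀ k : ℕ, ∀ y, ((T - β • 1 : Module.End ℂ V) ^ (k + 1)) y = 0 →
      (T - β • 1 : Module.End ℂ V) y = 0 := by
    intro k
    induction k with
    | zero => intro y hy; simpa using hy
    | succ k ih =>
      intro y hy
      rw [pow_succ] at hy
      refine hstep y ?_
      rw [pow_two]
      exact ih _ hy
  have h0 : (T - β • 1 : Module.End ℂ V) x = 0 := by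
    refine hall k x ?_
    rw [pow_succ', Module.End.mul_apply, hk, map_zero]
  exact Module.End.mem_eigenspace_iff.2 (by simpa [sub_eq_zero] using h0)

theorem rootMultiplicity [FiniteDimensional ℂ V] (h : T.IsolatedPair ε β β' b b' φ φ') :
    T.charpoly.rootMultiplicity β = 1 := by
  rw [← LinearMap.finrank_maxGenEigenspace_eq, h.maxGenEigenspace_eq, h.finrank_eigenspace]

theorem hasEigenvalue (h : T.IsolatedPair ε β β' b b' φ φ') : T.HasEigenvalue β :=
  Module.End.hasEigenvalue_of_hasEigenvector
    ⟨Module.End.mem_eigenspace_iff.2 h.map_b, h.b_ne_zero⟩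

theorem spectrum_inter_ball [FiniteDimensional ℂ V] (h : T.IsolatedPair ε β β' b b' φ φ') :
    spectrum ℂ T ∩ Metric.ball 0 ε = {β, β'} := by
  ext ζ
  constructor
  · rintro ⟨h1, h2⟩
    rw [mem_ball_zero_iff] at h2
    obtain ⟨x, hx, hx0⟩ := (Module.End.hasEigenvalue_iff_mem_spectrum.2 h1).exists_hasEigenvector
    have hx1 := Module.End.mem_eigenspace_iff.1 hx
    by_contra hne
    simp only [Set.mem_insert_iff, Set.mem_singleton_iff, not_or] at hne
    have e1 : φ x = 0 := by
      have := h.φ_map x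
      rw [hx1, map_smul, smul_eq_mul] at this
      exact (mul_eq_mul_right_iff.1 this).resolve_left hne.1
    have e2 : φ' x = 0 := by
      have := h.φ_map' x
      rw [hx1, map_smul, smul_eq_mul] at this
      exact (mul_eq_mul_right_iff.1 this).resolve_left hne.2
    exact hx0 (h.eq_zero ζ h2 x e1 e2 hx1)
  · rintro (rfl | rfl)
    · exact ⟨Module.End.hasEigenvalue_iff_mem_spectrum.1 h.hasEigenvalue,
        mem_ball_zero_iff.2 h.norm_lt⟩
    · exact ⟨Module.End.hasEigenvalue_iff_mem_spectrum.1 h.symm.hasEigenvalue,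
        mem_ball_zero_iff.2 h.norm_lt'⟩

theorem isUnit [FiniteDimensional ℂ V] (h : T.IsolatedPair ε β β' b b' φ φ') (hβ : β ≠ 0)
    (hβ' : β' ≠ 0) : IsUnit T := by
  rw [LinearMap.isUnit_iff_ker_eq_bot, LinearMap.ker_eq_bot']
  intro x hx
  refine h.eq_zero 0 (by simpa using (norm_nonneg _).trans_lt h.norm_lt) x ?_ ?_ (by simpa using hx)
  · have := h.φ_map x
    rw [hx, map_zero] at this
    exact (mul_eq_zero.1 this.symm).resolve_left hβ
  · have := h.φ_map' x
    rw [hx, map_zero] at this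
    exact (mul_eq_zero.1 this.symm).resolve_left hβ'

theorem φ_eq_zero_of_mem_maxGenEigenspace (h : T.IsolatedPair ε β β' b b' φ φ') {ζ : ℂ}
    (hζ : ζ ≠ β) {x : V} (hx : x ∈ T.maxGenEigenspace ζ) : φ x = 0 := by
  obtain ⟨k, hk⟩ := (Module.End.mem_maxGenEigenspace T ζ x).1 hx
  have : ∀ k : ℕ, ∀ y, φ (((T - ζ • 1 : Module.End ℂ V) ^ k) y) = (β - ζ) ^ k * φ y := by
    intro k
    induction k with
    | zero => simp
    | succ k ih =>
      intro y
      rw [pow_succ, Module.End.mul_apply, ih]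
      simp [h.φ_map]
      ring
  have h1 := this k x
  rw [hk, map_zero] at h1
  exact (mul_eq_zero.1 h1.symm).resolve_left (pow_ne_zero _ (sub_ne_zero.2 hζ.symm))

/-- The projection onto the complement of the two eigenvectors along them. -/
theorem iSup_maxGenEigenspace_projection [FiniteDimensional ℂ V]
    (h : T.IsolatedPair ε β β' b b' φ φ')
    (hc : IsCompl (⨆ μ ∈ spectrum ℂ T \ {β, β'}, T.maxGenEigenspace μ)
      (⨆ μ ∈ (spectrum ℂ T \ {β, β'})ᶜ, T.maxGenEigenspace μ)) (x : V) :
    Submodule.projection _ _ hc x = x - (φ x / φ b) • b - (φ' x / φ' b') • b' := by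
  set s := spectrum ℂ T \ {β, β'} with hs
  set p := ⨆ μ ∈ s, T.maxGenEigenspace μ
  set q := ⨆ μ ∈ sᶜ, T.maxGenEigenspace μ
  have hbq : b ∈ q := by
    have hβ : β ∈ sᶜ := by simp [hs]
    exact (le_iSup₂_of_le (f := fun μ (_ : μ ∈ sᶜ) => T.maxGenEigenspace μ) β hβ le_rfl)
      (Module.End.eigenspace_le_maxGenEigenspace (Module.End.mem_eigenspace_iff.2 h.map_b))
  have hbq' : b' ∈ q := by
    have hβ : β' ∈ sᶜ := by simp [hs]
    exact (le_iSup₂_of_le (f := fun μ (_ : μ ∈ sᶜ) => T.maxGenEigenspace μ) β' hβ le_rfl)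
      (Module.End.eigenspace_le_maxGenEigenspace (Module.End.mem_eigenspace_iff.2 h.map_b'))
  -- The space `p` is contained in the common kernel of the functionals, and `q` in the span of the
  -- two eigenvectors. These inclusions identify the projection.
  have hp : p ≤ LinearMap.ker φ ⊓ LinearMap.ker φ' := by
    refine iSup₂_le fun μ hμ y hy => ?_
    have h1 : μ ≠ β := by rintro rfl; simp [hs] at hμ
    have h2 : μ ≠ β' := by rintro rfl; simp [hs] at hμ
    exact ⟨h.φ_eq_zero_of_mem_maxGenEigenspace h1 hy,
      h.symm.φ_eq_zero_of_mem_maxGenEigenspace h2 hy⟩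
  have hq : q ≤ Submodule.span ℂ {b, b'} := by
    refine iSup₂_le fun μ hμ y hy => ?_
    by_cases h1 : μ = β
    · subst h1
      rw [h.maxGenEigenspace_eq] at hy
      rw [h.eq_smul (Module.End.mem_eigenspace_iff.1 hy)]
      exact Submodule.smul_mem _ _ (Submodule.subset_span (by simp))
    by_cases h2 : μ = β'
    · subst h2
      rw [h.symm.maxGenEigenspace_eq] at hy
      rw [h.symm.eq_smul (Module.End.mem_eigenspace_iff.1 hy)]
      exact Submodule.smul_mem _ _ (Submodule.subset_span (by simp))
    -- The complement of the selected part of the spectrum also contains all numbers that are not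
    -- eigenvalues. Their generalized eigenspaces are trivial.
    have h3 : μ ∉ spectrum ℂ T := by
      intro h3
      exact hμ ⟨h3, by simp [h1, h2]⟩
    have h4 : T.maxGenEigenspace μ = ⊥ := by
      by_contra hne
      refine h3 (Module.End.hasEigenvalue_iff_mem_spectrum.1 ?_)
      obtain ⟨k, hk⟩ : ∃ k : ℕ, T.maxGenEigenspace μ = T.genEigenspace μ k :=
        ⟨_, Module.End.maxGenEigenspace_eq T μ⟩
      rw [hk] at hne
      exact Module.End.hasEigenvalue_of_hasGenEigenvalue (k := k) hne
    rw [h4] at hy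
    rw [(Submodule.mem_bot ℂ).1 hy]
    exact Submodule.zero_mem _
  set y := x - (φ x / φ b) • b - (φ' x / φ' b') • b' with hy
  have hφy : φ y = 0 := by
    simp [hy, h.φ_b'_eq_zero, div_mul_cancel₀ _ h.φ_b]
  have hφy' : φ' y = 0 := by
    simp [hy, h.symm.φ_b'_eq_zero, div_mul_cancel₀ _ h.φ_b']
  have hyp : y ∈ p := by
    have h1 : Submodule.projection _ _ hc y ∈ p := Submodule.projection_apply_mem hc y
    have h2 : y - Submodule.projection _ _ hc y ∈ q := Submodule.sub_projection_mem hc y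
    set y₁ := Submodule.projection _ _ hc y
    obtain ⟨c, d, hcd⟩ := Submodule.mem_span_pair.1 (hq h2)
    have h3 := hp h1
    have e1 : c * φ b = 0 := by
      have := congrArg φ hcd
      rw [map_sub, hφy, h3.1] at this
      simpa [h.φ_b'_eq_zero] using this
    have e2 : d * φ' b' = 0 := by
      have := congrArg φ' hcd
      rw [map_sub, hφy', h3.2] at this
      simpa [h.symm.φ_b'_eq_zero] using this
    rw [(mul_eq_zero.1 e1).resolve_right h.φ_b, (mul_eq_zero.1 e2).resolve_right h.φ_b', zero_smul,
      zero_smul, add_zero] at hcd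
    rw [← sub_eq_zero.1 hcd.symm] at h1
    exact h1
  have hx : x = y + ((φ x / φ b) • b + (φ' x / φ' b') • b') := by rw [hy]; abel
  conv_lhs => rw [hx]
  rw [map_add, Submodule.projection_apply_left hc ⟨y, hyp⟩,
    (Submodule.projection_apply_eq_zero_iff hc).2
      (q.add_mem (q.smul_mem _ hbq) (q.smul_mem _ hbq')), add_zero]

end Module.End.IsolatedPair

/-! ### Operator norms and the Hilbert–Schmidt scalar product. -/

namespace BlockMat

variable {n : ℕ}

section Norm

open scoped Matrix.Norms.L2Operator

theorem opNorm_eq (R : BlockMat n) : opNorm R = ‖R‖ := rfl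

theorem opNorm_nonneg (R : BlockMat n) : 0 ≤ opNorm R := norm_nonneg _

theorem opNorm_add_le (R R' : BlockMat n) : opNorm (R + R') ≤ opNorm R + opNorm R' := by
  simp only [opNorm_eq]; exact norm_add_le _ _

theorem opNorm_sub_le (R R' : BlockMat n) : opNorm (R - R') ≤ opNorm R + opNorm R' := by
  simp only [opNorm_eq]; exact norm_sub_le _ _

theorem opNorm_mul_le (R R' : BlockMat n) : opNorm (R * R') ≤ opNorm R * opNorm R' := by
  simp only [opNorm_eq]; exact norm_mul_le _ _

theorem opNorm_smul (t : ℂ) (R : BlockMat n) : opNorm (t • R) = ‖t‖ * opNorm R := by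
  simp only [opNorm_eq]; exact norm_smul _ _

theorem opNorm_conjTranspose (R : BlockMat n) : opNorm Rᴴ = opNorm R := by
  simp only [opNorm_eq]; exact Matrix.l2_opNorm_conjTranspose R

theorem opNorm_eq_zero {R : BlockMat n} : opNorm R = 0 ↔ R = 0 := by
  rw [opNorm_eq]; exact norm_eq_zero

theorem opNorm_diagonal_le {a : Fin n ⊕ Fin n → ℂ} {A : ℝ} (hA : 0 ≤ A) (ha : ∀ i, ‖a i‖ ≤ A) :
    opNorm (Matrix.diagonal a) ≤ A := by
  rw [opNorm_eq, Matrix.l2_opNorm_diagonal]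
  exact (pi_norm_le_iff_of_nonneg hA).2 ha

theorem opNorm_flip_le : opNorm (flip n) ≤ 1 := by
  have h1 : (flip n)ᴴ = flip n := by
    simp [flip, Matrix.fromBlocks_conjTranspose]
  have h2 := Matrix.l2_opNorm_conjTranspose_mul_self (flip n)
  rw [h1, flip_mul_flip, ← opNorm_eq, ← opNorm_eq] at h2
  have h3 : opNorm (1 : BlockMat n) ≤ 1 := by
    rw [← Matrix.diagonal_one]
    exact opNorm_diagonal_le zero_le_one (by simp)
  have := opNorm_nonneg (flip n)
  nlinarith

theorem opNorm_twoDiag_le {a b : Fin n ⊕ Fin n → ℂ} {A B : ℝ} (hA : 0 ≤ A) (hB : 0 ≤ B)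
    (ha : ∀ i, ‖a i‖ ≤ A) (hb : ∀ i, ‖b i‖ ≤ B) : opNorm (twoDiag a b) ≤ A + B := by
  refine (opNorm_add_le _ _).trans (add_le_add (opNorm_diagonal_le hA ha) ?_)
  refine (opNorm_mul_le _ _).trans ?_
  have := mul_le_mul (opNorm_diagonal_le hB hb) opNorm_flip_le (opNorm_nonneg (flip n)) hB
  rwa [mul_one] at this

theorem norm_apply_le_opNorm (R : BlockMat n) (i j : Fin n ⊕ Fin n) : ‖R i j‖ ≤ opNorm R := by
  have h := Matrix.l2_opNorm_mulVec R (EuclideanSpace.single j (1 : ℂ))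
  rw [PiLp.norm_single, norm_one, mul_one] at h
  refine le_trans ?_ h
  refine le_trans (le_of_eq ?_) (PiLp.norm_apply_le _ i)
  simp

theorem superNorm_le {T : SuperOp n} {C : ℝ} (hC : 0 ≤ C)
    (h : ∀ R, opNorm (T R) ≤ C * opNorm R) : SuperOp.superNorm T ≤ C := by
  unfold SuperOp.superNorm
  exact ContinuousLinearMap.opNorm_le_bound _ hC h

end Norm

theorem hsInner_diagonal (y : Fin n ⊕ Fin n → ℝ) (R : BlockMat n) :
    hsInner (Matrix.diagonal fun i => (y i : ℂ)) R = (2 * (n : ℂ))⁻¹ * ∑ i, (y i : ℂ) * R i i := by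
  rw [hsInner, avg, Matrix.diagonal_conjTranspose, Matrix.trace]
  simp [Matrix.diagonal_mul]

theorem norm_hsInner_le (hn : 0 < n) (V W : BlockMat n) :
    ‖hsInner V W‖ ≤ opNorm V * opNorm W := by
  have hn' : (0 : ℝ) < n := by exact_mod_cast hn
  have h1 : ‖(Vᴴ * W).trace‖ ≤ 2 * n * (opNorm V * opNorm W) := by
    rw [Matrix.trace]
    refine (norm_sum_le _ _).trans ?_
    have h2 : ∀ i ∈ Finset.univ, ‖(Vᴴ * W).diag i‖ ≤ opNorm V * opNorm W := fun i _ => by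
      refine (norm_apply_le_opNorm _ i i).trans ((opNorm_mul_le _ _).trans ?_)
      rw [opNorm_conjTranspose]
    refine (Finset.sum_le_sum h2).trans (le_of_eq ?_)
    rw [Finset.sum_const, Finset.card_univ, Fintype.card_sum, Fintype.card_fin, nsmul_eq_mul]
    push_cast
    ring
  rw [hsInner, avg, norm_mul, norm_inv, norm_mul, Complex.norm_natCast, Complex.norm_ofNat,
    inv_mul_le_iff₀ (by positivity)]
  exact h1

theorem conj_hsInner (V W : BlockMat n) : (starRingEnd ℂ) (hsInner V W) = hsInner W V := by
  rw [hsInner, hsInner, avg, avg, map_mul, starRingEnd_apply, starRingEnd_apply,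
    ← Matrix.trace_conjTranspose]
  simp

end BlockMat

namespace SuperOp

open BlockMat

variable {n : ℕ}

open scoped ComplexOrder in
theorem eq_of_hsInner (hn : 0 < n) {X Y : BlockMat n} (h : ∀ V, hsInner V X = hsInner V Y) :
    X = Y := by
  have hn' : (2 * (n : ℂ))⁻¹ ≠ 0 := by
    have : (n : ℂ) ≠ 0 := by exact_mod_cast hn.ne'
    exact inv_ne_zero (mul_ne_zero two_ne_zero this)
  have h1 := h (X - Y)
  rw [hsInner, hsInner, avg, avg] at h1
  have h2 := mul_left_cancel₀ hn' h1
  rw [← sub_eq_zero, ← Matrix.trace_sub, ← mul_sub,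
    Matrix.trace_conjTranspose_mul_self_eq_zero_iff] at h2
  exact sub_eq_zero.1 h2

theorem hsInner_hsAdjoint' (T : SuperOp n) (V W : BlockMat n) :
    hsInner V (T W) = hsInner (hsAdjoint T V) W := by
  rw [← conj_hsInner, hsInner_hsAdjoint, conj_hsInner]

/-- The scalar product with a fixed matrix as a linear functional. -/
noncomputable def hsFunctional (V : BlockMat n) : BlockMat n →ₗ[ℂ] ℂ where
  toFun := hsInner V
  map_add' X Y := by simp [hsInner, avg, Matrix.trace_add, mul_add]
  map_smul' c X := by
    simp only [hsInner, avg, Matrix.mul_smul, Matrix.trace_smul, smul_eq_mul, RingHom.id_apply]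
    ring

theorem hsFunctional_apply (V X : BlockMat n) : hsFunctional V X = hsInner V X := rfl

theorem hsInner_smul_left (c : ℂ) (V X : BlockMat n) :
    hsInner (c • V) X = (starRingEnd ℂ) c * hsInner V X := by
  simp only [hsInner, avg, Matrix.conjTranspose_smul, Matrix.smul_mul, Matrix.trace_smul,
    smul_eq_mul, starRingEnd_apply]
  ring

end SuperOp

/-! ### The stability operator and its adjoint in terms of the reduced operator. -/

namespace Dyson

open BlockMat SuperOp

variable {n : ℕ}

theorem stabOp_apply (S : Matrix (Fin n) (Fin n) ℝ) (M R : BlockMat n) :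
    stabOp S M R = R - M * Matrix.diagonal (symSC S fun i => R i i) * M := by
  rw [stabOp, LinearMap.sub_apply, Module.End.one_apply, LinearMap.comp_apply, selfEnergy_eq]
  simp [SuperOp.conj, mul_assoc]

theorem sum_mul_symSC (S : Matrix (Fin n) (Fin n) ℝ) (x y : Fin n ⊕ Fin n → ℂ) :
    ∑ i, x i * symSC S y i = ∑ i, symSC S x i * y i := by
  simp only [symSC, Finset.mul_sum, Finset.sum_mul]
  rw [Finset.sum_comm]
  refine Finset.sum_congr rfl fun j _ => Finset.sum_congr rfl fun i _ => ?_
  rw [symS_comm S i j]; ring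

theorem symSC_conj (S : Matrix (Fin n) (Fin n) ℝ) (x : Fin n ⊕ Fin n → ℂ) (i : Fin n ⊕ Fin n) :
    symSC S (fun j => (starRingEnd ℂ) (x j)) i = (starRingEnd ℂ) (symSC S x i) := by
  simp [symSC, map_sum]

theorem trace_mul_diagonal (A : BlockMat n) (d : Fin n ⊕ Fin n → ℂ) :
    (A * Matrix.diagonal d).trace = ∑ i, A i i * d i := by
  simp [Matrix.trace, Matrix.mul_diagonal]

theorem trace_mul_cycle_self (A X D : BlockMat n) :
    (A * X * A * D).trace = (A * (D * A) * X).trace := by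
  rw [mul_assoc (A * X), Matrix.trace_mul_comm, ← mul_assoc, Matrix.trace_mul_comm _ X,
    Matrix.trace_mul_comm _ X, mul_assoc A, Matrix.trace_mul_comm]

/-- The self-energy is symmetric for the trace pairing and the two factors `M` move to `Mᴴ` by
cyclicity. In particular `X` differs from its image by a diagonal matrix. -/
theorem hsAdjoint_stabOp_apply (hn : 0 < n) (S : Matrix (Fin n) (Fin n) ℝ) (M X : BlockMat n) :
    hsAdjoint (stabOp S M) X = X - Matrix.diagonal (symSC S fun i => (Mᴴ * X * Mᴴ) i i) := by
  refine eq_of_hsInner hn fun V => ?_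
  rw [← hsInner_hsAdjoint, stabOp_apply]
  simp only [hsInner, avg, Matrix.conjTranspose_sub, Matrix.conjTranspose_mul, sub_mul, mul_sub,
    Matrix.trace_sub, Matrix.diagonal_conjTranspose]
  congr 2
  rw [← trace_mul_cycle_self, trace_mul_diagonal, trace_mul_diagonal]
  have e2 : ∀ i, star (symSC S fun i => V i i) i = symSC S (fun j => (starRingEnd ℂ) (V j j)) i :=
    fun i => (symSC_conj S _ i).symm
  simp only [e2]
  rw [sum_mul_symSC, ← Finset.sum_congr rfl fun i _ => mul_comm _ _]
  rfl

/-- The matrix with diagonal `s v` and off-diagonal part `-ζ u`, where `s = ± i`. It is the solution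
of the Dyson equation for `s = i`, and its adjoint for `s = -i`. -/
noncomputable def edgeMat (z : ℂ) (v u : Fin n ⊕ Fin n → ℝ) (s : ℂ) : BlockMat n :=
  twoDiag (fun i => s * v i) (fun i => -(offDiag n z i * u i))

theorem edgeMat_conjTranspose (z : ℂ) (v u : Fin n ⊕ Fin n → ℝ) (hu : ∀ i, u i.swap = u i)
    (s : ℂ) : (edgeMat z v u s)ᴴ = edgeMat z v u ((starRingEnd ℂ) s) := by
  rw [edgeMat, conjTranspose_twoDiag, edgeMat]
  congr 1 <;> ext i
  · simp
  · rw [map_neg, map_mul, conj_offDiag_swap, hu, Complex.conj_ofReal]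

/-- The eigenvector of the stability operator that belongs to the eigenvector `x` of `edgeOp`
with eigenvalue `1 - t`. -/
noncomputable def liftVec (S : Matrix (Fin n) (Fin n) ℝ) (M : BlockMat n) (t : ℝ)
    (x : Fin n ⊕ Fin n → ℝ) : BlockMat n :=
  ((1 - t : ℝ) : ℂ)⁻¹ • (M * Matrix.diagonal (fun i => (((symS S *ᵥ x) i : ℝ) : ℂ)) * M)

namespace EdgeData

variable {k : ℝ} {S : Matrix (Fin n) (Fin n) ℝ} {z : ℂ} {η ρ : ℝ} {v a u : Fin n ⊕ Fin n → ℝ}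

/-- The reduction to vectors: on the diagonal, sandwiching by `M` acts as `y ↦ w y' - v² y`, since
`|z|² u² = w`. Only `s² = -1` matters, so the formula covers both `M` and its adjoint. -/
theorem edgeMat_mul_diagonal_mul (h : EdgeData k S (‖z‖ ^ 2) η ρ v a u) {s : ℂ} (hs : s * s = -1)
    (y : Fin n ⊕ Fin n → ℂ) :
    edgeMat z v u s * Matrix.diagonal y * edgeMat z v u s =
      twoDiag (fun i => ((u i - v i * v i.swap : ℝ) : ℂ) * y i.swap + ((-1 * v i ^ 2 : ℝ) : ℂ) * y i)
        (fun i => -(s * offDiag n z i * u i * (v i * y i + v i.swap * y i.swap))) := by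
  rw [edgeMat, ← twoDiag_diagonal, twoDiag_mul, twoDiag_mul]
  congr 1 <;> ext i
  · rw [h.w_eq, h.u_swap, Complex.ofReal_mul, ← offDiag_mul_swap z i]
    push_cast
    linear_combination (v i : ℂ) ^ 2 * y i * hs
  · ring

theorem opNorm_edgeMat_le (h : EdgeData k S (‖z‖ ^ 2) η ρ v a u) {s : ℂ} (hs : ‖s‖ = 1) :
    opNorm (edgeMat z v u s) ≤ 2 * k := by
  have hk := h.k_pos
  rw [two_mul]
  refine opNorm_twoDiag_le hk.le hk.le (fun i => ?_) (fun i => ?_)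
  · rw [norm_mul, hs, one_mul, Complex.norm_real, Real.norm_of_nonneg (h.v_pos i).le]
    exact (h.v_ub i).trans (mul_le_of_le_one_right hk.le h.ρ_le)
  · have h1 := h.w_le i
    rw [h.w_eq] at h1
    rw [norm_neg, norm_mul, norm_offDiag, Complex.norm_real, Real.norm_of_nonneg (h.u_pos i).le]
    -- Bounding `|z| u` needs no separate bound on `|z|`: its square is `w`, which is at most `k ≤
    -- k²`.
    refine abs_le_of_sq_le_sq' ?_ hk.le |>.2
    rw [mul_pow]
    nlinarith [h.one_le]

theorem norm_offDiag_mul_le (h : EdgeData k S (‖z‖ ^ 2) η ρ v a u) (i) :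
    ‖offDiag n z i * (u i : ℂ)‖ ≤ k := by
  have hk := h.k_pos
  have h1 := h.w_le i
  rw [h.w_eq] at h1
  rw [norm_mul, norm_offDiag, Complex.norm_real, Real.norm_of_nonneg (h.u_pos i).le]
  refine abs_le_of_sq_le_sq' ?_ hk.le |>.2
  rw [mul_pow]
  nlinarith [h.one_le]

theorem edgeOp_ofReal (x : Fin n ⊕ Fin n → ℝ) (i : Fin n ⊕ Fin n) :
    ((u i - v i * v i.swap : ℝ) : ℂ) * (((symS S *ᵥ x) i.swap : ℝ) : ℂ) +
      ((-1 * v i ^ 2 : ℝ) : ℂ) * (((symS S *ᵥ x) i : ℝ) : ℂ) =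
      (((edgeOp S v u (-1) *ᵥ x) i : ℝ) : ℂ) := by
  rw [edgeOp_mulVec]; push_cast; ring

section Eigen

variable {t : ℝ} {x : Fin n ⊕ Fin n → ℝ}

theorem edgeMat_mul_symS_mul (h : EdgeData k S (‖z‖ ^ 2) η ρ v a u) {s : ℂ} (hs : s * s = -1)
    (hx : edgeOp S v u (-1) *ᵥ x = (1 - t) • x) (i : Fin n ⊕ Fin n) :
    (edgeMat z v u s * Matrix.diagonal (fun i => (((symS S *ᵥ x) i : ℝ) : ℂ)) *
      edgeMat z v u s) i i = ((1 - t : ℝ) : ℂ) * x i := by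
  rw [h.edgeMat_mul_diagonal_mul hs, twoDiag_apply_self, edgeOp_ofReal, hx, Pi.smul_apply,
    smul_eq_mul, Complex.ofReal_mul]

theorem liftVec_apply_self (h : EdgeData k S (‖z‖ ^ 2) η ρ v a u)
    (hx : edgeOp S v u (-1) *ᵥ x = (1 - t) • x) (ht : t < 1) (i : Fin n ⊕ Fin n) :
    liftVec S (edgeMat z v u Complex.I) t x i i = x i := by
  have h1 : ((1 - t : ℝ) : ℂ) ≠ 0 := Complex.ofReal_ne_zero.2 (by linarith)
  rw [liftVec, Matrix.smul_apply, h.edgeMat_mul_symS_mul Complex.I_mul_I hx, smul_eq_mul,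
    inv_mul_cancel_left₀ h1]

theorem stabOp_liftVec (h : EdgeData k S (‖z‖ ^ 2) η ρ v a u)
    (hx : edgeOp S v u (-1) *ᵥ x = (1 - t) • x) (ht : t < 1) :
    stabOp S (edgeMat z v u Complex.I) (liftVec S (edgeMat z v u Complex.I) t x) =
      (t : ℂ) • liftVec S (edgeMat z v u Complex.I) t x := by
  have h1 : ((1 - t : ℝ) : ℂ) ≠ 0 := Complex.ofReal_ne_zero.2 (by linarith)
  have e : (fun i => liftVec S (edgeMat z v u Complex.I) t x i i) = fun i => (x i : ℂ) := by
    ext i; exact h.liftVec_apply_self hx ht i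
  have e2 : edgeMat z v u Complex.I * Matrix.diagonal (symSC S fun i => (x i : ℂ)) *
      edgeMat z v u Complex.I =
      ((1 - t : ℝ) : ℂ) • liftVec S (edgeMat z v u Complex.I) t x := by
    rw [liftVec, smul_smul, mul_inv_cancel₀ h1, one_smul]
    congr 3
    ext i
    exact symSC_ofReal S x i
  rw [stabOp_apply, e, e2]
  push_cast
  module

/-- The same vector `x` that yields the right eigenvector yields the left one through `𝕊 x`, because
`Mᴴ` and `M` act on diagonals by the same reduced operator. -/
theorem hsAdjoint_stabOp_diagonal (h : EdgeData k S (‖z‖ ^ 2) η ρ v a u)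
    (hx : edgeOp S v u (-1) *ᵥ x = (1 - t) • x) :
    hsAdjoint (stabOp S (edgeMat z v u Complex.I))
      (Matrix.diagonal fun i => (((symS S *ᵥ x) i : ℝ) : ℂ)) =
      (t : ℂ) • Matrix.diagonal fun i => (((symS S *ᵥ x) i : ℝ) : ℂ) := by
  rw [hsAdjoint_stabOp_apply h.n_pos, edgeMat_conjTranspose z v u h.u_swap, Complex.conj_I]
  have e : (fun i => (edgeMat z v u (-Complex.I) *
      Matrix.diagonal (fun i => (((symS S *ᵥ x) i : ℝ) : ℂ)) * edgeMat z v u (-Complex.I)) i i) =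
      fun i => (((1 - t) * x i : ℝ) : ℂ) := by
    ext i
    rw [h.edgeMat_mul_symS_mul (by rw [neg_mul_neg, Complex.I_mul_I]) hx, Complex.ofReal_mul]
  rw [e, ← Matrix.diagonal_smul, Matrix.diagonal_sub]
  congr 1
  ext i
  rw [symSC_ofReal, Pi.smul_apply, smul_eq_mul]
  have : symS S *ᵥ (fun j => (1 - t) * x j) = (1 - t) • (symS S *ᵥ x) := by
    rw [← Matrix.mulVec_smul]; rfl
  rw [this, Pi.smul_apply, smul_eq_mul]
  push_cast
  ring

theorem hsInner_diagonal_liftVec (h : EdgeData k S (‖z‖ ^ 2) η ρ v a u)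
    (hx : edgeOp S v u (-1) *ᵥ x = (1 - t) • x) (ht : t < 1) :
    hsInner (Matrix.diagonal fun i => (((symS S *ᵥ x) i : ℝ) : ℂ))
      (liftVec S (edgeMat z v u Complex.I) t x) =
      (((2 * (n : ℝ))⁻¹ * ∑ i, (symS S *ᵥ x) i * x i : ℝ) : ℂ) := by
  rw [hsInner_diagonal]
  push_cast
  congr 1
  exact Finset.sum_congr rfl fun i _ => by rw [h.liftVec_apply_self hx ht]

/-- Translates the functional `𝕊 x` on the diagonal of `Mᴴ X Mᴴ` into the pairing of `X` with the
lifted right eigenvector, as needed for the lower bound on the adjoint. -/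
theorem sum_symS_mul_diag (h : EdgeData k S (‖z‖ ^ 2) η ρ v a u) (ht : t < 1) (X : BlockMat n) :
    ∑ i, (((symS S *ᵥ x) i : ℝ) : ℂ) *
      ((edgeMat z v u Complex.I)ᴴ * X * (edgeMat z v u Complex.I)ᴴ) i i =
      2 * n * (((1 - t : ℝ) : ℂ) * hsInner (liftVec S (edgeMat z v u Complex.I) t x) X) := by
  have h1 : ((1 - t : ℝ) : ℂ) ≠ 0 := Complex.ofReal_ne_zero.2 (by linarith)
  have hn : (n : ℂ) ≠ 0 := by exact_mod_cast h.n_pos.ne'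
  set M := edgeMat z v u Complex.I
  set d : Fin n ⊕ Fin n → ℂ := fun i => (((symS S *ᵥ x) i : ℝ) : ℂ) with hd
  have hdd : (Matrix.diagonal d)ᴴ = Matrix.diagonal d := by
    rw [Matrix.diagonal_conjTranspose]
    congr 1
    ext i
    simp [hd]
  have e1 : ∑ i, d i * (Mᴴ * X * Mᴴ) i i = (Mᴴ * X * Mᴴ * Matrix.diagonal d).trace := by
    rw [trace_mul_diagonal]
    exact Finset.sum_congr rfl fun i _ => mul_comm _ _
  have e2 : (Mᴴ * X * Mᴴ * Matrix.diagonal d).trace =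
      ((M * Matrix.diagonal d * M)ᴴ * X).trace := by
    rw [Matrix.conjTranspose_mul, Matrix.conjTranspose_mul, hdd, trace_mul_cycle_self]
  have e3 : hsInner (M * Matrix.diagonal d * M) X =
      ((1 - t : ℝ) : ℂ) * hsInner (liftVec S M t x) X := by
    rw [liftVec, hsInner_smul_left, map_inv₀, Complex.conj_ofReal, mul_inv_cancel_left₀ h1]
  rw [← e3, hsInner, avg, e1, e2]
  field_simp

end Eigen

end EdgeData

end Dyson

/-! ### Left and right eigenvectors, and lower bounds up to two functionals. -/

namespace Dyson

open BlockMat SuperOp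

variable {n : ℕ}

/-- The Perron vector of `edgeOp S v u 1` with the sign flipped on the second block, an
eigenvector of `edgeOp S v u (-1)`. -/
noncomputable def signVec (S : Matrix (Fin n) (Fin n) ℝ) (v u : Fin n ⊕ Fin n → ℝ)
    (i : Fin n ⊕ Fin n) : ℝ := blockSign n i * edgeVec S v u i

/-- The right eigenvector `B`. -/
noncomputable def rightVec (k : ℝ) (S : Matrix (Fin n) (Fin n) ℝ) (z : ℂ)
    (v u : Fin n ⊕ Fin n → ℝ) : BlockMat n :=
  liftVec S (edgeMat z v u Complex.I) (deflVal k S v u) (deflVec k S v u)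

/-- The right eigenvector `B_*`. -/
noncomputable def rightVecSign (S : Matrix (Fin n) (Fin n) ℝ) (z : ℂ)
    (v u : Fin n ⊕ Fin n → ℝ) : BlockMat n :=
  liftVec S (edgeMat z v u Complex.I) (edgeVal S v u) (signVec S v u)

/-- The left eigenvector `B̂`. -/
noncomputable def leftVec (k : ℝ) (S : Matrix (Fin n) (Fin n) ℝ)
    (v u : Fin n ⊕ Fin n → ℝ) : BlockMat n :=
  Matrix.diagonal fun i => (((symS S *ᵥ deflVec k S v u) i : ℝ) : ℂ)

/-- The left eigenvector `B̂_*`. -/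
noncomputable def leftVecSign (S : Matrix (Fin n) (Fin n) ℝ)
    (v u : Fin n ⊕ Fin n → ℝ) : BlockMat n :=
  Matrix.diagonal fun i => ((blockSign n i * (symS S *ᵥ edgeVec S v u) i : ℝ) : ℂ)

theorem leftVecSign_eq (S : Matrix (Fin n) (Fin n) ℝ) (v u : Fin n ⊕ Fin n → ℝ) :
    leftVecSign S v u =
      (-1 : ℂ) • Matrix.diagonal fun i => (((symS S *ᵥ signVec S v u) i : ℝ) : ℂ) := by
  rw [leftVecSign, ← Matrix.diagonal_smul]
  congr 1
  ext i
  rw [Pi.smul_apply]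
  unfold signVec
  rw [symS_mulVec_blockSign]
  simp

namespace EdgeData

variable {k : ℝ} {S : Matrix (Fin n) (Fin n) ℝ} {z : ℂ} {η ρ : ℝ} {v a u : Fin n ⊕ Fin n → ℝ}

theorem edgeOp_signVec (h : EdgeData k S (‖z‖ ^ 2) η ρ v a u)
    (hδ : 40000 * k ^ 29 * (ρ ^ 2 + η / ρ) ≤ 1) :
    edgeOp S v u (-1) *ᵥ signVec S v u = (1 - edgeVal S v u) • signVec S v u := by
  ext i
  unfold signVec
  rw [edgeOp_mulVec_blockSign, neg_neg, (h.edgeVec_spec hδ).2.2, Pi.smul_apply, Pi.smul_apply,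
    smul_eq_mul, smul_eq_mul]
  ring

theorem le_half (h : EdgeData k S (‖z‖ ^ 2) η ρ v a u)
    (hδ : 40000 * k ^ 29 * (ρ ^ 2 + η / ρ) ≤ 1) {t : ℝ}
    (ht : t ≤ 4 * k ^ 5 * (ρ ^ 2 + η / ρ)) : t ≤ 1 / 2 := by
  linarith [h.edge_small_pow_five hδ]

theorem deflVal_le (h : EdgeData k S (‖z‖ ^ 2) η ρ v a u)
    (hδ : 40000 * k ^ 29 * (ρ ^ 2 + η / ρ) ≤ 1) :
    deflVal k S v u ≤ 4 * k ^ 5 * (ρ ^ 2 + η / ρ) :=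
  h.eigenvalue_le (by norm_num) (h.deflVec_spec hδ).1 (h.deflVec_spec hδ).2.2

theorem edgeVal_le (h : EdgeData k S (‖z‖ ^ 2) η ρ v a u)
    (hδ : 40000 * k ^ 29 * (ρ ^ 2 + η / ρ) ≤ 1) :
    edgeVal S v u ≤ 4 * k ^ 5 * (ρ ^ 2 + η / ρ) :=
  h.eigenvalue_le (by norm_num) (h.edgeVec_spec hδ).1 (h.edgeVec_spec hδ).2.2

theorem deflVal_pos (h : EdgeData k S (‖z‖ ^ 2) η ρ v a u)
    (hδ : 40000 * k ^ 29 * (ρ ^ 2 + η / ρ) ≤ 1) : 0 < deflVal k S v u :=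
  h.eigenvalue_pos (by norm_num) (h.deflVec_spec hδ).1 (h.deflVec_spec hδ).2.2

theorem edgeVal_pos (h : EdgeData k S (‖z‖ ^ 2) η ρ v a u)
    (hδ : 40000 * k ^ 29 * (ρ ^ 2 + η / ρ) ≤ 1) : 0 < edgeVal S v u :=
  h.eigenvalue_pos (by norm_num) (h.edgeVec_spec hδ).1 (h.edgeVec_spec hδ).2.2

theorem deflVal_lt_one (h : EdgeData k S (‖z‖ ^ 2) η ρ v a u)
    (hδ : 40000 * k ^ 29 * (ρ ^ 2 + η / ρ) ≤ 1) : deflVal k S v u < 1 := by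
  linarith [h.le_half hδ (h.deflVal_le hδ)]

theorem edgeVal_lt_one (h : EdgeData k S (‖z‖ ^ 2) η ρ v a u)
    (hδ : 40000 * k ^ 29 * (ρ ^ 2 + η / ρ) ≤ 1) : edgeVal S v u < 1 := by
  linarith [h.le_half hδ (h.edgeVal_le hδ)]

theorem stabOp_rightVec (h : EdgeData k S (‖z‖ ^ 2) η ρ v a u)
    (hδ : 40000 * k ^ 29 * (ρ ^ 2 + η / ρ) ≤ 1) :
    stabOp S (edgeMat z v u Complex.I) (rightVec k S z v u) =
      (deflVal k S v u : ℂ) • rightVec k S z v u :=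
  h.stabOp_liftVec (h.deflVec_spec hδ).2.2 (h.deflVal_lt_one hδ)

theorem stabOp_rightVecSign (h : EdgeData k S (‖z‖ ^ 2) η ρ v a u)
    (hδ : 40000 * k ^ 29 * (ρ ^ 2 + η / ρ) ≤ 1) :
    stabOp S (edgeMat z v u Complex.I) (rightVecSign S z v u) =
      (edgeVal S v u : ℂ) • rightVecSign S z v u :=
  h.stabOp_liftVec (h.edgeOp_signVec hδ) (h.edgeVal_lt_one hδ)

theorem hsAdjoint_stabOp_leftVec (h : EdgeData k S (‖z‖ ^ 2) η ρ v a u)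
    (hδ : 40000 * k ^ 29 * (ρ ^ 2 + η / ρ) ≤ 1) :
    hsAdjoint (stabOp S (edgeMat z v u Complex.I)) (leftVec k S v u) =
      (deflVal k S v u : ℂ) • leftVec k S v u :=
  h.hsAdjoint_stabOp_diagonal (h.deflVec_spec hδ).2.2

theorem hsAdjoint_stabOp_leftVecSign (h : EdgeData k S (‖z‖ ^ 2) η ρ v a u)
    (hδ : 40000 * k ^ 29 * (ρ ^ 2 + η / ρ) ≤ 1) :
    hsAdjoint (stabOp S (edgeMat z v u Complex.I)) (leftVecSign S v u) =
      (edgeVal S v u : ℂ) • leftVecSign S v u := by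
  rw [leftVecSign_eq, map_smul, h.hsAdjoint_stabOp_diagonal (h.edgeOp_signVec hδ), smul_comm]

theorem hsInner_leftVec_rightVec (h : EdgeData k S (‖z‖ ^ 2) η ρ v a u)
    (hδ : 40000 * k ^ 29 * (ρ ^ 2 + η / ρ) ≤ 1) :
    hsInner (leftVec k S v u) (rightVec k S z v u) =
      (((2 * (n : ℝ))⁻¹ * ∑ i, (symS S *ᵥ deflVec k S v u) i * deflVec k S v u i : ℝ) : ℂ) :=
  h.hsInner_diagonal_liftVec (h.deflVec_spec hδ).2.2 (h.deflVal_lt_one hδ)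

theorem hsInner_leftVecSign_rightVecSign (h : EdgeData k S (‖z‖ ^ 2) η ρ v a u)
    (hδ : 40000 * k ^ 29 * (ρ ^ 2 + η / ρ) ≤ 1) :
    hsInner (leftVecSign S v u) (rightVecSign S z v u) =
      (((2 * (n : ℝ))⁻¹ * ∑ i, (symS S *ᵥ edgeVec S v u) i * edgeVec S v u i : ℝ) : ℂ) := by
  rw [leftVecSign_eq, hsInner_smul_left, rightVecSign,
    h.hsInner_diagonal_liftVec (h.edgeOp_signVec hδ) (h.edgeVal_lt_one hδ), map_neg, map_one,
    neg_one_mul, ← Complex.ofReal_neg, ← mul_neg, ← Finset.sum_neg_distrib]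
  congr 2
  refine Finset.sum_congr rfl fun i _ => ?_
  unfold signVec
  rw [symS_mulVec_blockSign]
  linear_combination ((symS S *ᵥ edgeVec S v u) i * edgeVec S v u i) * blockSign_mul_self i

theorem stabOp_apply_self (h : EdgeData k S (‖z‖ ^ 2) η ρ v a u) (R : BlockMat n) (i) :
    stabOp S (edgeMat z v u Complex.I) R i i =
      R i i - (((u i - v i * v i.swap : ℝ) : ℂ) * symSC S (fun j => R j j) i.swap +
        ((-1 * v i ^ 2 : ℝ) : ℂ) * symSC S (fun j => R j j) i) := by
  rw [stabOp_apply, Matrix.sub_apply, h.edgeMat_mul_diagonal_mul Complex.I_mul_I,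
    twoDiag_apply_self]

theorem norm_sum_leftVec (h : EdgeData k S (‖z‖ ^ 2) η ρ v a u) (R : BlockMat n) :
    ‖∑ i, (((symS S *ᵥ deflVec k S v u) i : ℝ) : ℂ) * R i i‖ ≤
      2 * n * ‖hsInner (leftVec k S v u) R‖ := by
  have hn := h.n_pos'
  rw [leftVec, hsInner_diagonal, norm_mul, norm_inv, norm_mul, Complex.norm_natCast,
    Complex.norm_ofNat, mul_inv_cancel_left₀ (by positivity)]

theorem norm_sum_leftVecSign (h : EdgeData k S (‖z‖ ^ 2) η ρ v a u) (R : BlockMat n) :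
    ‖∑ i, (blockSign n i * (symS S *ᵥ edgeVec S v u) i : ℂ) * R i i‖ ≤
      2 * n * ‖hsInner (leftVecSign S v u) R‖ := by
  have hn := h.n_pos'
  rw [leftVecSign, hsInner_diagonal, norm_mul, norm_inv, norm_mul, Complex.norm_natCast,
    Complex.norm_ofNat, mul_inv_cancel_left₀ (by positivity)]
  push_cast
  rfl

/-- The stability operator is bounded below, up to the two left eigenvectors. -/
theorem opNorm_le_stabOp (h : EdgeData k S (‖z‖ ^ 2) η ρ v a u)
    (hδ : 40000 * k ^ 29 * (ρ ^ 2 + η / ρ) ≤ 1) (R : BlockMat n) :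
    opNorm R ≤ 73 * k ^ 15 * (opNorm (stabOp S (edgeMat z v u Complex.I) R) +
      ‖hsInner (leftVec k S v u) R‖ + ‖hsInner (leftVecSign S v u) R‖) := by
  have hk := h.k_pos
  set M := edgeMat z v u Complex.I with hM
  set N := opNorm (stabOp S M R)
  set P := ‖hsInner (leftVec k S v u) R‖
  set Q := ‖hsInner (leftVecSign S v u) R‖
  have hN0 : 0 ≤ N := opNorm_nonneg _
  have hP0 : 0 ≤ P := norm_nonneg _
  have hQ0 : 0 ≤ Q := norm_nonneg _
  have h1 : ∀ i, ‖R i i‖ ≤ 18 * k ^ 12 * (N + P + Q) :=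
    h.norm_le_of_functionals hδ (h.symS_approx (h.deflVec_approx hδ))
      (h.symS_approx (h.edgeVec_approx hδ)) (σ := -1) (by norm_num)
      (fun i => by
        rw [← h.stabOp_apply_self]
        exact norm_apply_le_opNorm _ i i)
      (h.norm_sum_leftVec R) (h.norm_sum_leftVecSign R)
  have h2 := h.norm_symSC_le (by positivity) h1
  have h3 := opNorm_diagonal_le (by positivity) h2
  have h4 := h.opNorm_edgeMat_le (s := Complex.I) Complex.norm_I
  rw [← hM] at h4
  -- A bound on the diagonal of `R` suffices: the rest of `R` is recovered from its image and its
  -- diagonal.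
  have e : R = stabOp S M R + M * Matrix.diagonal (symSC S fun i => R i i) * M := by
    rw [stabOp_apply]; abel
  have h5 : opNorm (M * Matrix.diagonal (symSC S fun i => R i i) * M) ≤
      2 * k * (k * (18 * k ^ 12 * (N + P + Q))) * (2 * k) :=
    (opNorm_mul_le _ _).trans (mul_le_mul ((opNorm_mul_le _ _).trans
      (mul_le_mul h4 h3 (opNorm_nonneg _) (by positivity))) h4 (opNorm_nonneg _) (by positivity))
  have h6 : N ≤ k ^ 15 * (N + P + Q) := by
    have : 1 ≤ k ^ 15 := one_le_pow₀ h.one_le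
    calc N ≤ N + P + Q := by linarith
      _ ≤ _ := le_mul_of_one_le_left (by positivity) this
  calc opNorm R ≤ N + 2 * k * (k * (18 * k ^ 12 * (N + P + Q))) * (2 * k) := by
        conv_lhs => rw [e]
        exact (opNorm_add_le _ _).trans (add_le_add le_rfl h5)
    _ ≤ k ^ 15 * (N + P + Q) + 2 * k * (k * (18 * k ^ 12 * (N + P + Q))) * (2 * k) := by
        linarith
    _ = _ := by ring

theorem norm_sum_diag_le (h : EdgeData k S (‖z‖ ^ 2) η ρ v a u) {t : ℝ} (ht0 : 0 < t) (ht : t < 1)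
    (x : Fin n ⊕ Fin n → ℝ) (X : BlockMat n) :
    ‖∑ i, (((symS S *ᵥ x) i : ℝ) : ℂ) *
      ((edgeMat z v u Complex.I)ᴴ * X * (edgeMat z v u Complex.I)ᴴ) i i‖ ≤
      2 * n * ‖hsInner (liftVec S (edgeMat z v u Complex.I) t x) X‖ := by
  have hn := h.n_pos'
  rw [h.sum_symS_mul_diag ht, norm_mul, norm_mul, norm_mul, Complex.norm_natCast,
    Complex.norm_ofNat, Complex.norm_real, Real.norm_of_nonneg (by linarith)]
  refine mul_le_mul_of_nonneg_left ?_ (by positivity)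
  exact mul_le_of_le_one_left (norm_nonneg _) (by linarith)

/-- The adjoint of the stability operator is bounded below, up to the two right eigenvectors. -/
theorem opNorm_le_hsAdjoint_stabOp (h : EdgeData k S (‖z‖ ^ 2) η ρ v a u)
    (hδ : 40000 * k ^ 29 * (ρ ^ 2 + η / ρ) ≤ 1) (X : BlockMat n) :
    opNorm X ≤ 73 * k ^ 15 * (opNorm (hsAdjoint (stabOp S (edgeMat z v u Complex.I)) X) +
      ‖hsInner (rightVec k S z v u) X‖ + ‖hsInner (rightVecSign S z v u) X‖) := by
  have hk := h.k_pos
  set M := edgeMat z v u Complex.I with hM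
  set F := hsAdjoint (stabOp S M) X with hF
  set N := opNorm F
  set P := ‖hsInner (rightVec k S z v u) X‖
  set Q := ‖hsInner (rightVecSign S z v u) X‖
  set m : Fin n ⊕ Fin n → ℂ := fun i => (Mᴴ * X * Mᴴ) i i with hm
  have hN0 : 0 ≤ N := opNorm_nonneg _
  have hP0 : 0 ≤ P := norm_nonneg _
  have hQ0 : 0 ≤ Q := norm_nonneg _
  have h4 : opNorm Mᴴ ≤ 2 * k := by
    rw [opNorm_conjTranspose]; exact h.opNorm_edgeMat_le Complex.norm_I
  have e : X = F + Matrix.diagonal (symSC S m) := by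
    rw [hF, hsAdjoint_stabOp_apply h.n_pos]; abel
  have hMN : opNorm (Mᴴ * F * Mᴴ) ≤ 4 * k ^ 2 * N := by
    refine (opNorm_mul_le _ _).trans ((mul_le_mul ((opNorm_mul_le _ _).trans
      (mul_le_mul h4 le_rfl hN0 (by positivity))) h4 (opNorm_nonneg _) (by positivity)).trans
      (le_of_eq ?_))
    ring
  -- Sandwiching `X = F + diag(𝕊 m)` by `Mᴴ` and taking diagonals shows that `m - K m` is the
  -- diagonal of `Mᴴ F Mᴴ`, so the vector estimate applies to `m`.
  have e1 : ∀ i, (Mᴴ * F * Mᴴ) i i = m i - (((u i - v i * v i.swap : ℝ) : ℂ) * symSC S m i.swap +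
        ((-1 * v i ^ 2 : ℝ) : ℂ) * symSC S m i) := by
    intro i
    have e2 : (Mᴴ * Matrix.diagonal (symSC S m) * Mᴴ) i i =
        ((u i - v i * v i.swap : ℝ) : ℂ) * symSC S m i.swap +
        ((-1 * v i ^ 2 : ℝ) : ℂ) * symSC S m i := by
      rw [hM, edgeMat_conjTranspose z v u h.u_swap, Complex.conj_I,
        h.edgeMat_mul_diagonal_mul (by rw [neg_mul_neg, Complex.I_mul_I]), twoDiag_apply_self]
    have e3 : F = X - Matrix.diagonal (symSC S m) := by
      rw [hF, hsAdjoint_stabOp_apply h.n_pos]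
    rw [e3, mul_sub, sub_mul, Matrix.sub_apply, e2]
  have h1 : ∀ i, ‖m i‖ ≤ 18 * k ^ 12 * (4 * k ^ 2 * N + P + Q) := by
    refine h.norm_le_of_functionals hδ (h.symS_approx (h.deflVec_approx hδ))
      (h.symS_approx (h.edgeVec_approx hδ)) (σ := -1) (by norm_num)
      (fun i => ?_) ?_ ?_
    · rw [← e1]
      exact (norm_apply_le_opNorm _ i i).trans hMN
    · exact h.norm_sum_diag_le (h.deflVal_pos hδ) (h.deflVal_lt_one hδ) _ X
    · have h5 := h.norm_sum_diag_le (h.edgeVal_pos hδ) (h.edgeVal_lt_one hδ) (signVec S v u) X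
      have h6 : ∑ i, (((symS S *ᵥ signVec S v u) i : ℝ) : ℂ) * m i =
          -∑ i, (blockSign n i * (symS S *ᵥ edgeVec S v u) i : ℂ) * m i := by
        rw [← Finset.sum_neg_distrib]
        refine Finset.sum_congr rfl fun i _ => ?_
        unfold signVec
        rw [symS_mulVec_blockSign]
        push_cast
        ring
      have h7 := (congrArg norm h6).symm.trans_le h5
      rwa [norm_neg] at h7
  have hNF : opNorm F ≤ N := le_rfl
  clear_value N P Q
  have h0 : 0 ≤ 18 * k ^ 12 * (4 * k ^ 2 * N + P + Q) := by positivity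
  have h2 := h.norm_symSC_le h0 h1
  have h3 : opNorm (Matrix.diagonal (symSC S m)) ≤ k * (18 * k ^ 12 * (4 * k ^ 2 * N + P + Q)) :=
    opNorm_diagonal_le (mul_nonneg hk.le h0) h2
  have h6 : N ≤ k ^ 15 * N := le_mul_of_one_le_left hN0 (one_le_pow₀ h.one_le)
  have h7 : k ^ 13 ≤ k ^ 15 := pow_le_pow_right₀ h.one_le (by norm_num)
  have h8 : 0 ≤ k ^ 15 := by positivity
  calc opNorm X ≤ N + k * (18 * k ^ 12 * (4 * k ^ 2 * N + P + Q)) := by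
        conv_lhs => rw [e]
        exact (opNorm_add_le _ _).trans (add_le_add hNF h3)
    _ = N + 72 * (k ^ 15 * N) + 18 * (k ^ 13 * (P + Q)) := by ring
    _ ≤ k ^ 15 * N + 72 * (k ^ 15 * N) + 73 * (k ^ 15 * (P + Q)) := by
        have h9 : k ^ 13 * (P + Q) ≤ k ^ 15 * (P + Q) :=
          mul_le_mul_of_nonneg_right h7 (by positivity)
        have : 0 ≤ k ^ 15 * (P + Q) := by positivity
        linarith
    _ = _ := by ring

/-- The pairing `(2n)⁻¹ ⟨𝕊 x, x⟩` is comparable to `1`. -/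
theorem pairing_bounds (h : EdgeData k S (‖z‖ ^ 2) η ρ v a u)
    (hδ : 40000 * k ^ 29 * (ρ ^ 2 + η / ρ) ≤ 1) {x : Fin n ⊕ Fin n → ℝ}
    (hx : ∀ i, |x i - v i / ρ| ≤ 4000 * k ^ 25 * (ρ ^ 2 + η / ρ)) :
    1 / (4 * k ^ 3) ≤ (2 * (n : ℝ))⁻¹ * ∑ i, (symS S *ᵥ x) i * x i ∧
      (2 * (n : ℝ))⁻¹ * ∑ i, (symS S *ᵥ x) i * x i ≤ 8 * k ^ 3 := by
  have hk := h.k_pos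
  have hn := h.n_pos'
  have hb := h.approx_bounds hδ hx
  have hs := h.symS_bounds hb
  have hcard : ∀ c : ℝ, ∑ _i : Fin n ⊕ Fin n, c = 2 * n * c := fun c => by
    rw [Finset.sum_const, Finset.card_univ, Fintype.card_sum, Fintype.card_fin, nsmul_eq_mul]
    push_cast; ring
  constructor
  · rw [le_inv_mul_iff₀ (by positivity), ← hcard]
    refine Finset.sum_le_sum fun i _ => ?_
    calc 1 / (4 * k ^ 3) = 1 / (2 * k ^ 2) * (1 / (2 * k)) := by field_simp; norm_num
      _ ≤ _ := mul_le_mul (hs i).1 (hb i).1 (by positivity)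
          (le_trans (by positivity) (hs i).1)
  · rw [inv_mul_le_iff₀ (by positivity), ← hcard]
    refine Finset.sum_le_sum fun i _ => ?_
    calc (symS S *ᵥ x) i * x i ≤ 4 * k ^ 2 * (2 * k) :=
          mul_le_mul (hs i).2 (hb i).2 (le_trans (by positivity) (hb i).1) (by positivity)
      _ = _ := by ring

theorem norm_pairing (h : EdgeData k S (‖z‖ ^ 2) η ρ v a u)
    (hδ : 40000 * k ^ 29 * (ρ ^ 2 + η / ρ) ≤ 1) :
    1 / (4 * k ^ 3) ≤ ‖hsInner (leftVec k S v u) (rightVec k S z v u)‖ ∧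
      ‖hsInner (leftVec k S v u) (rightVec k S z v u)‖ ≤ 8 * k ^ 3 := by
  have hk := h.k_pos
  have h1 := h.pairing_bounds hδ (h.deflVec_approx hδ)
  have h0 : 0 < 1 / (4 * k ^ 3) := by positivity
  rwa [h.hsInner_leftVec_rightVec hδ, Complex.norm_real, Real.norm_of_nonneg (h0.le.trans h1.1)]

theorem norm_pairingSign (h : EdgeData k S (‖z‖ ^ 2) η ρ v a u)
    (hδ : 40000 * k ^ 29 * (ρ ^ 2 + η / ρ) ≤ 1) :
    1 / (4 * k ^ 3) ≤ ‖hsInner (leftVecSign S v u) (rightVecSign S z v u)‖ ∧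
      ‖hsInner (leftVecSign S v u) (rightVecSign S z v u)‖ ≤ 8 * k ^ 3 := by
  have hk := h.k_pos
  have h1 := h.pairing_bounds hδ (h.edgeVec_approx hδ)
  have h0 : 0 < 1 / (4 * k ^ 3) := by positivity
  rwa [h.hsInner_leftVecSign_rightVecSign hδ, Complex.norm_real,
    Real.norm_of_nonneg (h0.le.trans h1.1)]

/-- The radius is the reciprocal of the constant in `opNorm_le_stabOp`: an eigenvector in the common
kernel of both left functionals has eigenvalue of modulus at least this radius. -/
theorem isolatedPair (h : EdgeData k S (‖z‖ ^ 2) η ρ v a u)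
    (hδ : 40000 * k ^ 29 * (ρ ^ 2 + η / ρ) ≤ 1) :
    (stabOp S (edgeMat z v u Complex.I)).IsolatedPair (1 / (73 * k ^ 15))
      (deflVal k S v u) (edgeVal S v u) (rightVec k S z v u) (rightVecSign S z v u)
      (hsFunctional (leftVec k S v u)) (hsFunctional (leftVecSign S v u)) := by
  have hk := h.k_pos
  have hsmall : ∀ t : ℝ, 0 < t → t ≤ 4 * k ^ 5 * (ρ ^ 2 + η / ρ) →
      ‖(t : ℂ)‖ < 1 / (73 * k ^ 15) := by
    intro t ht0 ht
    rw [Complex.norm_real, Real.norm_of_nonneg ht0.le, lt_div_iff₀ (by positivity)]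
    have h1 := h.edge_small_pow hδ (m := 20) (by norm_num)
    calc t * (73 * k ^ 15) ≤ 4 * k ^ 5 * (ρ ^ 2 + η / ρ) * (73 * k ^ 15) := by gcongr
      _ = 292 / 40000 * (40000 * k ^ 20 * (ρ ^ 2 + η / ρ)) := by ring
      _ < 1 := by linarith
  have h0 : 0 < 1 / (4 * k ^ 3) := by positivity
  refine ⟨?_, hsmall _ (h.deflVal_pos hδ) (h.deflVal_le hδ),
    hsmall _ (h.edgeVal_pos hδ) (h.edgeVal_le hδ), h.stabOp_rightVec hδ,
    h.stabOp_rightVecSign hδ, fun x => ?_, fun x => ?_, ?_, ?_, ?_⟩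
  · exact_mod_cast (h.edgeVal_lt_deflVal hδ).ne'
  · rw [hsFunctional_apply, hsFunctional_apply, hsInner_hsAdjoint', h.hsAdjoint_stabOp_leftVec hδ,
      hsInner_smul_left, Complex.conj_ofReal]
  · rw [hsFunctional_apply, hsFunctional_apply, hsInner_hsAdjoint',
      h.hsAdjoint_stabOp_leftVecSign hδ, hsInner_smul_left, Complex.conj_ofReal]
  · rw [hsFunctional_apply, ← norm_pos_iff]
    exact h0.trans_le (h.norm_pairing hδ).1
  · rw [hsFunctional_apply, ← norm_pos_iff]
    exact h0.trans_le (h.norm_pairingSign hδ).1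
  · intro ζ hζ x h1 h2 h3
    rw [hsFunctional_apply] at h1 h2
    have h4 := h.opNorm_le_stabOp hδ x
    rw [h1, h2, h3, norm_zero, add_zero, add_zero, opNorm_smul, ← mul_assoc] at h4
    by_contra hx
    have h5 : 0 < opNorm x := lt_of_le_of_ne (opNorm_nonneg x) fun h => hx (opNorm_eq_zero.1 h.symm)
    rw [lt_div_iff₀ (by positivity)] at hζ
    have : 73 * k ^ 15 * ‖ζ‖ * opNorm x < 1 * opNorm x := by
      refine mul_lt_mul_of_pos_right ?_ h5
      linarith
    linarith

theorem isUnit_stabOp (h : EdgeData k S (‖z‖ ^ 2) η ρ v a u)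
    (hδ : 40000 * k ^ 29 * (ρ ^ 2 + η / ρ) ≤ 1) :
    IsUnit (stabOp S (edgeMat z v u Complex.I)) :=
  (h.isolatedPair hδ).isUnit (by exact_mod_cast (h.deflVal_pos hδ).ne')
    (by exact_mod_cast (h.edgeVal_pos hδ).ne')

theorem isUnit_hsAdjoint_stabOp (h : EdgeData k S (‖z‖ ^ 2) η ρ v a u)
    (hδ : 40000 * k ^ 29 * (ρ ^ 2 + η / ρ) ≤ 1) :
    IsUnit (hsAdjoint (stabOp S (edgeMat z v u Complex.I))) := by
  rw [LinearMap.isUnit_iff_ker_eq_bot, LinearMap.ker_eq_bot']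
  intro X hX
  have key : ∀ (t : ℝ) (B : BlockMat n), 0 < t →
      stabOp S (edgeMat z v u Complex.I) B = (t : ℂ) • B → hsInner B X = 0 := by
    intro t B ht hB
    have h1 := hsInner_hsAdjoint (stabOp S (edgeMat z v u Complex.I)) B X
    rw [hX, hB, hsInner_smul_left, Complex.conj_ofReal] at h1
    have h2 : hsInner B (0 : BlockMat n) = 0 := map_zero (hsFunctional B)
    rw [h2] at h1
    exact (mul_eq_zero.1 h1).resolve_left (by exact_mod_cast ht.ne')
  have h1 := h.opNorm_le_hsAdjoint_stabOp hδ X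
  rw [hX, key _ _ (h.deflVal_pos hδ) (h.stabOp_rightVec hδ),
    key _ _ (h.edgeVal_pos hδ) (h.stabOp_rightVecSign hδ), opNorm_eq_zero.2 rfl, norm_zero,
    add_zero, add_zero, mul_zero] at h1
  exact opNorm_eq_zero.1 (le_antisymm h1 (opNorm_nonneg X))

end EdgeData

end Dyson

/-! ### Bounds on the complementary spectral subspace. -/

namespace Dyson

open BlockMat SuperOp

variable {n : ℕ}

namespace EdgeData

variable {k : ℝ} {S : Matrix (Fin n) (Fin n) ℝ} {z : ℂ} {η ρ : ℝ} {v a u : Fin n ⊕ Fin n → ℝ}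

section Projection

theorem opNorm_leftVec_le (h : EdgeData k S (‖z‖ ^ 2) η ρ v a u)
    (hδ : 40000 * k ^ 29 * (ρ ^ 2 + η / ρ) ≤ 1) : opNorm (leftVec k S v u) ≤ 4 * k ^ 2 := by
  have hk := h.k_pos
  refine opNorm_diagonal_le (by positivity) fun i => ?_
  have h1 := h.symS_bounds (h.approx_bounds hδ (h.deflVec_approx hδ)) i
  rw [Complex.norm_real, Real.norm_of_nonneg (le_trans (by positivity) h1.1)]
  exact h1.2

theorem opNorm_leftVecSign_le (h : EdgeData k S (‖z‖ ^ 2) η ρ v a u)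
    (hδ : 40000 * k ^ 29 * (ρ ^ 2 + η / ρ) ≤ 1) : opNorm (leftVecSign S v u) ≤ 4 * k ^ 2 := by
  have hk := h.k_pos
  refine opNorm_diagonal_le (by positivity) fun i => ?_
  have h1 := h.symS_bounds (h.approx_bounds hδ (h.edgeVec_approx hδ)) i
  have h2 : ‖blockSign n i‖ = 1 := by cases i <;> simp [blockSign]
  rw [Complex.norm_real, norm_mul, h2, one_mul, Real.norm_of_nonneg (le_trans (by positivity) h1.1)]
  exact h1.2

theorem opNorm_liftVec_le (h : EdgeData k S (‖z‖ ^ 2) η ρ v a u) {t : ℝ} (ht : t ≤ 1 / 2)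
    {x : Fin n ⊕ Fin n → ℝ} (hx : ∀ i, |(symS S *ᵥ x) i| ≤ 4 * k ^ 2) :
    opNorm (liftVec S (edgeMat z v u Complex.I) t x) ≤ 32 * k ^ 4 := by
  have hk := h.k_pos
  have h4 := h.opNorm_edgeMat_le (s := Complex.I) Complex.norm_I
  have h3 : opNorm (Matrix.diagonal fun i => (((symS S *ᵥ x) i : ℝ) : ℂ)) ≤ 4 * k ^ 2 :=
    opNorm_diagonal_le (by positivity) fun i => by
      rw [Complex.norm_real, Real.norm_eq_abs]; exact hx i
  have h5 : ‖((1 - t : ℝ) : ℂ)⁻¹‖ ≤ 2 := by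
    rw [norm_inv, Complex.norm_real, Real.norm_of_nonneg (by linarith)]
    exact inv_le_of_inv_le₀ two_pos (by linarith)
  have h6 := (opNorm_mul_le (edgeMat z v u Complex.I *
    Matrix.diagonal fun i => (((symS S *ᵥ x) i : ℝ) : ℂ)) (edgeMat z v u Complex.I)).trans
    (mul_le_mul ((opNorm_mul_le _ _).trans
      (mul_le_mul h4 h3 (opNorm_nonneg _) (by positivity))) h4 (opNorm_nonneg _) (by positivity))
  rw [liftVec, opNorm_smul]
  calc _ ≤ 2 * (2 * k * (4 * k ^ 2) * (2 * k)) :=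
        mul_le_mul h5 h6 (opNorm_nonneg _) two_pos.le
    _ = _ := by ring

theorem opNorm_rightVec_le (h : EdgeData k S (‖z‖ ^ 2) η ρ v a u)
    (hδ : 40000 * k ^ 29 * (ρ ^ 2 + η / ρ) ≤ 1) : opNorm (rightVec k S z v u) ≤ 32 * k ^ 4 := by
  have hk := h.k_pos
  refine h.opNorm_liftVec_le (h.le_half hδ (h.deflVal_le hδ)) fun i => ?_
  have h1 := h.symS_bounds (h.approx_bounds hδ (h.deflVec_approx hδ)) i
  rw [abs_of_nonneg (le_trans (by positivity) h1.1)]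
  exact h1.2

theorem opNorm_rightVecSign_le (h : EdgeData k S (‖z‖ ^ 2) η ρ v a u)
    (hδ : 40000 * k ^ 29 * (ρ ^ 2 + η / ρ) ≤ 1) :
    opNorm (rightVecSign S z v u) ≤ 32 * k ^ 4 := by
  have hk := h.k_pos
  refine h.opNorm_liftVec_le (h.le_half hδ (h.edgeVal_le hδ)) fun i => ?_
  have h1 := h.symS_bounds (h.approx_bounds hδ (h.edgeVec_approx hδ)) i
  have h2 : |blockSign n i| = 1 := by cases i <;> simp [blockSign]
  unfold signVec
  rw [symS_mulVec_blockSign, abs_neg, abs_mul, h2, one_mul,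
    abs_of_nonneg (le_trans (by positivity) h1.1)]
  exact h1.2

theorem spectralProjection_apply (h : EdgeData k S (‖z‖ ^ 2) η ρ v a u)
    (hδ : 40000 * k ^ 29 * (ρ ^ 2 + η / ρ) ≤ 1) (R : BlockMat n) :
    spectralProjection (stabOp S (edgeMat z v u Complex.I))
      (spectrum ℂ (stabOp S (edgeMat z v u Complex.I)) \
        {(deflVal k S v u : ℂ), (edgeVal S v u : ℂ)}) R =
      R - (hsInner (leftVec k S v u) R / hsInner (leftVec k S v u) (rightVec k S z v u)) •
          rightVec k S z v u -
        (hsInner (leftVecSign S v u) R / hsInner (leftVecSign S v u) (rightVecSign S z v u)) •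
          rightVecSign S z v u :=
  (h.isolatedPair hδ).iSup_maxGenEigenspace_projection _ R

theorem opNorm_smul_le_of_pairing (h : EdgeData k S (‖z‖ ^ 2) η ρ v a u) {L B R : BlockMat n}
    {l b : ℝ} {c : ℂ} (hl : opNorm L ≤ l) (hb : opNorm B ≤ b) (hlb : l * b = 128 * k ^ 6)
    (hc : 1 / (4 * k ^ 3) ≤ ‖c‖) :
    opNorm ((hsInner L R / c) • B) ≤ 512 * k ^ 9 * opNorm R := by
  have hk := h.k_pos
  have hR := opNorm_nonneg R
  have hl0 := (opNorm_nonneg L).trans hl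
  have h0 : 0 < ‖c‖ := lt_of_lt_of_le (by positivity) hc
  have h1 : ‖c‖⁻¹ ≤ 4 * k ^ 3 := by
    rw [← inv_inv (4 * k ^ 3), ← one_div (4 * k ^ 3)]
    exact inv_anti₀ (by positivity) hc
  rw [opNorm_smul, norm_div, div_eq_mul_inv]
  calc ‖hsInner L R‖ * ‖c‖⁻¹ * opNorm B ≤ l * opNorm R * (4 * k ^ 3) * b := by
        gcongr
        · exact opNorm_nonneg B
        · exact (norm_hsInner_le h.n_pos L R).trans (mul_le_mul_of_nonneg_right hl hR)
    _ = 4 * k ^ 3 * opNorm R * (l * b) := by ring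
    _ = _ := by rw [hlb]; ring

/-- The projected matrix lies in the kernel of both left functionals, and so does its preimage,
because their eigenvalues are nonzero. On this kernel the lower bound loses its two extra terms. -/
theorem superNorm_inverse_mul_spectralProjection (h : EdgeData k S (‖z‖ ^ 2) η ρ v a u)
    (hδ : 40000 * k ^ 29 * (ρ ^ 2 + η / ρ) ≤ 1) :
    superNorm (Ring.inverse (stabOp S (edgeMat z v u Complex.I)) *
      spectralProjection (stabOp S (edgeMat z v u Complex.I))
        (spectrum ℂ (stabOp S (edgeMat z v u Complex.I)) \
          {(deflVal k S v u : ℂ), (edgeVal S v u : ℂ)})) ≤ 74825 * k ^ 24 := by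
  have hk := h.k_pos
  have hp := h.isolatedPair hδ
  refine superNorm_le (by positivity) fun R => ?_
  set T := stabOp S (edgeMat z v u Complex.I) with hT
  set 𝓠 := spectralProjection T (spectrum ℂ T \
    {(deflVal k S v u : ℂ), (edgeVal S v u : ℂ)}) with hQ
  have hTY : T (Ring.inverse T (𝓠 R)) = 𝓠 R := by
    rw [← Module.End.mul_apply, Ring.mul_inverse_cancel T (h.isUnit_stabOp hδ),
      Module.End.one_apply]
  have hR := h.spectralProjection_apply hδ R
  rw [← hT, ← hQ] at hR
  have z1 : hsFunctional (leftVec k S v u) (𝓠 R) = 0 := by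
    rw [hR, map_sub, map_sub, map_smul, map_smul, hp.φ_b'_eq_zero, smul_zero, sub_zero, smul_eq_mul,
      ← hsFunctional_apply, ← hsFunctional_apply, div_mul_cancel₀ _ hp.φ_b, sub_self]
  have z2 : hsFunctional (leftVecSign S v u) (𝓠 R) = 0 := by
    rw [hR, map_sub, map_sub, map_smul, map_smul, hp.symm.φ_b'_eq_zero, smul_zero, sub_zero,
      smul_eq_mul, ← hsFunctional_apply (leftVecSign S v u),
      ← hsFunctional_apply (leftVecSign S v u), div_mul_cancel₀ _ hp.φ_b', sub_self]
  have hβ : (deflVal k S v u : ℂ) ≠ 0 := by exact_mod_cast (h.deflVal_pos hδ).ne'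
  have hβ' : (edgeVal S v u : ℂ) ≠ 0 := by exact_mod_cast (h.edgeVal_pos hδ).ne'
  have y1 : hsInner (leftVec k S v u) (Ring.inverse T (𝓠 R)) = 0 := by
    have := hp.φ_map (Ring.inverse T (𝓠 R))
    rw [hTY, z1] at this
    exact (mul_eq_zero.1 this.symm).resolve_left hβ
  have y2 : hsInner (leftVecSign S v u) (Ring.inverse T (𝓠 R)) = 0 := by
    have := hp.φ_map' (Ring.inverse T (𝓠 R))
    rw [hTY, z2] at this
    exact (mul_eq_zero.1 this.symm).resolve_left hβ'
  have h1 := h.opNorm_le_stabOp hδ (Ring.inverse T (𝓠 R))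
  rw [← hT, hTY, y1, y2, norm_zero, add_zero, add_zero] at h1
  have h2 : opNorm (𝓠 R) ≤ opNorm R + 512 * k ^ 9 * opNorm R + 512 * k ^ 9 * opNorm R := by
    rw [hR]
    refine (opNorm_sub_le _ _).trans (add_le_add ((opNorm_sub_le _ _).trans
      (add_le_add le_rfl ?_)) ?_)
    · exact h.opNorm_smul_le_of_pairing (h.opNorm_leftVec_le hδ) (h.opNorm_rightVec_le hδ)
        (by ring) (h.norm_pairing hδ).1
    · exact h.opNorm_smul_le_of_pairing (h.opNorm_leftVecSign_le hδ)
        (h.opNorm_rightVecSign_le hδ) (by ring) (h.norm_pairingSign hδ).1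
  have h3 : opNorm R ≤ k ^ 9 * opNorm R :=
    le_mul_of_one_le_left (opNorm_nonneg R) (one_le_pow₀ h.one_le)
  rw [Module.End.mul_apply]
  calc _ ≤ 73 * k ^ 15 * opNorm (𝓠 R) := h1
    _ ≤ 73 * k ^ 15 * (k ^ 9 * opNorm R + 512 * k ^ 9 * opNorm R + 512 * k ^ 9 * opNorm R) := by
        refine mul_le_mul_of_nonneg_left (h2.trans ?_) (by positivity)
        linarith
    _ = _ := by ring

theorem hsAdjoint_spectralProjection_apply (h : EdgeData k S (‖z‖ ^ 2) η ρ v a u)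
    (hδ : 40000 * k ^ 29 * (ρ ^ 2 + η / ρ) ≤ 1) (X : BlockMat n) :
    hsAdjoint (spectralProjection (stabOp S (edgeMat z v u Complex.I))
      (spectrum ℂ (stabOp S (edgeMat z v u Complex.I)) \
        {(deflVal k S v u : ℂ), (edgeVal S v u : ℂ)})) X =
      X - (hsInner (rightVec k S z v u) X / hsInner (rightVec k S z v u) (leftVec k S v u)) •
          leftVec k S v u -
        (hsInner (rightVecSign S z v u) X / hsInner (rightVecSign S z v u) (leftVecSign S v u)) •
          leftVecSign S v u := by
  refine eq_of_hsInner h.n_pos fun V => ?_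
  rw [← hsInner_hsAdjoint, h.spectralProjection_apply hδ, ← conj_hsInner,
    ← hsFunctional_apply X, ← hsFunctional_apply V]
  simp only [map_sub, map_smul, smul_eq_mul, map_mul, map_div₀, hsFunctional_apply, conj_hsInner]
  ring

/-- The dual argument: the spectral projection kills both right eigenvectors, hence the range of its
adjoint is orthogonal to them, and the inverse of the adjoint operator preserves this orthogonality.
-/
theorem superNorm_inverse_mul_hsAdjoint_spectralProjection
    (h : EdgeData k S (‖z‖ ^ 2) η ρ v a u)
    (hδ : 40000 * k ^ 29 * (ρ ^ 2 + η / ρ) ≤ 1) :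
    superNorm (Ring.inverse (hsAdjoint (stabOp S (edgeMat z v u Complex.I))) *
      hsAdjoint (spectralProjection (stabOp S (edgeMat z v u Complex.I))
        (spectrum ℂ (stabOp S (edgeMat z v u Complex.I)) \
          {(deflVal k S v u : ℂ), (edgeVal S v u : ℂ)}))) ≤ 74825 * k ^ 24 := by
  have hk := h.k_pos
  have hp := h.isolatedPair hδ
  refine superNorm_le (by positivity) fun X => ?_
  set T := stabOp S (edgeMat z v u Complex.I) with hT
  set 𝓠 := spectralProjection T (spectrum ℂ T \
    {(deflVal k S v u : ℂ), (edgeVal S v u : ℂ)}) with hQ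
  have hTY : hsAdjoint T (Ring.inverse (hsAdjoint T) (hsAdjoint 𝓠 X)) = hsAdjoint 𝓠 X := by
    rw [← Module.End.mul_apply, Ring.mul_inverse_cancel _ (h.isUnit_hsAdjoint_stabOp hδ),
      Module.End.one_apply]
  have hX := h.hsAdjoint_spectralProjection_apply hδ X
  rw [← hT, ← hQ] at hX
  have zero_left : ∀ V : BlockMat n, hsInner 0 V = 0 := fun V => by
    rw [← conj_hsInner, ← hsFunctional_apply, map_zero, map_zero]
  have z1 : 𝓠 (rightVec k S z v u) = 0 := by
    have e1 := hp.φ_b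
    have e2 := hp.symm.φ_b'_eq_zero
    rw [hsFunctional_apply] at e1 e2
    rw [hQ, h.spectralProjection_apply hδ, div_self e1, e2, one_smul, zero_div, zero_smul,
      sub_self, sub_zero]
  have z2 : 𝓠 (rightVecSign S z v u) = 0 := by
    have e1 := hp.φ_b'
    have e2 := hp.φ_b'_eq_zero
    rw [hsFunctional_apply] at e1 e2
    rw [hQ, h.spectralProjection_apply hδ, div_self e1, e2, one_smul, zero_div, zero_smul,
      sub_zero, sub_self]
  have key : ∀ (t : ℝ) (B : BlockMat n), 0 < t → T B = (t : ℂ) • B → 𝓠 B = 0 →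
      hsInner B (Ring.inverse (hsAdjoint T) (hsAdjoint 𝓠 X)) = 0 := by
    intro t B ht hB hB0
    have e1 : hsInner B (hsAdjoint 𝓠 X) = 0 := by
      rw [← hsInner_hsAdjoint, hB0, zero_left]
    rw [← hTY, ← hsInner_hsAdjoint, hB, hsInner_smul_left, Complex.conj_ofReal] at e1
    exact (mul_eq_zero.1 e1).resolve_left (by exact_mod_cast ht.ne')
  have h1 := h.opNorm_le_hsAdjoint_stabOp hδ (Ring.inverse (hsAdjoint T) (hsAdjoint 𝓠 X))
  rw [← hT, hTY, key _ _ (h.deflVal_pos hδ) (h.stabOp_rightVec hδ) z1,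
    key _ _ (h.edgeVal_pos hδ) (h.stabOp_rightVecSign hδ) z2, norm_zero, add_zero, add_zero] at h1
  have h2 : opNorm (hsAdjoint 𝓠 X) ≤
      opNorm X + 512 * k ^ 9 * opNorm X + 512 * k ^ 9 * opNorm X := by
    rw [hX]
    refine (opNorm_sub_le _ _).trans (add_le_add ((opNorm_sub_le _ _).trans
      (add_le_add le_rfl ?_)) ?_)
    · refine h.opNorm_smul_le_of_pairing (h.opNorm_rightVec_le hδ) (h.opNorm_leftVec_le hδ)
        (by ring) ?_
      rw [← conj_hsInner, RCLike.norm_conj]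
      exact (h.norm_pairing hδ).1
    · refine h.opNorm_smul_le_of_pairing (h.opNorm_rightVecSign_le hδ)
        (h.opNorm_leftVecSign_le hδ) (by ring) ?_
      rw [← conj_hsInner, RCLike.norm_conj]
      exact (h.norm_pairingSign hδ).1
  have h3 : opNorm X ≤ k ^ 9 * opNorm X :=
    le_mul_of_one_le_left (opNorm_nonneg X) (one_le_pow₀ h.one_le)
  rw [Module.End.mul_apply]
  calc _ ≤ 73 * k ^ 15 * opNorm (hsAdjoint 𝓠 X) := h1
    _ ≤ 73 * k ^ 15 * (k ^ 9 * opNorm X + 512 * k ^ 9 * opNorm X + 512 * k ^ 9 * opNorm X) := by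
        refine mul_le_mul_of_nonneg_left (h2.trans ?_) (by positivity)
        linarith
    _ = _ := by ring

end Projection

end EdgeData

end Dyson

/-! ### Expansions of the eigenvectors, eigenvalues and pairings. -/

namespace Dyson

open BlockMat SuperOp

variable {n : ℕ}

theorem imPart_edgeMat {z : ℂ} {v u : Fin n ⊕ Fin n → ℝ} (hu : ∀ i, u i.swap = u i) :
    imPart (edgeMat z v u Complex.I) = twoDiag (fun i => (v i : ℂ)) fun _ => 0 := by
  rw [imPart, edgeMat_conjTranspose z v u hu, edgeMat, edgeMat, twoDiag_sub, smul_twoDiag]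
  congr 1 <;> ext i
  · rw [Complex.conj_I]
    field_simp
    ring
  · rw [sub_self, mul_zero]

theorem rePart_edgeMat {z : ℂ} {v u : Fin n ⊕ Fin n → ℝ} (hu : ∀ i, u i.swap = u i) :
    rePart (edgeMat z v u Complex.I) = twoDiag (fun _ => 0) fun i => -(offDiag n z i * u i) := by
  rw [rePart, edgeMat_conjTranspose z v u hu, edgeMat, edgeMat, twoDiag_add, smul_twoDiag]
  congr 1 <;> ext i
  · rw [Complex.conj_I]; ring
  · ring

theorem imPart_neg_twoDiag_offDiag (z : ℂ) (a : Fin n ⊕ Fin n → ℝ) :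
    imPart (-twoDiag (fun i => Complex.I * (a i : ℂ)) (offDiag n z)) =
      twoDiag (fun i => -(a i : ℂ)) fun _ => 0 := by
  rw [imPart, Matrix.conjTranspose_neg, conjTranspose_twoDiag, neg_twoDiag, neg_twoDiag,
    twoDiag_sub, smul_twoDiag]
  congr 1 <;> ext i
  · rw [map_mul, Complex.conj_I, Complex.conj_ofReal]
    field_simp
    ring
  · rw [conj_offDiag_swap, sub_self, mul_zero]

theorem Eminus_eq : Eminus n = twoDiag (fun i => (blockSign n i : ℂ)) fun _ => 0 := by
  rw [twoDiag_diagonal, Eminus]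
  ext i j
  cases i <;> cases j <;> simp [blockSign, Matrix.diagonal_apply, Matrix.one_apply]
  split_ifs <;> simp

namespace EdgeData

variable {k : ℝ} {S : Matrix (Fin n) (Fin n) ℝ} {z : ℂ} {η ρ : ℝ} {v a u : Fin n ⊕ Fin n → ℝ}

theorem liftVec_eq_twoDiag (h : EdgeData k S (‖z‖ ^ 2) η ρ v a u) {t : ℝ}
    {x : Fin n ⊕ Fin n → ℝ} (hx : edgeOp S v u (-1) *ᵥ x = (1 - t) • x) (ht : t < 1) :
    liftVec S (edgeMat z v u Complex.I) t x = twoDiag (fun i => (x i : ℂ)) (fun i =>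
      -(Complex.I * (offDiag n z i * u i)) *
        (((1 - t)⁻¹ * (v i * (symS S *ᵥ x) i + v i.swap * (symS S *ᵥ x) i.swap) : ℝ) : ℂ)) := by
  have h1 : ((1 - t : ℝ) : ℂ) ≠ 0 := Complex.ofReal_ne_zero.2 (by linarith)
  rw [liftVec, h.edgeMat_mul_diagonal_mul Complex.I_mul_I, smul_twoDiag]
  congr 1 <;> ext i
  · rw [edgeOp_ofReal, hx, Pi.smul_apply, smul_eq_mul, Complex.ofReal_mul,
      inv_mul_cancel_left₀ h1]
  · push_cast; ring

/-- The off-diagonal part of the right eigenvectors to leading order. -/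
theorem offDiag_approx (h : EdgeData k S (‖z‖ ^ 2) η ρ v a u)
    (hδ : 40000 * k ^ 29 * (ρ ^ 2 + η / ρ) ≤ 1) {t : ℝ} (ht0 : 0 < t)
    (ht : t ≤ 4 * k ^ 5 * (ρ ^ 2 + η / ρ)) {s e : Fin n ⊕ Fin n → ℝ} (he : ∀ i, |e i| ≤ 1)
    (hs : ∀ i, |s i - e i * (a i / ρ)| ≤ 8000 * k ^ 26 * (ρ ^ 2 + η / ρ)) (i) :
    |(1 - t)⁻¹ * (v i * s i + v i.swap * s i.swap) - (e i + e i.swap) * (v i * a i / ρ)| ≤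
      33000 * k ^ 27 * (ρ ^ 2 + η / ρ) := by
  have hk := h.k_pos
  have hρ := h.ρ_pos
  have hη := h.η_pos
  have hth := h.le_half hδ ht
  set δ := ρ ^ 2 + η / ρ with hδd
  have hδ0 : 0 < δ := by positivity
  have h1t : (1 - t)⁻¹ ≤ 2 := inv_le_of_inv_le₀ two_pos (by linarith)
  have h1t0 : 0 < (1 - t)⁻¹ := inv_pos.2 (by linarith)
  have hv : ∀ i, |v i| ≤ k := fun i => by
    rw [abs_of_pos (h.v_pos i)]
    exact (h.v_ub i).trans (mul_le_of_le_one_right hk.le h.ρ_le)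
  have hva : |v i * a i / ρ| ≤ k ^ 2 := by
    rw [abs_of_nonneg (div_nonneg (mul_nonneg (h.v_pos i).le (h.a_pos i).le) hρ.le),
      div_le_iff₀ hρ]
    calc v i * a i ≤ k * ρ * (k * ρ) :=
          mul_le_mul (h.v_ub i) (h.a_ub i) (h.a_pos i).le (by positivity)
      _ = k ^ 2 * ρ * ρ := by ring
      _ ≤ k ^ 2 * ρ * 1 := by gcongr; exact h.ρ_le
      _ = _ := by ring
  -- Both leading terms carry the same factor because `v' a' = v a`. The factor `(1 - t)⁻¹` costs
  -- only another error of order `t`.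
  have e1 : (1 - t)⁻¹ * (v i * s i + v i.swap * s i.swap) - (e i + e i.swap) * (v i * a i / ρ) =
      (1 - t)⁻¹ * (v i * (s i - e i * (a i / ρ)) +
        v i.swap * (s i.swap - e i.swap * (a i.swap / ρ)) +
        t * ((e i + e i.swap) * (v i * a i / ρ))) := by
    have h2 : (1 - t)⁻¹ * (1 - t) = 1 := inv_mul_cancel₀ (by linarith)
    have h3 := h.va_swap i
    linear_combination ((e i + e i.swap) * (v i * a i / ρ)) * h2 +
      (1 - t)⁻¹ * e i.swap / ρ * h3
  have b1 : ∀ i, |v i * (s i - e i * (a i / ρ))| ≤ k * (8000 * k ^ 26 * δ) := fun i => by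
    rw [abs_mul]
    exact mul_le_mul (hv i) (hs i) (abs_nonneg _) hk.le
  have b2 : |t * ((e i + e i.swap) * (v i * a i / ρ))| ≤ 4 * k ^ 5 * δ * (2 * k ^ 2) := by
    rw [abs_mul, abs_mul, abs_of_pos ht0]
    have : |e i + e i.swap| ≤ 2 := by
      refine (abs_add_le _ _).trans ?_
      linarith [he i, he i.swap]
    refine mul_le_mul ht ?_ (by positivity) (by positivity)
    exact mul_le_mul this hva (abs_nonneg _) two_pos.le
  have b3 := (abs_add_le _ _).trans (add_le_add ((abs_add_le _ _).trans
    (add_le_add (b1 i) (b1 i.swap))) b2)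
  have hk7 : k ^ 7 ≤ k ^ 27 := pow_le_pow_right₀ h.one_le (by norm_num)
  rw [e1, abs_mul, abs_of_pos h1t0]
  calc _ ≤ 2 * (k * (8000 * k ^ 26 * δ) + k * (8000 * k ^ 26 * δ) + 4 * k ^ 5 * δ * (2 * k ^ 2)) :=
        mul_le_mul h1t b3 (abs_nonneg _) two_pos.le
    _ = 32000 * k ^ 27 * δ + 16 * (k ^ 7 * δ) := by ring
    _ ≤ 32000 * k ^ 27 * δ + 1000 * (k ^ 27 * δ) := by
        have h5 : k ^ 7 * δ ≤ k ^ 27 * δ := mul_le_mul_of_nonneg_right hk7 hδ0.le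
        have h6 : 0 ≤ k ^ 27 * δ := by positivity
        linarith
    _ = _ := by ring

theorem opNorm_twoDiag_sub_le (h : EdgeData k S (‖z‖ ^ 2) η ρ v a u)
    {x x' y y' : Fin n ⊕ Fin n → ℝ}
    (hx : ∀ i, |x i - x' i| ≤ 4000 * k ^ 25 * (ρ ^ 2 + η / ρ))
    (hy : ∀ i, |y i - y' i| ≤ 33000 * k ^ 27 * (ρ ^ 2 + η / ρ)) :
    opNorm (twoDiag (fun i => (x i : ℂ)) (fun i => -(Complex.I * (offDiag n z i * u i)) * (y i : ℂ)) -
      twoDiag (fun i => (x' i : ℂ)) (fun i => -(Complex.I * (offDiag n z i * u i)) * (y' i : ℂ))) ≤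
      37000 * k ^ 28 * (ρ ^ 2 + η / ρ) := by
  have hk := h.k_pos
  have hρ := h.ρ_pos
  have hη := h.η_pos
  set δ := ρ ^ 2 + η / ρ with hδd
  have hδ0 : 0 < δ := by positivity
  rw [twoDiag_sub]
  have h1 := opNorm_twoDiag_le (n := n) (a := fun i => (x i : ℂ) - x' i)
    (b := fun i => -(Complex.I * (offDiag n z i * u i)) * (y i : ℂ) -
      -(Complex.I * (offDiag n z i * u i)) * (y' i : ℂ)) (A := 4000 * k ^ 25 * δ)
    (B := k * (33000 * k ^ 27 * δ)) (by positivity) (by positivity)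
    (fun i => by
      rw [← Complex.ofReal_sub, Complex.norm_real, Real.norm_eq_abs]
      exact hx i)
    (fun i => by
      rw [← mul_sub, norm_mul, norm_neg, norm_mul, Complex.norm_I, one_mul, ← Complex.ofReal_sub,
        Complex.norm_real, Real.norm_eq_abs]
      exact mul_le_mul (h.norm_offDiag_mul_le i) (hy i) (abs_nonneg _) hk.le)
  have hk28 : k ^ 25 ≤ k ^ 28 := pow_le_pow_right₀ h.one_le (by norm_num)
  have h5 : k ^ 25 * δ ≤ k ^ 28 * δ := mul_le_mul_of_nonneg_right hk28 hδ0.le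
  calc _ ≤ _ := h1
    _ = 4000 * (k ^ 25 * δ) + 33000 * (k ^ 28 * δ) := by ring
    _ ≤ 4000 * (k ^ 28 * δ) + 33000 * (k ^ 28 * δ) := by linarith
    _ = _ := by ring

theorem rightVec_approx (h : EdgeData k S (‖z‖ ^ 2) η ρ v a u)
    (hδ : 40000 * k ^ 29 * (ρ ^ 2 + η / ρ) ≤ 1) :
    opNorm (rightVec k S z v u - ((ρ⁻¹ : ℂ) • imPart (edgeMat z v u Complex.I) -
      (2 * Complex.I * (ρ⁻¹ : ℂ)) • (imPart (edgeMat z v u Complex.I) *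
        twoDiag (fun i => -(a i : ℂ)) (fun _ => 0) * rePart (edgeMat z v u Complex.I)))) ≤
      37000 * k ^ 28 * (ρ ^ 2 + η / ρ) := by
  have h1 := h.opNorm_twoDiag_sub_le (h.deflVec_approx hδ)
    (h.offDiag_approx hδ (h.deflVal_pos hδ) (h.deflVal_le hδ) (e := fun _ => 1) (by simp)
      (fun i => by rw [one_mul]; exact h.symS_approx (h.deflVec_approx hδ) i))
  refine le_of_eq_of_le ?_ h1
  rw [rightVec, h.liftVec_eq_twoDiag (h.deflVec_spec hδ).2.2 (h.deflVal_lt_one hδ),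
    imPart_edgeMat h.u_swap, rePart_edgeMat h.u_swap, twoDiag_mul, twoDiag_mul, smul_twoDiag,
    smul_twoDiag, twoDiag_sub]
  congr 3 <;> ext i
  · push_cast; ring
  · push_cast; ring

/-- No off-diagonal term appears at leading order: `𝕊` applied to the signed vector is approximately
`-ε a / ρ`, with opposite signs on the two blocks, and the two contributions cancel. For `rightVec`
they add up instead. -/
theorem rightVecSign_approx (h : EdgeData k S (‖z‖ ^ 2) η ρ v a u)
    (hδ : 40000 * k ^ 29 * (ρ ^ 2 + η / ρ) ≤ 1) :
    opNorm (rightVecSign S z v u -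
      (ρ⁻¹ : ℂ) • (Eminus n * imPart (edgeMat z v u Complex.I))) ≤
      37000 * k ^ 28 * (ρ ^ 2 + η / ρ) := by
  have habs : ∀ i, |blockSign n i| = 1 := fun i => by cases i <;> simp [blockSign]
  have h1 := h.opNorm_twoDiag_sub_le (x := signVec S v u) (x' := fun i => blockSign n i * (v i / ρ))
    (fun i => by
      unfold signVec
      rw [← mul_sub, abs_mul, habs, one_mul]
      exact h.edgeVec_approx hδ i)
    (h.offDiag_approx hδ (h.edgeVal_pos hδ) (h.edgeVal_le hδ) (s := symS S *ᵥ signVec S v u)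
      (e := fun i => -blockSign n i) (fun i => by rw [abs_neg, habs])
      (fun i => by
        unfold signVec
        rw [symS_mulVec_blockSign, ← neg_mul, ← mul_sub, abs_mul, abs_neg, habs, one_mul]
        exact h.symS_approx (h.edgeVec_approx hδ) i))
  refine le_of_eq_of_le ?_ h1
  rw [rightVecSign, h.liftVec_eq_twoDiag (h.edgeOp_signVec hδ) (h.edgeVal_lt_one hδ),
    imPart_edgeMat h.u_swap, Eminus_eq, twoDiag_mul, smul_twoDiag]
  congr 3 <;> ext i
  · push_cast; ring
  · rw [blockSign_swap]; push_cast; ring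

theorem leftVec_approx (h : EdgeData k S (‖z‖ ^ 2) η ρ v a u)
    (hδ : 40000 * k ^ 29 * (ρ ^ 2 + η / ρ) ≤ 1) :
    opNorm (leftVec k S v u - -((ρ⁻¹ : ℂ) • twoDiag (fun i => -(a i : ℂ)) (fun _ => 0))) ≤
      8000 * k ^ 26 * (ρ ^ 2 + η / ρ) := by
  have hk := h.k_pos
  have hρ := h.ρ_pos
  have hη := h.η_pos
  rw [twoDiag_diagonal, leftVec, ← Matrix.diagonal_smul, Matrix.diagonal_neg, Matrix.diagonal_sub]
  refine opNorm_diagonal_le (by positivity) fun i => ?_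
  have e : ((((symS S *ᵥ deflVec k S v u) i : ℝ) : ℂ) -
      -((ρ⁻¹ : ℂ) • fun i => -(a i : ℂ)) i) =
      (((symS S *ᵥ deflVec k S v u) i - a i / ρ : ℝ) : ℂ) := by
    rw [Pi.smul_apply, smul_eq_mul]; push_cast; ring
  have h1 := h.symS_approx (h.deflVec_approx hδ) i
  rw [← Real.norm_eq_abs, ← Complex.norm_real, ← e] at h1
  exact h1

theorem leftVecSign_approx (h : EdgeData k S (‖z‖ ^ 2) η ρ v a u)
    (hδ : 40000 * k ^ 29 * (ρ ^ 2 + η / ρ) ≤ 1) :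
    opNorm (leftVecSign S v u -
      -((ρ⁻¹ : ℂ) • (Eminus n * twoDiag (fun i => -(a i : ℂ)) (fun _ => 0)))) ≤
      8000 * k ^ 26 * (ρ ^ 2 + η / ρ) := by
  have hk := h.k_pos
  have hρ := h.ρ_pos
  have hη := h.η_pos
  have habs : ∀ i, |blockSign n i| = 1 := fun i => by cases i <;> simp [blockSign]
  rw [Eminus_eq, twoDiag_diagonal, twoDiag_diagonal, leftVecSign, Matrix.diagonal_mul_diagonal,
    ← Matrix.diagonal_smul, Matrix.diagonal_neg, Matrix.diagonal_sub]
  refine opNorm_diagonal_le (by positivity) fun i => ?_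
  have e : (((blockSign n i * (symS S *ᵥ edgeVec S v u) i : ℝ) : ℂ) -
      -((ρ⁻¹ : ℂ) • fun i => (blockSign n i : ℂ) * -(a i : ℂ)) i) =
      ((blockSign n i * ((symS S *ᵥ edgeVec S v u) i - a i / ρ) : ℝ) : ℂ) := by
    rw [Pi.smul_apply, smul_eq_mul]; push_cast; ring
  have h1 := h.symS_approx (h.edgeVec_approx hδ) i
  rw [← one_mul |_|, ← habs i, ← abs_mul, ← Real.norm_eq_abs, ← Complex.norm_real, ← e] at h1
  exact h1

theorem sum_le_of_le {f : Fin n ⊕ Fin n → ℝ} {c : ℝ} (h : EdgeData k S (‖z‖ ^ 2) η ρ v a u)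
    (hf : ∀ i, |f i| ≤ c) : |(2 * (n : ℝ))⁻¹ * ∑ i, f i| ≤ c := by
  have hn := h.n_pos'
  rw [abs_mul, abs_of_pos (by positivity), inv_mul_le_iff₀ (by positivity)]
  refine (Finset.abs_sum_le_sum_abs _ _).trans ((Finset.sum_le_sum fun i _ => hf i).trans ?_)
  rw [Finset.sum_const, Finset.card_univ, Fintype.card_sum, Fintype.card_fin, nsmul_eq_mul]
  push_cast
  apply le_of_eq
  ring

/-- The expansion of the eigenvalue times the pairing. -/
theorem eigenvalue_mul_pairing (h : EdgeData k S (‖z‖ ^ 2) η ρ v a u)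
    (hδ : 40000 * k ^ 29 * (ρ ^ 2 + η / ρ) ≤ 1) {σ t : ℝ} (hσ : |σ| ≤ 1)
    {x : Fin n ⊕ Fin n → ℝ} (hx0 : ∀ i, 0 < x i) (hsum : ∑ i, x i = 2 * n * Real.pi)
    (hx : edgeOp S v u σ *ᵥ x = (1 - t) • x)
    (happ : ∀ i, |x i - v i / ρ| ≤ 4000 * k ^ 25 * (ρ ^ 2 + η / ρ)) :
    |t * ((2 * (n : ℝ))⁻¹ * ∑ i, (symS S *ᵥ x) i * x i) -
      (Real.pi * η * ρ⁻¹ +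
        (1 - σ) * (ρ ^ 2 * ((ρ ^ 4)⁻¹ * ((2 * (n : ℝ))⁻¹ * ∑ i, (v i * a i) ^ 2))))| ≤
      160000 * k ^ 32 * (ρ ^ 3 + η * ρ + η ^ 2 / ρ ^ 2) := by
  have hk := h.k_pos
  have hn := h.n_pos'
  have hρ := h.ρ_pos
  have hη := h.η_pos
  have hb := h.approx_bounds hδ happ
  have hsa := h.symS_approx happ
  have ht0 := h.eigenvalue_pos hσ hx0 hx
  have ht := h.eigenvalue_le hσ hx0 hx
  have hid := h.eigenvalue_identity hx
  set δ := ρ ^ 2 + η / ρ with hδd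
  have hδ0 : 0 < δ := by positivity
  have hσ2 : |1 - σ| ≤ 2 := by
    have := abs_le.1 hσ
    rw [abs_le]; constructor <;> linarith
  have e0 : ∑ i, (η + (1 - σ) * (symS S *ᵥ fun j => v j ^ 2 * a j) i) * x i =
      η * (2 * n * Real.pi) + (1 - σ) * ∑ i, v i ^ 2 * a i * (symS S *ᵥ x) i := by
    rw [← hsum, sum_mul_symS S (fun j => v j ^ 2 * a j) x, Finset.mul_sum, Finset.mul_sum,
      ← Finset.sum_add_distrib]
    exact Finset.sum_congr rfl fun i _ => by ring
  rw [e0] at hid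
  have e1 : ∑ i, (symS S *ᵥ x) i * x i =
      (∑ i, a i * x i) / ρ + ∑ i, ((symS S *ᵥ x) i - a i / ρ) * x i := by
    rw [Finset.sum_div, ← Finset.sum_add_distrib]
    exact Finset.sum_congr rfl fun i _ => by ring
  have e2 : ∑ i, v i ^ 2 * a i * (symS S *ᵥ x) i =
      (∑ i, (v i * a i) ^ 2) / ρ + ∑ i, v i ^ 2 * a i * ((symS S *ᵥ x) i - a i / ρ) := by
    rw [Finset.sum_div, ← Finset.sum_add_distrib]
    exact Finset.sum_congr rfl fun i _ => by ring
  -- The exact identity for `t ⟨a, x⟩` with `a / ρ` replaced by `𝕊 x`. The normalization of `∑ x`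
  -- makes the term `π η / ρ` exact. Both remainders pair the error `𝕊 x - a / ρ` of order `δ` with
  -- a further factor of order at most `δ`.
  have e3 : t * ((2 * (n : ℝ))⁻¹ * ∑ i, (symS S *ᵥ x) i * x i) -
      (Real.pi * η * ρ⁻¹ +
        (1 - σ) * (ρ ^ 2 * ((ρ ^ 4)⁻¹ * ((2 * (n : ℝ))⁻¹ * ∑ i, (v i * a i) ^ 2)))) =
      t * ((2 * (n : ℝ))⁻¹ * ∑ i, ((symS S *ᵥ x) i - a i / ρ) * x i) +
      (1 - σ) * (((2 * (n : ℝ))⁻¹ * ∑ i, v i ^ 2 * a i * ((symS S *ᵥ x) i - a i / ρ)) / ρ) := by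
    rw [e2] at hid
    rw [e1]
    field_simp
    field_simp at hid
    linear_combination hid
  have b1 : |(2 * (n : ℝ))⁻¹ * ∑ i, ((symS S *ᵥ x) i - a i / ρ) * x i| ≤
      8000 * k ^ 26 * δ * (2 * k) := h.sum_le_of_le fun i => by
    rw [abs_mul, abs_of_pos (hx0 i)]
    exact mul_le_mul (hsa i) (hb i).2 (hx0 i).le (by positivity)
  have b2 : |(2 * (n : ℝ))⁻¹ * ∑ i, v i ^ 2 * a i * ((symS S *ᵥ x) i - a i / ρ)| ≤
      (k * ρ) ^ 2 * (k * ρ) * (8000 * k ^ 26 * δ) := h.sum_le_of_le fun i => by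
    have hv := h.v_pos i
    have ha := h.a_pos i
    rw [abs_mul, abs_of_pos (by positivity)]
    refine mul_le_mul ?_ (hsa i) (abs_nonneg _) (by positivity)
    exact mul_le_mul (pow_le_pow_left₀ hv.le (h.v_ub i) 2) (h.a_ub i) ha.le (by positivity)
  have hρδ : ρ ^ 2 ≤ δ := by rw [hδd]; linarith [show 0 ≤ η / ρ by positivity]
  -- Expanding the square gives `ρ⁴ + 2 η ρ + η² / ρ²`, and `ρ⁴ ≤ ρ³`.
  have hδ2 : δ ^ 2 ≤ 2 * (ρ ^ 3 + η * ρ + η ^ 2 / ρ ^ 2) := by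
    have h1 : ρ ^ 4 ≤ ρ ^ 3 := pow_le_pow_of_le_one hρ.le h.ρ_le (by norm_num)
    have h2 : η ^ 2 / ρ ^ 2 = (η / ρ) ^ 2 := by rw [div_pow]
    have h3 : 0 < η * ρ := by positivity
    rw [h2, hδd]
    nlinarith [sq_nonneg (ρ ^ 2 - η / ρ)]
  rw [e3]
  refine (abs_add_le _ _).trans ?_
  rw [abs_mul t, abs_mul (1 - σ), abs_of_pos ht0, abs_div, abs_of_pos hρ]
  calc _ ≤ 4 * k ^ 5 * δ * (8000 * k ^ 26 * δ * (2 * k)) +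
        2 * ((k * ρ) ^ 2 * (k * ρ) * (8000 * k ^ 26 * δ) / ρ) := by gcongr
    _ = 64000 * k ^ 32 * δ ^ 2 + 16000 * (k ^ 29 * (δ * ρ ^ 2)) := by field_simp; ring
    _ ≤ 64000 * k ^ 32 * δ ^ 2 + 16000 * (k ^ 32 * (δ * δ)) := by
        have : k ^ 29 ≤ k ^ 32 := pow_le_pow_right₀ h.one_le (by norm_num)
        gcongr
    _ = 80000 * k ^ 32 * δ ^ 2 := by ring
    _ ≤ 80000 * k ^ 32 * (2 * (ρ ^ 3 + η * ρ + η ^ 2 / ρ ^ 2)) := by gcongr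
    _ = _ := by ring

theorem psi_bounds (h : EdgeData k S (‖z‖ ^ 2) η ρ v a u) :
    1 / k ^ 4 ≤ (ρ ^ 4)⁻¹ * ((2 * (n : ℝ))⁻¹ * ∑ i, (v i * a i) ^ 2) ∧
      (ρ ^ 4)⁻¹ * ((2 * (n : ℝ))⁻¹ * ∑ i, (v i * a i) ^ 2) ≤ k ^ 4 := by
  have hk := h.k_pos
  have hn := h.n_pos'
  have hρ := h.ρ_pos
  have hcard : ∀ c : ℝ, ∑ _i : Fin n ⊕ Fin n, c = 2 * n * c := fun c => by
    rw [Finset.sum_const, Finset.card_univ, Fintype.card_sum, Fintype.card_fin, nsmul_eq_mul]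
    push_cast; ring
  constructor
  · rw [le_inv_mul_iff₀ (by positivity), le_inv_mul_iff₀ (by positivity), ← hcard]
    refine Finset.sum_le_sum fun i _ => ?_
    calc ρ ^ 4 * (1 / k ^ 4) = (ρ / k * (ρ / k)) ^ 2 := by field_simp
      _ ≤ _ := by
        have := h.v_pos i
        exact pow_le_pow_left₀ (by positivity)
          (mul_le_mul (h.v_lb i) (h.a_lb i) (by positivity) this.le) 2
  · rw [inv_mul_le_iff₀ (by positivity), inv_mul_le_iff₀ (by positivity), ← hcard]
    refine Finset.sum_le_sum fun i _ => ?_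
    have h1 := h.v_pos i
    have h2 := h.a_pos i
    calc (v i * a i) ^ 2 ≤ (k * ρ * (k * ρ)) ^ 2 :=
          pow_le_pow_left₀ (by positivity) (mul_le_mul (h.v_ub i) (h.a_ub i) h2.le (by positivity)) 2
      _ = _ := by ring

theorem avg_sq (v a : Fin n ⊕ Fin n → ℝ) :
    (avg ((twoDiag (fun i => (v i : ℂ)) (fun _ => 0) *
      twoDiag (fun i => -(a i : ℂ)) fun _ => 0) ^ 2)).re =
      (2 * (n : ℝ))⁻¹ * ∑ i, (v i * a i) ^ 2 := by
  rw [twoDiag_diagonal, twoDiag_diagonal, Matrix.diagonal_mul_diagonal, Matrix.diagonal_pow, avg,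
    Matrix.trace_diagonal]
  have : (2 * (n : ℂ))⁻¹ * ∑ i, ((fun i => (v i : ℂ) * -(a i : ℂ)) ^ 2) i =
      (((2 * (n : ℝ))⁻¹ * ∑ i, (v i * a i) ^ 2 : ℝ) : ℂ) := by
    push_cast
    congr 1
    refine Finset.sum_congr rfl fun i _ => ?_
    rw [Pi.pow_apply]; ring
  rw [this, Complex.ofReal_re]

theorem edgeVal_comparable (h : EdgeData k S (‖z‖ ^ 2) η ρ v a u)
    (hδ : 40000 * k ^ 29 * (ρ ^ 2 + η / ρ) ≤ 1) :
    edgeVal S v u ≤ k * (η / ρ) ∧ η / ρ ≤ k * edgeVal S v u := by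
  have hk := h.k_pos
  have hρ := h.ρ_pos
  have h1 := h.eigenvalue_lower (σ := 1) (by norm_num) (h.edgeVec_spec hδ).1 (h.edgeVec_spec hδ).2.2
  have h2 := h.eigenvalue_upper (σ := 1) (by norm_num) (h.edgeVec_spec hδ).1 (h.edgeVec_spec hδ).2.2
  rw [sub_self, zero_mul, add_zero] at h1 h2
  constructor
  · rw [mul_div_assoc', le_div_iff₀ hρ]
    rw [div_mul_eq_mul_div, div_le_iff₀ hk] at h2
    linarith
  · rw [div_le_iff₀ hρ]
    linarith

theorem le_deflVal (h : EdgeData k S (‖z‖ ^ 2) η ρ v a u)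
    (hδ : 40000 * k ^ 29 * (ρ ^ 2 + η / ρ) ≤ 1) :
    ρ ^ 2 + η / ρ ≤ k ^ 5 * deflVal k S v u := by
  have hk := h.k_pos
  have hρ := h.ρ_pos
  have hη := h.η_pos
  have h1 := h.eigenvalue_lower (σ := -1) (by norm_num) (h.deflVec_spec hδ).1
    (h.deflVec_spec hδ).2.2
  have e : ρ ^ 2 + η / ρ = (ρ ^ 3 + η) / ρ := by field_simp
  rw [e, div_le_iff₀ hρ]
  have h2 : η ≤ k ^ 4 * η := le_mul_of_one_le_left hη.le (one_le_pow₀ h.one_le)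
  have h3 := mul_le_mul_of_nonneg_left h1 (show 0 ≤ k ^ 4 by positivity)
  have e4 : k ^ 4 * (η + (1 - -1) * (ρ ^ 3 / k ^ 4)) = k ^ 4 * η + 2 * ρ ^ 3 := by
    field_simp; ring
  rw [e4] at h3
  have : 0 < ρ ^ 3 := by positivity
  linarith

end EdgeData

end Dyson

/-! ### Continuity in the spectral parameter. -/

namespace Dyson

open BlockMat SuperOp

variable {n : ℕ}

section Continuity

variable {k : ℝ} {S : Matrix (Fin n) (Fin n) ℝ} {z : ℂ} {ρ : ℝ → ℝ}
  {v a u : ℝ → Fin n ⊕ Fin n → ℝ} {s : Set ℝ}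

theorem continuousOn_edgeOp (S : Matrix (Fin n) (Fin n) ℝ) (hv : ContinuousOn v s)
    (hu : ContinuousOn u s) (σ : ℝ) : ContinuousOn (fun η => edgeOp S (v η) (u η) σ) s := by
  have hv' := continuousOn_pi.1 hv
  have hu' := continuousOn_pi.1 hu
  refine continuousOn_pi.2 fun i => continuousOn_pi.2 fun j => ?_
  simp only [edgeOp, Matrix.of_apply]
  exact (((hu' i).sub ((hv' i).mul (hv' i.swap))).mul continuousOn_const).add
    ((continuousOn_const.mul ((hv' i).pow 2)).mul continuousOn_const)

theorem continuousOn_symS_mulVec (S : Matrix (Fin n) (Fin n) ℝ) (hv : ContinuousOn v s) :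
    ContinuousOn (fun η => symS S *ᵥ v η) s := by
  have hc : Continuous fun x : Fin n ⊕ Fin n → ℝ => symS S *ᵥ x := by fun_prop
  exact hc.comp_continuousOn hv

theorem continuousOn_edgeU (S : Matrix (Fin n) (Fin n) ℝ) {zz : ℝ} (hv : ContinuousOn v s)
    (h0 : ∀ η ∈ s, ∀ i, edgeA S η (v η) i * edgeA S η (v η) i.swap + zz ≠ 0) :
    ContinuousOn (fun η => edgeU S zz η (v η)) s := by
  have h1 := continuousOn_pi.1 (continuousOn_symS_mulVec S hv)
  have h2 : ∀ i, ContinuousOn (fun η => edgeA S η (v η) i) s := fun i =>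
    continuousOn_id.add (h1 i)
  refine continuousOn_pi.2 fun i => ?_
  exact (((h2 i).mul (h2 i.swap)).add continuousOn_const).inv₀ fun η hη => h0 η hη i

theorem continuousOn_twoDiag {c d : ℝ → Fin n ⊕ Fin n → ℂ} (hc : ContinuousOn c s)
    (hd : ContinuousOn d s) : ContinuousOn (fun η => twoDiag (c η) (d η)) s := by
  have h : Continuous fun p : (Fin n ⊕ Fin n → ℂ) × (Fin n ⊕ Fin n → ℂ) => twoDiag p.1 p.2 := by
    unfold twoDiag
    fun_prop
  exact h.comp_continuousOn (hc.prodMk hd)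

theorem continuousOn_ofReal {x : ℝ → Fin n ⊕ Fin n → ℝ} (hx : ContinuousOn x s) :
    ContinuousOn (fun η i => (x η i : ℂ)) s := by
  have hx' := continuousOn_pi.1 hx
  exact continuousOn_pi.2 fun i => Complex.continuous_ofReal.comp_continuousOn (hx' i)

theorem continuousOn_edgeMat (z : ℂ) (hv : ContinuousOn v s) (hu : ContinuousOn u s) (c : ℂ) :
    ContinuousOn (fun η => edgeMat z (v η) (u η) c) s := by
  have hv' := continuousOn_pi.1 (continuousOn_ofReal hv)
  have hu' := continuousOn_pi.1 (continuousOn_ofReal hu)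
  exact continuousOn_twoDiag (continuousOn_pi.2 fun i => continuousOn_const.mul (hv' i))
    (continuousOn_pi.2 fun i => (continuousOn_const.mul (hu' i)).neg)

theorem continuousOn_diagonal_ofReal {x : ℝ → Fin n ⊕ Fin n → ℝ} (hx : ContinuousOn x s) :
    ContinuousOn (fun η => (Matrix.diagonal fun i => (x η i : ℂ) : BlockMat n)) s :=
  (Continuous.matrix_diagonal continuous_id).comp_continuousOn (continuousOn_ofReal hx)

theorem continuousOn_liftVec (S : Matrix (Fin n) (Fin n) ℝ) {M : ℝ → BlockMat n} {t : ℝ → ℝ}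
    {x : ℝ → Fin n ⊕ Fin n → ℝ} (hM : ContinuousOn M s) (ht : ContinuousOn t s)
    (hx : ContinuousOn x s) (ht1 : ∀ η ∈ s, t η < 1) :
    ContinuousOn (fun η => liftVec S (M η) (t η) (x η)) s := by
  have h1 := continuousOn_diagonal_ofReal (continuousOn_symS_mulVec S hx)
  have ht' : ContinuousOn (fun η => 1 - t η) s := continuousOn_const.sub ht
  have h2 : ContinuousOn (fun η => ((1 - t η : ℝ) : ℂ)⁻¹) s :=
    (Complex.continuous_ofReal.comp_continuousOn ht').inv₀
      fun η hη => Complex.ofReal_ne_zero.2 (sub_pos.2 (ht1 η hη)).ne'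
  have hc : Continuous fun p : ℂ × BlockMat n × BlockMat n => p.1 • (p.2.1 * p.2.2 * p.2.1) := by
    fun_prop
  exact hc.comp_continuousOn (h2.prodMk (hM.prodMk h1))

theorem continuousOn_edgeVec (hv : ContinuousOn v s) (hu : ContinuousOn u s)
    (h : ∀ η ∈ s, EdgeData k S (‖z‖ ^ 2) η (ρ η) (v η) (a η) (u η))
    (hδ : ∀ η ∈ s, 40000 * k ^ 29 * (ρ η ^ 2 + η / ρ η) ≤ 1) :
    ContinuousOn (fun η => edgeVec S (v η) (u η)) s ∧
      ContinuousOn (fun η => edgeVal S (v η) (u η)) s := by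
  -- Perron's theorem needs a nonempty index set; otherwise the edge data force the parameter set to
  -- be empty.
  rcases isEmpty_or_nonempty (Fin n ⊕ Fin n) with hn | hn
  · have hs : s = ∅ := by
      refine Set.eq_empty_of_forall_notMem fun η hη => ?_
      exact hn.false (Sum.inl ⟨0, (h η hη).n_pos⟩)
    simp [hs]
  have hpos : ∀ η ∈ s, ∀ i j, 0 < edgeOp S (v η) (u η) 1 i j := fun η hη =>
    (h η hη).edgeOp_one_pos (hδ η hη)
  have hc := continuousOn_edgeOp S hv hu 1
  exact ⟨(Matrix.continuousOn_perronVec hc hpos).const_smul (2 * n * Real.pi : ℝ),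
    continuousOn_const.sub (Matrix.continuousOn_perronVal hc hpos)⟩

theorem continuousOn_deflVec (hv : ContinuousOn v s) (hu : ContinuousOn u s)
    (h : ∀ η ∈ s, EdgeData k S (‖z‖ ^ 2) η (ρ η) (v η) (a η) (u η))
    (hδ : ∀ η ∈ s, 40000 * k ^ 29 * (ρ η ^ 2 + η / ρ η) ≤ 1) :
    ContinuousOn (fun η => deflVec k S (v η) (u η)) s ∧
      ContinuousOn (fun η => deflVal k S (v η) (u η)) s := by
  rcases isEmpty_or_nonempty (Fin n ⊕ Fin n) with hn | hn
  · have hs : s = ∅ := by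
      refine Set.eq_empty_of_forall_notMem fun η hη => ?_
      exact hn.false (Sum.inl ⟨0, (h η hη).n_pos⟩)
    simp [hs]
  have hpos : ∀ η ∈ s, ∀ i j, 0 < deflOp k S (v η) (u η) i j := fun η hη =>
    (h η hη).deflOp_pos (hδ η hη)
  have hc : ContinuousOn (fun η => deflOp k S (v η) (u η)) s := by
    have h1 := continuousOn_edgeOp S hv hu (-1)
    have h2 := continuousOn_pi.1
      (continuousOn_symS_mulVec S (continuousOn_edgeVec hv hu h hδ).1)
    have hv' := continuousOn_pi.1 hv
    refine continuousOn_pi.2 fun i => continuousOn_pi.2 fun j => ?_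
    have h3 : ContinuousOn (fun η => edgeOp S (v η) (u η) (-1) i j) s :=
      continuousOn_pi.1 (continuousOn_pi.1 h1 i) j
    exact h3.sub ((continuousOn_const.mul (continuousOn_const.mul ((hv' i).pow 2))).mul
      (continuousOn_const.mul (h2 j)))
  exact ⟨(Matrix.continuousOn_perronVec hc hpos).const_smul (2 * n * Real.pi : ℝ),
    continuousOn_const.sub (Matrix.continuousOn_perronVal hc hpos)⟩

theorem continuousOn_signVec (hv : ContinuousOn v s) (hu : ContinuousOn u s)
    (h : ∀ η ∈ s, EdgeData k S (‖z‖ ^ 2) η (ρ η) (v η) (a η) (u η))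
    (hδ : ∀ η ∈ s, 40000 * k ^ 29 * (ρ η ^ 2 + η / ρ η) ≤ 1) :
    ContinuousOn (fun η => signVec S (v η) (u η)) s := by
  have h1 := continuousOn_pi.1 (continuousOn_edgeVec hv hu h hδ).1
  exact continuousOn_pi.2 fun i => continuousOn_const.mul (h1 i)

end Continuity

/-! ### Choice of constants and assembly of the proposition. -/

/-- The data at the spectral edge that belong to a solution of the Dyson equation. -/
theorem IsSolution.edgeData {sLow sUp τ : ℝ} (hsLow : 0 < sLow) (hsUp : sLow < sUp)
    (hn : 0 < n) {S : Matrix (Fin n) (Fin n) ℝ} (hS : IsFlat sLow sUp S) {z : ℂ} (hz : ‖z‖ < τ)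
    {η r : ℝ} (hη : 0 < η) {M : BlockMat n} (h : IsSolution S z η M)
    (hr : density M + η / density M ≤ r) (hr1 : r ≤ 1)
    (hr2 : r ≤ 1 / (40000 * edgeConst sLow sUp τ ^ 29))
    (hr3 : r ≤ sLow / (2 * (1 + sUp * Real.pi) ^ 2)) (hk : 0 < edgeConst sLow sUp τ) :
    EdgeData (edgeConst sLow sUp τ) S (‖z‖ ^ 2) η (density M) (diagIm M)
        (edgeA S η (diagIm M)) (edgeU S (‖z‖ ^ 2) η (diagIm M)) ∧
      40000 * edgeConst sLow sUp τ ^ 29 * (density M ^ 2 + η / density M) ≤ 1 := by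
  have hS0 : ∀ i j, 0 ≤ S i j := fun i j => le_trans (by positivity) (hS i j).1
  obtain ⟨h1, -, -⟩ := h.structure hS0 hη
  have : Nonempty (Fin n ⊕ Fin n) := ⟨Sum.inl ⟨0, hn⟩⟩
  have hn' : (0 : ℝ) < n := by exact_mod_cast hn
  have hρ : 0 < density M := by
    rw [density_eq]
    have := Finset.sum_pos (fun i (_ : i ∈ Finset.univ) => h1.1 i) Finset.univ_nonempty
    have := Real.pi_pos
    positivity
  have hηρ : 0 < η / density M := by positivity
  have hsUp0 : 0 < 1 + sUp * Real.pi := by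
    have := Real.pi_pos
    have := hsLow.trans hsUp
    positivity
  refine ⟨edgeData_of_isPosSolution hsLow hsUp hn hS (by positivity)
    (pow_le_pow_left₀ (norm_nonneg z) hz.le 2) hη h1 (density_eq M) (by linarith) (by linarith) ?_,
    ?_⟩
  · have h2 : density M ≤ sLow / (2 * (1 + sUp * Real.pi) ^ 2) := by linarith
    rw [le_div_iff₀ (by positivity)] at h2
    linarith
  · have h2 : density M ^ 2 ≤ density M := by nlinarith
    have h3 : density M ^ 2 + η / density M ≤ 1 / (40000 * edgeConst sLow sUp τ ^ 29) := by
      linarith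
    rw [le_div_iff₀ (by positivity)] at h3
    linarith

theorem one_le_edgeConst {sLow sUp : ℝ} (τ : ℝ) (hsLow : 0 < sLow) (hsUp : sLow < sUp) :
    1 ≤ edgeConst sLow sUp τ := by
  have hpi := Real.pi_pos
  have hsUp0 : 0 < sUp := hsLow.trans hsUp
  have h1 : 0 < 1 / sLow := by positivity
  have h2 : 0 < 2 / sLow := by positivity
  have h3 : 0 < (1 + sUp * Real.pi) ^ 2 + τ ^ 2 := by positivity
  have h4 : 0 < 1 / (sLow * Real.pi) := by positivity
  have h5 : 0 < 1 + sUp * Real.pi := by positivity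
  have h6 : 0 < ((1 + sUp * Real.pi) ^ 2 + τ ^ 2) / (sLow * Real.pi) := by positivity
  have h7 : 0 < 2 / sLow * (1 + sUp * Real.pi) := by positivity
  unfold edgeConst
  linarith

end Dyson

open BlockMat SuperOp Dyson in
theorem proposition3p1 (sLow sUp τ : ℝ) (hsLow : 0 < sLow) (hsUp : sLow < sUp) (hτ : 1 < τ) :
    ∃ ρs : ℝ, 0 < ρs ∧ ∃ ε : ℝ, 0 < ε ∧ ∃ C : ℝ, 0 < C ∧
      ∀ (n : ℕ), 0 < n → ∀ S : Matrix (Fin n) (Fin n) ℝ, IsFlat sLow sUp S →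
      ∀ z : ℂ, ‖z‖ < τ →
      ∀ M : ℝ → BlockMat n, (∀ η ∈ Set.Ioc (0 : ℝ) 1, IsSolution S z η (M η)) →
      ∃ (β βs : ℝ → ℂ) (B Bs Bhat Bshat : ℝ → BlockMat n),
        -- continuity in `η` for fixed `z`
        ContinuousOn β (regime M ρs) ∧ ContinuousOn βs (regime M ρs) ∧
        ContinuousOn B (regime M ρs) ∧ ContinuousOn Bs (regime M ρs) ∧
        ContinuousOn Bhat (regime M ρs) ∧ ContinuousOn Bshat (regime M ρs) ∧
        ∀ η ∈ regime M ρs, ∀ (ρ : ℝ), ρ = density (M η) →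
          ∀ 𝓑 : SuperOp n, 𝓑 = stabOp S (M η) →
          -- the small eigenvalues, their multiplicities and their sizes
          spectrum ℂ 𝓑 ∩ Metric.ball 0 ε = {β η, βs η} ∧
          Module.finrank ℂ (𝓑.eigenspace (β η)) = 1 ∧
          Module.finrank ℂ (𝓑.eigenspace (βs η)) = 1 ∧
          𝓑.charpoly.rootMultiplicity (β η) = 1 ∧
          𝓑.charpoly.rootMultiplicity (βs η) = 1 ∧
          0 < ‖βs η‖ ∧ ‖βs η‖ < ‖β η‖ ∧
          Comparable C ‖βs η‖ (η / ρ) ∧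
          Comparable C ‖β η‖ (η / ρ + ρ ^ 2) ∧
          -- right and left eigenvectors
          𝓑 (Bs η) = βs η • Bs η ∧
          𝓑 (B η) = β η • B η ∧
          hsAdjoint 𝓑 (Bshat η) = (starRingEnd ℂ) (βs η) • Bshat η ∧
          hsAdjoint 𝓑 (Bhat η) = (starRingEnd ℂ) (β η) • Bhat η ∧
          -- expansions of the eigenvectors
          opNorm (B η - ((ρ⁻¹ : ℂ) • imPart (M η) - (2 * Complex.I * (ρ⁻¹ : ℂ)) •
            (imPart (M η) * imPart (M η)⁻¹ * rePart (M η)))) ≤ C * (ρ ^ 2 + η / ρ) ∧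
          opNorm (Bs η - (ρ⁻¹ : ℂ) • (Eminus n * imPart (M η))) ≤ C * (ρ ^ 2 + η / ρ) ∧
          opNorm (Bhat η - -((ρ⁻¹ : ℂ) • imPart (M η)⁻¹)) ≤ C * (ρ ^ 2 + η / ρ) ∧
          opNorm (Bshat η - -((ρ⁻¹ : ℂ) • (Eminus n * imPart (M η)⁻¹))) ≤
            C * (ρ ^ 2 + η / ρ) ∧
          -- expansions of the eigenvalues
          ‖β η * hsInner (Bhat η) (B η) -
              ((Real.pi * η * ρ⁻¹ + 2 * ρ ^ 2 * psi (M η) : ℝ) : ℂ)‖ ≤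
            C * (ρ ^ 3 + η * ρ + η ^ 2 / ρ ^ 2) ∧
          ‖βs η * hsInner (Bshat η) (Bs η) - ((Real.pi * η * ρ⁻¹ : ℝ) : ℂ)‖ ≤
            C * (ρ ^ 3 + η * ρ + η ^ 2 / ρ ^ 2) ∧
          Comparable C (psi (M η)) 1 ∧
          Comparable C ‖hsInner (Bhat η) (B η)‖ 1 ∧
          Comparable C ‖hsInner (Bshat η) (Bs η)‖ 1 ∧
          -- boundedness on the complementary spectral subspace
          IsUnit 𝓑 ∧ IsUnit (hsAdjoint 𝓑) ∧
          ∀ 𝓠 : SuperOp n, 𝓠 = spectralProjection 𝓑 (spectrum ℂ 𝓑 \ {β η, βs η}) →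
            superNorm (Ring.inverse 𝓑 * 𝓠) +
              superNorm (Ring.inverse (hsAdjoint 𝓑) * hsAdjoint 𝓠) ≤ C := by
  set k := edgeConst sLow sUp τ with hk_def
  have hk1 : 1 ≤ k := one_le_edgeConst τ hsLow hsUp
  have hk : 0 < k := one_pos.trans_le hk1
  have hsUp0 : 0 < 1 + sUp * Real.pi := by
    have := Real.pi_pos
    have := hsLow.trans hsUp
    positivity
  have hC : ∀ {c X : ℝ} {m : ℕ}, 0 ≤ X → 0 ≤ c → c ≤ 160000 → m ≤ 32 →
      c * k ^ m * X ≤ 160000 * k ^ 32 * X := by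
    intro c X m hX hc0 hc hm
    have : k ^ m ≤ k ^ 32 := pow_le_pow_right₀ hk1 hm
    gcongr
  -- The three terms of the threshold ensure in turn `ρ ≤ 1` and `η / ρ ≤ 1`, smallness of `δ`
  -- (through `ρ² ≤ ρ`), and a lower bound on `|z|²`. The last constant `160000 k³²` dominates all
  -- those in the separate estimates.
  refine ⟨min 1 (min (1 / (40000 * k ^ 29)) (sLow / (2 * (1 + sUp * Real.pi) ^ 2))),
    by positivity, 1 / (73 * k ^ 15), by positivity, 160000 * k ^ 32, by positivity, ?_⟩
  set r := min 1 (min (1 / (40000 * k ^ 29)) (sLow / (2 * (1 + sUp * Real.pi) ^ 2))) with hr_def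
  have hr1 : r ≤ 1 := min_le_left _ _
  have hr2 : r ≤ 1 / (40000 * k ^ 29) := (min_le_right _ _).trans (min_le_left _ _)
  have hr3 : r ≤ sLow / (2 * (1 + sUp * Real.pi) ^ 2) := (min_le_right _ _).trans (min_le_right _ _)
  intro n hn S hS z hz M hM
  have hS0 : ∀ i j, 0 ≤ S i j := fun i j => le_trans (by positivity) (hS i j).1
  set v : ℝ → Fin n ⊕ Fin n → ℝ := fun η => diagIm (M η)
  set u : ℝ → Fin n ⊕ Fin n → ℝ := fun η => edgeU S (‖z‖ ^ 2) η (v η)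
  have hdata : ∀ η ∈ regime M r, EdgeData k S (‖z‖ ^ 2) η (density (M η)) (v η)
      (edgeA S η (v η)) (u η) ∧
      40000 * k ^ 29 * (density (M η) ^ 2 + η / density (M η)) ≤ 1 := fun η hη =>
    (hM η hη.1).edgeData hsLow hsUp hn hS hz hη.1.1 hη.2 hr1 hr2 hr3 hk
  have hE := fun η hη => (hdata η hη).1
  have hD := fun η hη => (hdata η hη).2
  have hv : ContinuousOn v (regime M r) := continuousOn_of_isPosSolution hS0 (by positivity)
    (fun η hη => hη.1.1) fun η hη => ((hM η hη.1).structure hS0 hη.1.1).1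
  have hu : ContinuousOn u (regime M r) := continuousOn_edgeU S hv fun η hη i h0 => by
    have := (hE η hη).u_eq i
    rw [h0, mul_zero] at this
    exact zero_ne_one this
  have hMc := continuousOn_edgeMat z hv hu Complex.I
  have hg := continuousOn_edgeVec hv hu hE hD
  have hh := continuousOn_deflVec hv hu hE hD
  have hsg := continuousOn_signVec hv hu hE hD
  refine ⟨fun η => (deflVal k S (v η) (u η) : ℂ), fun η => (edgeVal S (v η) (u η) : ℂ),
    fun η => rightVec k S z (v η) (u η), fun η => rightVecSign S z (v η) (u η),
    fun η => leftVec k S (v η) (u η), fun η => leftVecSign S (v η) (u η),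
    Complex.continuous_ofReal.comp_continuousOn hh.2,
    Complex.continuous_ofReal.comp_continuousOn hg.2,
    continuousOn_liftVec S hMc hh.2 hh.1 fun η hη => (hE η hη).deflVal_lt_one (hD η hη),
    continuousOn_liftVec S hMc hg.2 hsg fun η hη => (hE η hη).edgeVal_lt_one (hD η hη),
    continuousOn_diagonal_ofReal (continuousOn_symS_mulVec S hh.1), ?_, ?_⟩
  · have h1 := continuousOn_pi.1 (continuousOn_symS_mulVec S hg.1)
    exact continuousOn_diagonal_ofReal
      (x := fun η i => blockSign n i * (symS S *ᵥ edgeVec S (v η) (u η)) i)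
      (continuousOn_pi.2 fun i => continuousOn_const.mul (h1 i))
  rintro η hη ρ hρ 𝓑 h𝓑
  have h := hE η hη
  have hδ := hD η hη
  obtain ⟨-, hMinv, hMeq⟩ := (hM η hη.1).structure hS0 hη.1.1
  have hMe : M η = edgeMat z (v η) (u η) Complex.I := hMeq
  have hIinv : imPart (M η)⁻¹ = twoDiag (fun i => -(edgeA S η (v η) i : ℂ)) fun _ => 0 := by
    rw [hMinv]
    exact imPart_neg_twoDiag_offDiag z (edgeA S η (v η))
  have hpsi : psi (M η) = (density (M η) ^ 4)⁻¹ *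
      ((2 * (n : ℝ))⁻¹ * ∑ i, (v η i * edgeA S η (v η) i) ^ 2) := by
    rw [psi, hIinv]
    conv_lhs => rw [hMe, imPart_edgeMat h.u_swap, EdgeData.avg_sq, ← hMe]
  rw [← hρ] at h hδ hpsi
  subst h𝓑
  rw [hIinv, hpsi]
  rw [hMe]
  have hρ0 := h.ρ_pos
  have hη0 := h.η_pos
  have hδ0 : 0 ≤ ρ ^ 2 + η / ρ := by positivity
  have hE0 : 0 ≤ ρ ^ 3 + η * ρ + η ^ 2 / ρ ^ 2 := by positivity
  have hp := h.isolatedPair hδ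
  have hβ := h.deflVal_pos hδ
  have hβs := h.edgeVal_pos hδ
  have hβn : ‖(deflVal k S (v η) (u η) : ℂ)‖ = deflVal k S (v η) (u η) := by
    rw [Complex.norm_real, Real.norm_of_nonneg hβ.le]
  have hβsn : ‖(edgeVal S (v η) (u η) : ℂ)‖ = edgeVal S (v η) (u η) := by
    rw [Complex.norm_real, Real.norm_of_nonneg hβs.le]
  have hone : ∀ {c X : ℝ} {m : ℕ}, 0 < c → c ≤ 160000 → m ≤ 32 → 1 / (c * k ^ m) ≤ X →
      1 ≤ 160000 * k ^ 32 * X := by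
    intro c X m hc0 hc hm hX
    have hX0 : 0 ≤ X := le_trans (by positivity) hX
    rw [div_le_iff₀ (by positivity)] at hX
    linarith [hC hX0 hc0.le hc hm]
  have hcomp : ∀ {X : ℝ}, 1 / (4 * k ^ 3) ≤ X → X ≤ 8 * k ^ 3 →
      Comparable (160000 * k ^ 32) X 1 := by
    intro X h1 h2
    have h3 := hC (c := 8) (X := 1) (m := 3) zero_le_one (by norm_num) (by norm_num) (by norm_num)
    exact ⟨by linarith, hone (by norm_num) (by norm_num) (by norm_num) h1⟩
  refine ⟨hp.spectrum_inter_ball, hp.finrank_eigenspace, hp.symm.finrank_eigenspace,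
    hp.rootMultiplicity, hp.symm.rootMultiplicity, ?_, ?_, ?_, ?_, h.stabOp_rightVecSign hδ,
    h.stabOp_rightVec hδ, ?_, ?_, ?_, ?_, ?_, ?_, ?_, ?_, ?_, ?_, ?_, h.isUnit_stabOp hδ,
    h.isUnit_hsAdjoint_stabOp hδ, ?_⟩
  · rwa [hβsn]
  · rw [hβn, hβsn]
    exact h.edgeVal_lt_deflVal hδ
  · have h1 := h.edgeVal_comparable hδ
    rw [hβsn]
    have h2 : 0 ≤ η / ρ := by positivity
    have h3 := hC (c := 1) (m := 1) h2 (by norm_num) (by norm_num) (by norm_num)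
    have h4 := hC (c := 1) (m := 1) hβs.le (by norm_num) (by norm_num) (by norm_num)
    rw [one_mul, pow_one] at h3 h4
    exact ⟨h1.1.trans h3, h1.2.trans h4⟩
  · rw [hβn, add_comm (η / ρ)]
    refine ⟨(h.deflVal_le hδ).trans (hC hδ0 (by norm_num) (by norm_num) (by norm_num)), ?_⟩
    have h4 := hC (c := 1) (m := 5) hβ.le (by norm_num) (by norm_num) (by norm_num)
    rw [one_mul] at h4
    exact (h.le_deflVal hδ).trans h4
  · rw [Complex.conj_ofReal]
    exact h.hsAdjoint_stabOp_leftVecSign hδ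
  · rw [Complex.conj_ofReal]
    exact h.hsAdjoint_stabOp_leftVec hδ
  · exact (h.rightVec_approx hδ).trans (hC hδ0 (by norm_num) (by norm_num) (by norm_num))
  · exact (h.rightVecSign_approx hδ).trans (hC hδ0 (by norm_num) (by norm_num) (by norm_num))
  · exact (h.leftVec_approx hδ).trans (hC hδ0 (by norm_num) (by norm_num) (by norm_num))
  · exact (h.leftVecSign_approx hδ).trans (hC hδ0 (by norm_num) (by norm_num) (by norm_num))
  · have h1 := h.eigenvalue_mul_pairing hδ (σ := -1) (by norm_num) (h.deflVec_spec hδ).1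
      (h.deflVec_spec hδ).2.1 (h.deflVec_spec hδ).2.2 (h.deflVec_approx hδ)
    rw [h.hsInner_leftVec_rightVec hδ, ← Complex.ofReal_mul, ← Complex.ofReal_sub,
      Complex.norm_real, Real.norm_eq_abs]
    refine le_of_eq_of_le (congrArg _ ?_) h1
    ring
  · have h1 := h.eigenvalue_mul_pairing hδ (σ := 1) (by norm_num) (h.edgeVec_spec hδ).1
      (h.edgeVec_spec hδ).2.1 (h.edgeVec_spec hδ).2.2 (h.edgeVec_approx hδ)
    rw [sub_self, zero_mul, add_zero] at h1
    rwa [h.hsInner_leftVecSign_rightVecSign hδ, ← Complex.ofReal_mul, ← Complex.ofReal_sub,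
      Complex.norm_real, Real.norm_eq_abs]
  · have h1 := h.psi_bounds
    refine ⟨h1.2.trans ?_, hone (c := 1) (m := 4) (by norm_num) (by norm_num) (by norm_num) ?_⟩
    · have h2 := hC (c := 1) (X := 1) (m := 4) zero_le_one (by norm_num) (by norm_num) (by norm_num)
      linarith
    · rw [one_mul]; exact h1.1
  · exact hcomp (h.norm_pairing hδ).1 (h.norm_pairing hδ).2
  · exact hcomp (h.norm_pairingSign hδ).1 (h.norm_pairingSign hδ).2
  · rintro 𝓠 rfl
    have h1 := h.superNorm_inverse_mul_spectralProjection hδ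
    -- Both norms have the bound `74825 k²⁴`; the constant 149650 below is twice 74825.
    have h2 := h.superNorm_inverse_mul_hsAdjoint_spectralProjection hδ
    have h3 := hC (c := 149650) (X := 1) (m := 24) zero_le_one (by norm_num) (by norm_num)
      (by norm_num)
    linarith
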